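/- **Notation.** Let $\mathbb{D}=\{z\in\mathbb{C}:|z|<1\}$, $\overline{\mathbb{D}}$ its closure and $\mathbb{T}=\partial\mathbb{D}$. With $\partial_z=\frac12(\partial_x-i\partial_y)$ and $\partial_{\bar z}=\frac12(\partial_x+i\partial_y)$, put $$\Delta_\alpha f(z)=\partial_z\big[(1-|z|^2)^{-\alpha}\,\partial_{\bar z}f\big](z),\qquad z\in\mathbb{D},$$ and, for $u\in\mathcal{C}(\mathbb{T})$, $$\mathcal{P}_\alpha[u](z)=\frac1{2\pi}\int_0^{2\pi}P_\alpha(ze^{-i\theta})\,u(e^{i\theta})\,d\theta,\qquad P_\alpha(z)=\frac{(1-|z|^2)^{\alpha+1}}{(1-z)(1-\bar z)^{\alpha+1}}.$$ We say that $f$ solves the Dirichlet problem with data $(g,f^*)$ if $\Delta_\alpha f=g$ in $\mathbb{D}$ and $f=f^*$ on $\mathbb{T}$, the latter in the sense that the functions $f_r(e^{i\theta})=f(re^{i\theta})$ converge to $f^*$ in $\mathcal{D}'(\mathbb{T})$ as $r\to1^-$; at the points of $\mathbb{T}$ the value of $f$ is that of $f^*$. Let $\|f^*\|_\infty=\sup_{z\in\mathbb{T}}|f^*(z)|$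 and $\|g\|_\infty=\sup_{z\in\mathbb{D}}|g(z)|$. **Theorem 2.1.** Let $\alpha\ge0$, let $g:\overline{\mathbb{D}}\to\mathbb{C}$ be continuous and let $f^*\in\mathcal{C}^1(\mathbb{T})$ be complex-valued. If $f\in\mathcal{C}^2(\mathbb{D})$ is a complex-valued solution of the Dirichlet problem with data $(g,f^*)$ and $\mathcal{P}_\alpha[f^*](0)=0$, then for all $z\in\overline{\mathbb{D}}$, $$|f(z)|\le 2^\alpha\Big[\frac4\pi\,\|f^*\|_\infty\arctan|z|+\|g\|_\infty(1-|z|^2)^{\alpha+1}\Big].$$ The inequality is sharp: for $\alpha=0$, a constant $C>0$, $g\equiv-C$ and $f^*\equiv0$, the function $f(z)=C(1-|z|^2)$ satisfies all the hypotheses, and equality holds for every $z\in\overline{\mathbb{D}}$. -/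

import Mathlib

open Complex Filter Topology MeasureTheory
open scoped ContDiff Manifold

noncomputable section

/-- The Wirtinger derivative `∂_z F = (1/2) (∂F/∂x - i ∂F/∂y)`. -/
def wirtingerD (F : ℂ → ℂ) (z : ℂ) : ℂ :=
  (1 / 2 : ℂ) * (fderiv ℝ F z 1 - I * fderiv ℝ F z I)

/-- The Wirtinger derivative `∂_{z̄} F = (1/2) (∂F/∂x + i ∂F/∂y)`. -/
def wirtingerDbar (F : ℂ → ℂ) (z : ℂ) : ℂ :=
  (1 / 2 : ℂ) * (fderiv ℝ F z 1 + I * fderiv ℝ F z I)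

/-- The weighted Laplacian `Δ_α f = ∂_z [(1 - |z|²)^{-α} ∂_{z̄} f]` on the unit disc. -/
def weightedLaplacian (α : ℝ) (f : ℂ → ℂ) (z : ℂ) : ℂ :=
  wirtingerD (fun w : ℂ => (((1 - ‖w‖ ^ 2) ^ (-α) : ℝ) : ℂ) * wirtingerDbar f w) z

/-- `f_r → u` in `𝒟'(𝕋)` as `r → 1⁻`, where `f_r(e^{iθ}) = f(r e^{iθ})`: the pairings with every
smooth test function on the unit circle converge. -/
def HasDistribBoundaryValue (f : ℂ → ℂ) (u : Circle → ℂ) : Prop :=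
  ∀ φ : Circle → ℂ, ContMDiff (𝓡 1) 𝓘(ℝ, ℂ) ∞ φ →
    Tendsto
      (fun r : ℝ => ∫ θ in (0 : ℝ)..(2 * Real.pi),
        f ((r : ℂ) * (Circle.exp θ : ℂ)) * φ (Circle.exp θ))
      (𝓝[<] 1)
      (𝓝 (∫ θ in (0 : ℝ)..(2 * Real.pi), u (Circle.exp θ) * φ (Circle.exp θ)))

/-- `f` solves the Dirichlet problem `Δ_α f = g` in `𝔻`, `f = u` on `𝕋`. The boundary condition is
the distributional one; the values of `f` at the points of `𝕋` are, by convention, those of `u`. -/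
structure SolvesDirichlet (α : ℝ) (g : ℂ → ℂ) (u : Circle → ℂ) (f : ℂ → ℂ) : Prop where
  equation : ∀ z ∈ Metric.ball (0 : ℂ) 1, weightedLaplacian α f z = g z
  boundary : HasDistribBoundaryValue f u
  values_on_circle : ∀ ζ : Circle, f (ζ : ℂ) = u ζ

/-- The `α`-harmonic Poisson kernel `P_α(z) = (1 - |z|²)^{α+1} / ((1 - z) (1 - z̄)^{α+1})`. The
complex power is the principal one (`Re (1 - z̄) > 0` on the unit disc). -/
def alphaPoissonKernel (α : ℝ) (z : ℂ) : ℂ :=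
  (((1 - ‖z‖ ^ 2) ^ (α + 1) : ℝ) : ℂ) /
    ((1 - z) * (1 - (starRingEnd ℂ) z) ^ ((α : ℂ) + 1))

/-- `𝒫_α[u](z) = (1/2π) ∫₀^{2π} P_α(z e^{-iθ}) u(e^{iθ}) dθ`. -/
def alphaPoissonIntegral (α : ℝ) (u : Circle → ℂ) (z : ℂ) : ℂ :=
  (1 / (2 * Real.pi) : ℂ) *
    ∫ θ in (0 : ℝ)..(2 * Real.pi),
      alphaPoissonKernel α (z * (Circle.exp (-θ) : ℂ)) * u (Circle.exp θ)

/-- `sup_{z ∈ 𝕋} |u(z)|`. -/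
def supNormCircle (u : Circle → ℂ) : ℝ := ⨆ ζ : Circle, ‖u ζ‖

/-- `sup_{z ∈ 𝔻} |g(z)|`. -/
def supNormDisc (g : ℂ → ℂ) : ℝ := ⨆ z : Metric.ball (0 : ℂ) 1, ‖g z‖

end

/-! The operator `Δ_α` is covariant under disc automorphisms. For `z = e a` with `|e| = 1`, `0 ≤ a <
1`, let `Φ(s) = e (s + a) / (1 + a s)` and `F(s) = (1 + a s)^α f(Φ(s))`, so that `F(0) = f(z)`. Then
`(1 - |s|²)^{-α} ∂̄F` is an antiholomorphic factor times the same expression for `f`, evaluated at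
`Φ`. Hence `F` solves an equation of the same type, and the growth of its circle means can be
integrated explicitly. Comparison with `1 - |Φ|²` (`circle_mean_comparison`, `moebius_mean_bound`)
shows that `f(z)` differs from the mean of `F` over `|s| = R` by at most `2^α ‖g‖ (1 - |z|²)^{α+1}`.

As `R → 1` that mean becomes the mean of `(1 + a e^{iθ})^α U(θ)` with `U = f* ∘ Φ`. The hypothesis
`𝒫_α[f*](0) = 0` says that `f*` has mean zero, that is, `U` is orthogonal to the Poisson kernel `K`
with pole at `-a`. Any multiple of `K` may therefore be subtracted from the weight before absolute
values are taken. `norm_integral_weighted_le` bounds the result by `2^α (4/π) ‖f*‖ arctan a`. For `α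
= 0` this is the sharp harmonic Schwarz lemma. For `α ≥ 1` the excess `(1 + z)^α - 1` is small in
sup norm. For `0 < α < 1` the weight is a convex combination of `1` and the slope `1 + ((1 + z)^α -
1)/α`; an `L²` estimate of the slope with constant `1 + log 2` suffices, since `1 + α log 2 ≤ 2^α`.

The boundary values are attained only as distributions. Therefore `f` is first convolved in the
angle with a nonnegative trigonometric polynomial: only finitely many Fourier coefficients are
involved, so the boundary limit becomes classical (`norm_angularMean_le_of_solution`). The powers of
`cosPeak`, divided by their mass, form an approximate identity, and the bound passes to `f`. -/

/-! ### Wirtinger calculus. -/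

/-- The real-linear map `v ↦ p v + q v̄` with Wirtinger coefficients `p`, `q`. -/
noncomputable def wirtingerForm (p q : ℂ) : ℂ →L[ℝ] ℂ :=
  p • ContinuousLinearMap.id ℝ ℂ + q • (conjCLE : ℂ →L[ℝ] ℂ)

theorem wirtingerForm_apply (p q v : ℂ) :
    wirtingerForm p q v = p * v + q * (starRingEnd ℂ) v := by
  simp [wirtingerForm]

theorem HasFDerivAt.wirtingerD_eq {F : ℂ → ℂ} {p q z : ℂ}
    (h : HasFDerivAt F (wirtingerForm p q) z) : wirtingerD F z = p := by
  rw [wirtingerD, h.fderiv, wirtingerForm_apply, wirtingerForm_apply, map_one, conj_I]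
  linear_combination (-(1 / 2 : ℂ) * (p - q)) * I_mul_I

theorem HasFDerivAt.wirtingerDbar_eq {F : ℂ → ℂ} {p q z : ℂ}
    (h : HasFDerivAt F (wirtingerForm p q) z) : wirtingerDbar F z = q := by
  rw [wirtingerDbar, h.fderiv, wirtingerForm_apply, wirtingerForm_apply, map_one, conj_I]
  linear_combination ((1 / 2 : ℂ) * (p - q)) * I_mul_I

theorem DifferentiableAt.hasFDerivAt_wirtinger {F : ℂ → ℂ} {z : ℂ}
    (h : DifferentiableAt ℝ F z) :
    HasFDerivAt F (wirtingerForm (wirtingerD F z) (wirtingerDbar F z)) z := by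
  convert h.hasFDerivAt using 1
  ext v
  have hv : v = v.re • (1 : ℂ) + v.im • I := by
    simp [re_add_im]
  have h1 : fderiv ℝ F z v = v.re * fderiv ℝ F z 1 + v.im * fderiv ℝ F z I := by
    conv_lhs => rw [hv]
    rw [map_add, map_smul, map_smul]
    simp
  rw [h1, wirtingerForm_apply, wirtingerD, wirtingerDbar]
  have h2 : (starRingEnd ℂ) v = v.re - v.im * I := by
    apply Complex.ext <;> simp
  rw [h2]
  conv_lhs => rw [← re_add_im v]
  simp only [add_re, ofReal_re, mul_re, I_re, mul_zero, ofReal_im, I_im, mul_one, sub_self,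
    add_zero, add_im, mul_im, zero_add]
  linear_combination (-(v.im : ℂ) * fderiv ℝ F z I) * I_mul_I

theorem HasDerivAt.hasFDerivAt_wirtinger {A : ℂ → ℂ} {d z : ℂ} (h : HasDerivAt A d z) :
    HasFDerivAt A (wirtingerForm d 0) z :=
  (h.hasFDerivAt.restrictScalars ℝ).congr_fderiv <| ContinuousLinearMap.ext fun v => by
    simp [wirtingerForm_apply, mul_comm]

theorem hasFDerivAt_conj_wirtinger (z : ℂ) :
    HasFDerivAt (fun w : ℂ => (starRingEnd ℂ) w) (wirtingerForm 0 1) z :=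
  (conjCLE.hasFDerivAt (x := z)).congr_fderiv <| ContinuousLinearMap.ext fun v => by
    simp [wirtingerForm_apply]

theorem HasDerivAt.hasFDerivAt_conj_wirtinger {A : ℂ → ℂ} {d z : ℂ} (h : HasDerivAt A d z) :
    HasFDerivAt (fun w => (starRingEnd ℂ) (A w)) (wirtingerForm 0 ((starRingEnd ℂ) d)) z :=
  ((_root_.hasFDerivAt_conj_wirtinger (A z)).comp z h.hasFDerivAt_wirtinger).congr_fderiv <|
    ContinuousLinearMap.ext fun v => by simp [wirtingerForm_apply]

theorem HasFDerivAt.wirtinger_comp {f Φ : ℂ → ℂ} {p q d z : ℂ}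
    (hf : HasFDerivAt f (wirtingerForm p q) (Φ z)) (hΦ : HasDerivAt Φ d z) :
    HasFDerivAt (fun w => f (Φ w)) (wirtingerForm (p * d) (q * (starRingEnd ℂ) d)) z :=
  (hf.comp z hΦ.hasFDerivAt_wirtinger).congr_fderiv <| ContinuousLinearMap.ext fun v => by
    simp [wirtingerForm_apply, mul_assoc]

theorem HasFDerivAt.wirtinger_mul {F G : ℂ → ℂ} {p q p' q' z : ℂ}
    (hF : HasFDerivAt F (wirtingerForm p q) z) (hG : HasFDerivAt G (wirtingerForm p' q') z) :
    HasFDerivAt (fun w => F w * G w)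
      (wirtingerForm (p * G z + F z * p') (q * G z + F z * q')) z :=
  (hF.mul hG).congr_fderiv <| ContinuousLinearMap.ext fun v => by
    simp [wirtingerForm_apply]
    ring

/-! ### Circle means and their radial derivatives. -/

theorem norm_mul_exp_I (ρ θ : ℝ) : ‖(ρ : ℂ) * exp (θ * I)‖ = |ρ| := by
  rw [norm_mul, norm_exp_ofReal_mul_I, mul_one, norm_real, Real.norm_eq_abs]

theorem conj_exp_I (θ : ℝ) : (starRingEnd ℂ) (exp (θ * I)) = exp (-(θ * I)) := by
  rw [← exp_conj]; simp

theorem continuous_circle_comp {H : ℂ → ℂ} (hH : ContinuousOn H (Metric.ball 0 1)) {ρ : ℝ}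
    (hρ : |ρ| < 1) : Continuous fun θ : ℝ => H (ρ * exp (θ * I)) := by
  refine hH.comp_continuous (by fun_prop) fun θ => ?_
  rw [mem_ball_zero_iff, norm_mul_exp_I]; exact hρ

section CircleMeans

variable {H p q : ℂ → ℂ}

theorem hasDerivAt_circle_integral
    (hH : ∀ z ∈ Metric.ball (0 : ℂ) 1, HasFDerivAt H (wirtingerForm (p z) (q z)) z)
    (hp : ContinuousOn p (Metric.ball 0 1)) (hq : ContinuousOn q (Metric.ball 0 1))
    {ρ : ℝ} (hρ : |ρ| < 1) :
    HasDerivAt (fun r : ℝ => ∫ θ in (0 : ℝ)..(2 * Real.pi), H (r * exp (θ * I)))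
      (∫ θ in (0 : ℝ)..(2 * Real.pi),
        (p (ρ * exp (θ * I)) * exp (θ * I) + q (ρ * exp (θ * I)) * exp (-(θ * I)))) ρ := by
  obtain ⟨R, hR, hR1⟩ := exists_between hρ
  have hsub : Metric.closedBall (0 : ℂ) R ⊆ Metric.ball 0 1 := Metric.closedBall_subset_ball hR1
  obtain ⟨P, hP⟩ := (isCompact_closedBall (0 : ℂ) R).exists_bound_of_continuousOn (hp.mono hsub)
  obtain ⟨Q, hQ⟩ := (isCompact_closedBall (0 : ℂ) R).exists_bound_of_continuousOn (hq.mono hsub)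
  have hHc : ContinuousOn H (Metric.ball 0 1) :=
    fun z hz => (hH z hz).continuousAt.continuousWithinAt
  have hs : {r : ℝ | |r| < R} ∈ 𝓝 ρ :=
    (isOpen_lt continuous_abs continuous_const).mem_nhds hR
  refine (intervalIntegral.hasDerivAt_integral_of_dominated_loc_of_deriv_le
    (F := fun (r : ℝ) (θ : ℝ) => H (r * exp (θ * I)))
    (F' := fun (r : ℝ) (θ : ℝ) =>
      p (r * exp (θ * I)) * exp (θ * I) + q (r * exp (θ * I)) * exp (-(θ * I)))
    (bound := fun _ => P + Q) hs ?_ ?_ ?_ ?_ ?_ ?_).2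
  · filter_upwards [hs] with r hr
    exact (continuous_circle_comp hHc (lt_trans hr hR1)).aestronglyMeasurable
  · exact (continuous_circle_comp hHc hρ).intervalIntegrable _ _
  · refine Continuous.aestronglyMeasurable ?_
    have h1 := continuous_circle_comp hp hρ
    have h2 := continuous_circle_comp hq hρ
    exact (h1.mul (by fun_prop)).add (h2.mul (by fun_prop))
  · refine Eventually.of_forall fun θ _ r hr => ?_
    have hm : (r : ℂ) * exp (θ * I) ∈ Metric.closedBall (0 : ℂ) R := by
      rw [mem_closedBall_zero_iff, norm_mul_exp_I]; exact (show |r| < R from hr).le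
    refine (norm_add_le _ _).trans (add_le_add ?_ ?_)
    · rw [norm_mul, norm_exp_ofReal_mul_I, mul_one]; exact hP _ hm
    · rw [norm_mul, ← conj_exp_I, norm_conj, norm_exp_ofReal_mul_I, mul_one]; exact hQ _ hm
  · exact intervalIntegrable_const
  · refine Eventually.of_forall fun θ _ r hr => ?_
    have hm : (r : ℂ) * exp (θ * I) ∈ Metric.ball (0 : ℂ) 1 := by
      rw [mem_ball_zero_iff, norm_mul_exp_I]; exact lt_trans hr hR1
    have hc : HasDerivAt (fun r : ℝ => (r : ℂ) * exp (θ * I)) (exp (θ * I)) r := by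
      simpa using (ofRealCLM.hasDerivAt (x := r)).mul_const (exp (θ * I))
    have h := (hH _ hm).comp_hasDerivAt r hc
    rwa [wirtingerForm_apply, conj_exp_I] at h

/-- Up to the factor `I`, the integrand is the `θ`-derivative of the `2π`-periodic function `H(ρ
e^{iθ})`. -/
theorem integral_angular_derivative_eq_zero
    (hH : ∀ z ∈ Metric.ball (0 : ℂ) 1, HasFDerivAt H (wirtingerForm (p z) (q z)) z)
    (hp : ContinuousOn p (Metric.ball 0 1)) (hq : ContinuousOn q (Metric.ball 0 1))
    {ρ : ℝ} (hρ : |ρ| < 1) :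
    ∫ θ in (0 : ℝ)..(2 * Real.pi),
      (p (ρ * exp (θ * I)) * (ρ * exp (θ * I)) - q (ρ * exp (θ * I)) * (ρ * exp (-(θ * I))))
      = 0 := by
  have h1 := continuous_circle_comp hp hρ
  have h2 := continuous_circle_comp hq hρ
  have key := intervalIntegral.integral_eq_sub_of_hasDerivAt
    (f := fun θ : ℝ => H (ρ * exp (θ * I)))
    (f' := fun θ : ℝ => I * (p (ρ * exp (θ * I)) * (ρ * exp (θ * I)) -
      q (ρ * exp (θ * I)) * (ρ * exp (-(θ * I))))) (a := 0) (b := 2 * Real.pi)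
    (fun θ _ => by
      have hm : (ρ : ℂ) * exp (θ * I) ∈ Metric.ball (0 : ℂ) 1 := by
        rw [mem_ball_zero_iff, norm_mul_exp_I]; exact hρ
      have hc : HasDerivAt (fun θ : ℝ => (ρ : ℂ) * exp (θ * I)) (ρ * (exp (θ * I) * I)) θ := by
        have h3 : HasDerivAt (fun θ : ℝ => (θ : ℂ) * I) I θ := by
          simpa using (ofRealCLM.hasDerivAt (x := θ)).mul_const I
        exact (h3.cexp).const_mul _
      refine ((hH _ hm).comp_hasDerivAt θ hc).congr_deriv ?_
      rw [wirtingerForm_apply, map_mul, map_mul, conj_exp_I, conj_I, conj_ofReal]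
      ring)
    (((h1.mul (by fun_prop)).sub (h2.mul (by fun_prop))).const_mul I |>.intervalIntegrable _ _)
  rw [intervalIntegral.integral_const_mul] at key
  have h0 : H (ρ * exp ((2 * Real.pi : ℝ) * I)) - H (ρ * exp ((0 : ℝ) * I)) = 0 := by
    push_cast
    rw [exp_two_pi_mul_I]; simp
  rw [h0] at key
  exact (mul_eq_zero.1 key).resolve_left I_ne_zero

theorem intervalIntegrable_circle_mul (hp : ContinuousOn p (Metric.ball 0 1)) {ρ : ℝ}
    (hρ : |ρ| < 1) {e : ℝ → ℂ} (he : Continuous e) (a b : ℝ) :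
    IntervalIntegrable (fun θ : ℝ => p (ρ * exp (θ * I)) * e θ) volume a b :=
  ((continuous_circle_comp hp hρ).mul he).intervalIntegrable _ _

theorem integral_exp_mul_I : ∫ θ in (0 : ℝ)..(2 * Real.pi), exp (θ * I) = 0 := by
  have h := integral_exp_mul_complex (a := 0) (b := 2 * Real.pi) I_ne_zero
  simp only [mul_comm I] at h
  rw [h]
  push_cast
  rw [exp_two_pi_mul_I]; simp

theorem integral_exp_neg_mul_I : ∫ θ in (0 : ℝ)..(2 * Real.pi), exp (-(θ * I)) = 0 := by
  have h := integral_exp_mul_complex (a := 0) (b := 2 * Real.pi) (neg_ne_zero.2 I_ne_zero)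
  simp only [neg_mul, mul_comm I] at h
  rw [h]
  push_cast
  rw [exp_neg, exp_two_pi_mul_I]; simp

theorem circle_integral_z_eq_zbar
    (hH : ∀ z ∈ Metric.ball (0 : ℂ) 1, HasFDerivAt H (wirtingerForm (p z) (q z)) z)
    (hp : ContinuousOn p (Metric.ball 0 1)) (hq : ContinuousOn q (Metric.ball 0 1))
    {ρ : ℝ} (hρ : |ρ| < 1) :
    ∫ θ in (0 : ℝ)..(2 * Real.pi), p (ρ * exp (θ * I)) * exp (θ * I) =
      ∫ θ in (0 : ℝ)..(2 * Real.pi), q (ρ * exp (θ * I)) * exp (-(θ * I)) := by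
  rcases eq_or_ne ρ 0 with rfl | hρ0
  · simp only [ofReal_zero, zero_mul, intervalIntegral.integral_const_mul, integral_exp_mul_I,
      integral_exp_neg_mul_I, mul_zero]
  rw [← sub_eq_zero, ← intervalIntegral.integral_sub
    (intervalIntegrable_circle_mul hp hρ (by fun_prop) _ _)
    (intervalIntegrable_circle_mul hq hρ (by fun_prop) _ _)]
  refine (mul_eq_zero.1 ?_).resolve_left (ofReal_ne_zero.2 hρ0)
  rw [← intervalIntegral.integral_const_mul, ← integral_angular_derivative_eq_zero hH hp hq hρ]
  congr 1; ext θ; ring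

/-- The `∂_z` and `∂_z̄` parts of the radial derivative have equal integrals, so either one alone,
doubled, gives the derivative of the mean. -/
theorem hasDerivAt_circle_integral_zbar
    (hH : ∀ z ∈ Metric.ball (0 : ℂ) 1, HasFDerivAt H (wirtingerForm (p z) (q z)) z)
    (hp : ContinuousOn p (Metric.ball 0 1)) (hq : ContinuousOn q (Metric.ball 0 1))
    {ρ : ℝ} (hρ : |ρ| < 1) :
    HasDerivAt (fun r : ℝ => ∫ θ in (0 : ℝ)..(2 * Real.pi), H (r * exp (θ * I)))
      (2 * ∫ θ in (0 : ℝ)..(2 * Real.pi), q (ρ * exp (θ * I)) * exp (-(θ * I))) ρ := by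
  refine (hasDerivAt_circle_integral hH hp hq hρ).congr_deriv ?_
  rw [intervalIntegral.integral_add (intervalIntegrable_circle_mul hp hρ (by fun_prop) _ _)
    (intervalIntegrable_circle_mul hq hρ (by fun_prop) _ _),
    circle_integral_z_eq_zbar hH hp hq hρ, ← two_mul]

theorem hasDerivAt_circle_integral_z
    (hH : ∀ z ∈ Metric.ball (0 : ℂ) 1, HasFDerivAt H (wirtingerForm (p z) (q z)) z)
    (hp : ContinuousOn p (Metric.ball 0 1)) (hq : ContinuousOn q (Metric.ball 0 1))
    {ρ : ℝ} (hρ : |ρ| < 1) :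
    HasDerivAt (fun r : ℝ => ∫ θ in (0 : ℝ)..(2 * Real.pi), H (r * exp (θ * I)))
      (2 * ∫ θ in (0 : ℝ)..(2 * Real.pi), p (ρ * exp (θ * I)) * exp (θ * I)) ρ := by
  rw [circle_integral_z_eq_zbar hH hp hq hρ]
  exact hasDerivAt_circle_integral_zbar hH hp hq hρ

end CircleMeans

theorem norm_sq_mul_exp_I (ρ θ : ℝ) : ‖(ρ : ℂ) * exp (θ * I)‖ ^ 2 = ρ ^ 2 := by
  rw [norm_mul_exp_I, sq_abs]

theorem mul_exp_I_mem_ball {ρ : ℝ} (hρ : |ρ| < 1) (θ : ℝ) :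
    (ρ : ℂ) * exp (θ * I) ∈ Metric.ball (0 : ℂ) 1 := by
  rw [mem_ball_zero_iff, norm_mul_exp_I]; exact hρ

/-- The derivative of the circle means of `z̄ Ψ(z)`. -/
theorem hasDerivAt_circle_integral_conj_mul {Ψ p q : ℂ → ℂ}
    (hΨ : ∀ z ∈ Metric.ball (0 : ℂ) 1, HasFDerivAt Ψ (wirtingerForm (p z) (q z)) z)
    (hp : ContinuousOn p (Metric.ball 0 1)) (hq : ContinuousOn q (Metric.ball 0 1))
    {ρ : ℝ} (hρ : |ρ| < 1) :
    HasDerivAt (fun r : ℝ => ∫ θ in (0 : ℝ)..(2 * Real.pi),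
        (starRingEnd ℂ) (r * exp (θ * I)) * Ψ (r * exp (θ * I)))
      (2 * ρ * ∫ θ in (0 : ℝ)..(2 * Real.pi), p (ρ * exp (θ * I))) ρ := by
  have hΨc : ContinuousOn Ψ (Metric.ball 0 1) :=
    fun z hz => (hΨ z hz).continuousAt.continuousWithinAt
  have hc : ContinuousOn (fun z : ℂ => (starRingEnd ℂ) z) (Metric.ball 0 1) :=
    continuous_conj.continuousOn
  -- In the `∂_z` form the factor `z̄` is constant, so only `z̄ p` contributes, and `z̄ e^{iθ} = ρ`.
  have h := hasDerivAt_circle_integral_z (H := fun z => (starRingEnd ℂ) z * Ψ z)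
    (fun z hz => (hasFDerivAt_conj_wirtinger z).wirtinger_mul (hΨ z hz))
    ((continuousOn_const.mul hΨc).add (hc.mul hp))
    ((continuousOn_const.mul hΨc).add (hc.mul hq)) hρ
  refine h.congr_deriv ?_
  rw [mul_assoc, ← intervalIntegral.integral_const_mul (ρ : ℂ)]
  refine congrArg (fun w : ℂ => 2 * w) (intervalIntegral.integral_congr fun θ _ => ?_)
  rw [zero_mul, zero_add, map_mul, conj_ofReal, conj_exp_I]
  have : exp (-(θ * I)) * exp (θ * I) = 1 := by rw [← exp_add]; simp
  linear_combination (ρ : ℂ) * p (ρ * exp (θ * I)) * this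

/-! ### Comparison of circle means for the weighted operator. -/

/-- The weight is constant on circles, so the second-order equation becomes two first-order ones.
With `J(r) = ∫ z̄ Ψ`, the integral of `F` over the circle has derivative `2 (1 - r²)^α J / r`, while
`J' = 2r ∫ ∂_z Ψ`; for `F₀` the same holds without weight and with `-κ` as source. The bound on `∂_z
Ψ` gives `|J| ≤ C (1 - r²)^{-α} (-J₀)`; the weight cancels and a second integration finishes. -/
theorem circle_mean_comparison {F pF Ψ pΨ qΨ F₀ p₀ q₀ q₁ : ℂ → ℂ} {κ : ℂ → ℝ} {α C : ℝ}
    (hα : 0 ≤ α) (hC : 0 ≤ C)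
    (hF : ∀ z ∈ Metric.ball (0 : ℂ) 1,
      HasFDerivAt F (wirtingerForm (pF z) (((1 - ‖z‖ ^ 2) ^ α : ℝ) * Ψ z)) z)
    (hpF : ContinuousOn pF (Metric.ball 0 1))
    (hΨ : ∀ z ∈ Metric.ball (0 : ℂ) 1, HasFDerivAt Ψ (wirtingerForm (pΨ z) (qΨ z)) z)
    (hpΨ : ContinuousOn pΨ (Metric.ball 0 1)) (hqΨ : ContinuousOn qΨ (Metric.ball 0 1))
    (hF₀ : ∀ z ∈ Metric.ball (0 : ℂ) 1, HasFDerivAt F₀ (wirtingerForm (p₀ z) (q₀ z)) z)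
    (hp₀ : ContinuousOn p₀ (Metric.ball 0 1))
    (hq₀ : ∀ z ∈ Metric.ball (0 : ℂ) 1, HasFDerivAt q₀ (wirtingerForm (-(κ z : ℂ)) (q₁ z)) z)
    (hκ : ContinuousOn κ (Metric.ball 0 1)) (hq₁ : ContinuousOn q₁ (Metric.ball 0 1))
    (hbd : ∀ z ∈ Metric.ball (0 : ℂ) 1, ‖pΨ z‖ ≤ C * (1 - ‖z‖ ^ 2) ^ (-α) * κ z)
    {R : ℝ} (hR0 : 0 ≤ R) (hR : R < 1) :
    ‖(∫ θ in (0 : ℝ)..(2 * Real.pi), F (R * exp (θ * I))) - 2 * Real.pi * F 0‖ ≤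
      C * (2 * Real.pi * F₀ 0 - ∫ θ in (0 : ℝ)..(2 * Real.pi), F₀ (R * exp (θ * I))).re := by
  have hΨc : ContinuousOn Ψ (Metric.ball 0 1) :=
    fun z hz => (hΨ z hz).continuousAt.continuousWithinAt
  have hq₀c : ContinuousOn q₀ (Metric.ball 0 1) :=
    fun z hz => (hq₀ z hz).continuousAt.continuousWithinAt
  have hwc : ContinuousOn (fun z : ℂ => (((1 - ‖z‖ ^ 2) ^ α : ℝ) : ℂ) * Ψ z)
      (Metric.ball 0 1) := by
    refine ContinuousOn.mul (Complex.continuous_ofReal.comp_continuousOn ?_) hΨc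
    exact ContinuousOn.rpow_const (by fun_prop) fun z _ => Or.inr hα
  have hκc : ContinuousOn (fun z => -(κ z : ℂ)) (Metric.ball 0 1) :=
    (Complex.continuous_ofReal.comp_continuousOn hκ).neg
  set J : ℝ → ℂ := fun r => ∫ θ in (0 : ℝ)..(2 * Real.pi),
        (starRingEnd ℂ) (r * exp (θ * I)) * Ψ (r * exp (θ * I)) with hJ
  set J₀ : ℝ → ℂ := fun r => ∫ θ in (0 : ℝ)..(2 * Real.pi),
        (starRingEnd ℂ) (r * exp (θ * I)) * q₀ (r * exp (θ * I)) with hJ₀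
  have hJ' : ∀ r : ℝ, |r| < 1 → HasDerivAt J
      (2 * r * ∫ θ in (0 : ℝ)..(2 * Real.pi), pΨ (r * exp (θ * I))) r :=
    fun r hr => hasDerivAt_circle_integral_conj_mul hΨ hpΨ hqΨ hr
  have hJ₀' : ∀ r : ℝ, |r| < 1 → HasDerivAt (fun r => (J₀ r).re)
      (-(2 * r * ∫ θ in (0 : ℝ)..(2 * Real.pi), κ (r * exp (θ * I)))) r := fun r hr => by
    have h := hasDerivAt_circle_integral_conj_mul hq₀ hκc hq₁ hr
    have h2 := reCLM.hasFDerivAt.comp_hasDerivAt r h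
    refine h2.congr_deriv ?_
    rw [intervalIntegral.integral_neg, intervalIntegral.integral_ofReal, reCLM_apply,
      mul_neg, neg_re]
    norm_cast
  have hJzero : J 0 = 0 := by simp [hJ]
  have hJ₀zero : J₀ 0 = 0 := by simp [hJ₀]
  have hJbound : ∀ r : ℝ, 0 ≤ r → r < 1 →
      ‖J r‖ ≤ C * (1 - r ^ 2) ^ (-α) * (-(J₀ r).re) := by
    intro r hr0 hr1
    have habs : ∀ x ∈ Set.Icc 0 r, |x| < 1 := fun x hx => by
      rw [abs_of_nonneg hx.1]; exact hx.2.trans_lt hr1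
    -- Since `-α ≤ 0`, the factor `(1 - x²)^{-α}` is at most `(1 - r²)^{-α}` for `x ≤ r`. Freezing
    -- it at `r` makes the majorant a multiple of `-J₀`.
    refine image_norm_le_of_norm_deriv_right_le_deriv_boundary' (a := 0) (b := r) (f := J)
      (B := fun x => C * (1 - r ^ 2) ^ (-α) * (-(J₀ x).re))
      (fun x hx => (hJ' x (habs x hx)).continuousAt.continuousWithinAt)
      (fun x hx => (hJ' x (habs x ⟨hx.1, hx.2.le⟩)).hasDerivWithinAt)
      (by simp [hJzero, hJ₀zero])
      (fun x hx => ((hJ₀' x (habs x hx)).neg.const_mul _).continuousAt.continuousWithinAt)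
      (fun x hx => ((hJ₀' x (habs x ⟨hx.1, hx.2.le⟩)).neg.const_mul _).hasDerivWithinAt)
      (fun x hx => ?_) (Set.right_mem_Icc.2 hr0)
    have hx1 := habs x ⟨hx.1, hx.2.le⟩
    have hx2 : x ^ 2 ≤ r ^ 2 := by
      have := hx.1; have := hx.2.le; gcongr
    have hr2 : 0 < 1 - r ^ 2 := by nlinarith
    have hle : ‖∫ θ in (0 : ℝ)..(2 * Real.pi), pΨ (x * exp (θ * I))‖ ≤
        ∫ θ in (0 : ℝ)..(2 * Real.pi), C * (1 - r ^ 2) ^ (-α) * κ (x * exp (θ * I)) := by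
      refine intervalIntegral.norm_integral_le_of_norm_le (by positivity)
        (Eventually.of_forall fun θ _ => ?_) ?_
      · have h := hbd _ (mul_exp_I_mem_ball hx1 θ)
        rw [norm_sq_mul_exp_I] at h
        -- The sign of `κ` comes from the bound itself when `C > 0`; when `C = 0` the bound forces
        -- `pΨ` to vanish.
        have hpos : 0 < C * (1 - x ^ 2) ^ (-α) ∨ C = 0 := by
          rcases hC.eq_or_lt with h0 | h0
          · exact Or.inr h0.symm
          · exact Or.inl (mul_pos h0 (Real.rpow_pos_of_pos (by linarith) _))
        rcases hpos with hpos | hpos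
        · have hκ0 : 0 ≤ κ (x * exp (θ * I)) :=
            nonneg_of_mul_nonneg_right ((norm_nonneg _).trans h) hpos
          refine h.trans ?_
          gcongr ?_ * _
          refine mul_le_mul_of_nonneg_left ?_ hC
          exact Real.rpow_le_rpow_of_nonpos hr2 (by linarith) (by linarith)
        · simpa [hpos] using h
      · refine (Continuous.const_mul ?_ _).intervalIntegrable _ _
        exact hκ.comp_continuous (by fun_prop) fun θ => mul_exp_I_mem_ball hx1 θ
    rw [intervalIntegral.integral_const_mul] at hle
    rw [norm_mul, norm_mul, norm_real, Real.norm_of_nonneg hx.1, neg_neg]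
    norm_num
    have := mul_le_mul_of_nonneg_left hle (mul_nonneg zero_le_two hx.1)
    linarith
  have habs : ∀ x ∈ Set.Icc 0 R, |x| < 1 := fun x hx => by
    rw [abs_of_nonneg hx.1]; exact hx.2.trans_lt hR
  have hM' := fun x hx => hasDerivAt_circle_integral_zbar hF hpF hwc (habs x hx)
  have hM₀' := fun x hx => reCLM.hasFDerivAt.comp_hasDerivAt x
    (hasDerivAt_circle_integral_zbar hF₀ hp₀ hq₀c (habs x hx))
  have hfun : ∀ x : ℝ, HasDerivAt (fun y : ℝ => y) 1 x := fun x => hasDerivAt_id x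
  have key := image_norm_le_of_norm_deriv_right_le_deriv_boundary' (a := 0) (b := R)
      (f := fun r : ℝ => (∫ θ in (0 : ℝ)..(2 * Real.pi), F (r * exp (θ * I))) -
        2 * Real.pi * F 0)
      (B := fun r : ℝ => C * ((2 * Real.pi * F₀ 0).re -
        (∫ θ in (0 : ℝ)..(2 * Real.pi), F₀ (r * exp (θ * I))).re))
      (fun x hx => ((hM' x hx).sub_const _).continuousAt.continuousWithinAt)
      (fun x hx => ((hM' x ⟨hx.1, hx.2.le⟩).sub_const _).hasDerivWithinAt)
      (by simp)
      (fun x hx => (((hM₀' x hx).const_sub _).const_mul C).continuousAt.continuousWithinAt)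
      (fun x hx => (((hM₀' x ⟨hx.1, hx.2.le⟩).const_sub _).const_mul C).hasDerivWithinAt)
      (fun x hx => ?_) (Set.right_mem_Icc.2 hR0)
  · simpa only [sub_re] using key
  -- The identities `e1`, `e2` carry a factor `x`, so the centre is treated apart; there both
  -- derivatives vanish.
  rcases hx.1.eq_or_lt with h0 | h0
  · rw [← h0]
    simp only [ofReal_zero, zero_mul, intervalIntegral.integral_const_mul,
      integral_exp_neg_mul_I, mul_zero]
    simp
  have hx1 := habs x ⟨hx.1, hx.2.le⟩
  have hx2 : 0 < 1 - x ^ 2 := by nlinarith [hx.2]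
  have e1 : (x : ℂ) * ∫ θ in (0 : ℝ)..(2 * Real.pi),
      (((1 - ‖(x : ℂ) * exp (θ * I)‖ ^ 2) ^ α : ℝ) : ℂ) * Ψ (x * exp (θ * I)) * exp (-(θ * I)) =
      ((1 - x ^ 2) ^ α : ℝ) * J x := by
    rw [← intervalIntegral.integral_const_mul, hJ, ← intervalIntegral.integral_const_mul]
    congr 1; ext θ
    rw [norm_sq_mul_exp_I, map_mul, conj_ofReal, conj_exp_I]
    ring
  have e2 : (x : ℂ) * ∫ θ in (0 : ℝ)..(2 * Real.pi), q₀ (x * exp (θ * I)) * exp (-(θ * I)) =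
      J₀ x := by
    rw [← intervalIntegral.integral_const_mul, hJ₀]
    congr 1; ext θ
    rw [map_mul, conj_ofReal, conj_exp_I]
    ring
  refine le_of_mul_le_mul_left ?_ h0
  have b := mul_le_mul_of_nonneg_left (hJbound x hx.1 (hx.2.trans hR))
    (Real.rpow_nonneg hx2.le α)
  have hrp : (1 - x ^ 2) ^ α * (1 - x ^ 2) ^ (-α) = 1 := by
    rw [← Real.rpow_add hx2]; simp
  have e1n := congrArg norm e1
  rw [norm_mul, norm_mul, norm_real, norm_real, Real.norm_of_nonneg hx.1,
    Real.norm_of_nonneg (Real.rpow_nonneg hx2.le α)] at e1n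
  have e2r := congrArg re e2
  rw [re_ofReal_mul] at e2r
  rw [norm_mul, norm_ofNat, mul_left_comm, e1n, reCLM_apply]
  have : ∀ c : ℂ, (2 * c).re = 2 * c.re := fun c => by simp
  rw [this]
  have e3 : x * (C * -(2 * (∫ θ in (0 : ℝ)..(2 * Real.pi),
      q₀ (x * exp (θ * I)) * exp (-(θ * I))).re)) = 2 * (C * (-(J₀ x).re)) := by
    rw [← e2r]; ring
  rw [e3]
  have e4 : (1 - x ^ 2) ^ α * (C * (1 - x ^ 2) ^ (-α) * -(J₀ x).re) = C * (-(J₀ x).re) := by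
    linear_combination (C * (-(J₀ x).re)) * hrp
  linarith

/-! ### Regularity of the Wirtinger derivatives. -/

theorem ContDiffOn.wirtingerDbar {F : ℂ → ℂ} {s : Set ℂ} (hs : IsOpen s) {m n : WithTop ℕ∞}
    (hF : ContDiffOn ℝ n F s) (hmn : m + 1 ≤ n) : ContDiffOn ℝ m (wirtingerDbar F) s := by
  have h := hF.fderiv_of_isOpen hs hmn
  exact contDiffOn_const.mul
    ((h.clm_apply contDiffOn_const).add (contDiffOn_const.mul (h.clm_apply contDiffOn_const)))

theorem ContDiffOn.wirtingerD {F : ℂ → ℂ} {s : Set ℂ} (hs : IsOpen s) {m n : WithTop ℕ∞}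
    (hF : ContDiffOn ℝ n F s) (hmn : m + 1 ≤ n) : ContDiffOn ℝ m (wirtingerD F) s := by
  have h := hF.fderiv_of_isOpen hs hmn
  exact contDiffOn_const.mul
    ((h.clm_apply contDiffOn_const).sub (contDiffOn_const.mul (h.clm_apply contDiffOn_const)))

theorem contDiffOn_weighted_wirtingerDbar {f : ℂ → ℂ} (hf : ContDiffOn ℝ 2 f (Metric.ball 0 1))
    (α : ℝ) : ContDiffOn ℝ 1
      (fun w : ℂ => (((1 - ‖w‖ ^ 2) ^ (-α) : ℝ) : ℂ) * wirtingerDbar f w) (Metric.ball 0 1) := by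
  refine ContDiffOn.mul ?_ (hf.wirtingerDbar Metric.isOpen_ball (by norm_num))
  refine ofRealCLM.contDiff.comp_contDiffOn ?_
  refine ContDiffOn.rpow_const_of_ne ?_ fun z hz => ?_
  · exact (contDiff_const.sub (contDiff_norm_sq ℝ)).contDiffOn
  · rw [mem_ball_zero_iff] at hz
    have := norm_nonneg z
    nlinarith

/-! ### Disc automorphisms and the covariance of `Δ_α`. -/

section Moebius

variable {a : ℝ}

/-- The disc automorphism `s ↦ e (s + a) / (1 + a s)`, where `|e| = 1` and `0 ≤ a < 1`. -/
noncomputable def discMoebius (a : ℝ) (e s : ℂ) : ℂ := e * ((s + a) / (1 + a * s))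

theorem norm_one_add_mul_ge (ha0 : 0 ≤ a) (ha : a < 1) (s : ℂ) :
    1 - ‖s‖ ≤ ‖1 + a * s‖ := by
  have h := norm_sub_norm_le (1 : ℂ) (-(a * s))
  rw [norm_neg, norm_mul, norm_real, Real.norm_of_nonneg ha0, norm_one, sub_neg_eq_add] at h
  have := norm_nonneg s
  nlinarith

theorem norm_mul_lt_one (ha0 : 0 ≤ a) (ha : a < 1) {s : ℂ} (hs : ‖s‖ ≤ 1) :
    ‖(a : ℂ) * s‖ < 1 := by
  rw [norm_mul, norm_real, Real.norm_of_nonneg ha0]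
  have := norm_nonneg s
  nlinarith

theorem one_add_mul_mem_slitPlane (ha0 : 0 ≤ a) (ha : a < 1) {s : ℂ} (hs : ‖s‖ ≤ 1) :
    1 + a * s ∈ slitPlane :=
  mem_slitPlane_of_norm_lt_one (norm_mul_lt_one ha0 ha hs)

theorem one_sub_norm_sq_discMoebius (ha0 : 0 ≤ a) (ha : a < 1) {e s : ℂ} (he : ‖e‖ = 1)
    (hs : ‖s‖ ≤ 1) :
    1 - ‖discMoebius a e s‖ ^ 2 = (1 - a ^ 2) * (1 - ‖s‖ ^ 2) / ‖1 + a * s‖ ^ 2 := by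
  have h0 : ‖1 + a * s‖ ^ 2 ≠ 0 :=
    pow_ne_zero _ (norm_ne_zero_iff.2 (slitPlane_ne_zero (one_add_mul_mem_slitPlane ha0 ha hs)))
  rw [discMoebius, norm_mul, he, one_mul, norm_div, div_pow, eq_div_iff h0, sub_mul,
    div_mul_cancel₀ _ h0]
  simp only [← normSq_eq_norm_sq, normSq_apply]
  simp
  ring

theorem norm_discMoebius_lt_one (ha0 : 0 ≤ a) (ha : a < 1) {e s : ℂ} (he : ‖e‖ = 1)
    (hs : ‖s‖ < 1) : ‖discMoebius a e s‖ < 1 := by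
  have h := one_sub_norm_sq_discMoebius ha0 ha he hs.le
  have h0 : 0 < ‖1 + a * s‖ ^ 2 := pow_pos
    (norm_pos_iff.2 (slitPlane_ne_zero (one_add_mul_mem_slitPlane ha0 ha hs.le))) _
  have h1 : 0 < (1 - a ^ 2) * (1 - ‖s‖ ^ 2) / ‖1 + a * s‖ ^ 2 := by
    have := norm_nonneg s
    have : 0 < 1 - a ^ 2 := by nlinarith
    have : 0 < 1 - ‖s‖ ^ 2 := by nlinarith
    positivity
  rw [← h] at h1
  have := norm_nonneg (discMoebius a e s)
  nlinarith

theorem hasDerivAt_discMoebius (ha0 : 0 ≤ a) (ha : a < 1) (e : ℂ) {s : ℂ} (hs : ‖s‖ ≤ 1) :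
    HasDerivAt (discMoebius a e) (e * ((1 - a ^ 2) / (1 + a * s) ^ 2)) s := by
  have h0 := slitPlane_ne_zero (one_add_mul_mem_slitPlane ha0 ha hs)
  have h1 : HasDerivAt (fun s : ℂ => s + a) 1 s := (hasDerivAt_id s).add_const _
  have h2 : HasDerivAt (fun s : ℂ => 1 + a * s) a s := by
    simpa using ((hasDerivAt_id s).const_mul (a : ℂ)).const_add 1
  refine ((h1.div h2 h0).const_mul e).congr_deriv ?_
  congr 2
  ring

theorem differentiableAt_one_add_mul_cpow (ha0 : 0 ≤ a) (ha : a < 1) (β : ℂ) {s : ℂ}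
    (hs : ‖s‖ ≤ 1) : DifferentiableAt ℂ (fun s : ℂ => (1 + a * s) ^ β) s :=
  DifferentiableAt.cpow_const (by fun_prop) (one_add_mul_mem_slitPlane ha0 ha hs)

/-- `(1 + a s)^α` equals `|1 + a s|^{2α}` times the conjugate of `(1 + a s)^{-α}`, and `|1 + a s|² =
(1 - a²)(1 - |s|²) / (1 - |Φ|²)`. This turns the weight at `Φ(s)` into the weight at `s` up to an
antiholomorphic factor, which is why `f ∘ Φ` is multiplied by `(1 + a s)^α`. -/
theorem moebius_weight_identity {α : ℝ} (ha0 : 0 ≤ a) (ha : a < 1) {e s : ℂ} (he : ‖e‖ = 1)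
    (hs : ‖s‖ < 1) :
    (1 + a * s) ^ (α : ℂ) = ((1 - ‖s‖ ^ 2) ^ α : ℝ) * (((1 - a ^ 2) ^ α : ℝ) *
      (starRingEnd ℂ) ((1 + a * s) ^ (-α : ℂ))) *
      ((1 - ‖discMoebius a e s‖ ^ 2) ^ (-α) : ℝ) := by
  have h0 := slitPlane_ne_zero (one_add_mul_mem_slitPlane ha0 ha hs.le)
  have hn : 0 < ‖1 + a * s‖ := norm_pos_iff.2 h0
  have h1 : 0 < 1 - a ^ 2 := by nlinarith
  have h2 : 0 < 1 - ‖s‖ ^ 2 := by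
    have := norm_nonneg s
    nlinarith
  rw [one_sub_norm_sq_discMoebius ha0 ha he hs.le, cpow_neg]
  set P := (1 + a * s) ^ (α : ℂ) with hP
  have hPn : ‖P‖ = ‖1 + a * s‖ ^ α := norm_cpow_real _ _
  have hP0 : P ≠ 0 := norm_ne_zero_iff.1 (by rw [hPn]; positivity)
  have hc0 : (starRingEnd ℂ) P ≠ 0 := (map_ne_zero _).2 hP0
  have hPP : P * (starRingEnd ℂ) P = ((‖1 + a * s‖ ^ α) ^ 2 : ℝ) := by
    rw [mul_conj, normSq_eq_norm_sq, hPn]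
  have hw : (1 - ‖s‖ ^ 2) ^ α * (1 - a ^ 2) ^ α *
      ((1 - a ^ 2) * (1 - ‖s‖ ^ 2) / ‖1 + a * s‖ ^ 2) ^ (-α) = (‖1 + a * s‖ ^ α) ^ 2 := by
    rw [Real.rpow_neg (by positivity), Real.div_rpow (by positivity) (by positivity),
      Real.mul_rpow h1.le h2.le, pow_two ‖1 + a * s‖, Real.mul_rpow hn.le hn.le]
    have := Real.rpow_pos_of_pos h1 α
    have := Real.rpow_pos_of_pos h2 α
    have := Real.rpow_pos_of_pos hn α
    field_simp
  rw [map_inv₀]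
  have := congrArg (fun x : ℝ => (x : ℂ)) hw
  simp only [ofReal_mul] at this
  rw [← hPP] at this
  generalize (((1 - a ^ 2) * (1 - ‖s‖ ^ 2) / ‖1 + a * s‖ ^ 2) ^ (-α) : ℝ) = W at this ⊢
  field_simp
  linear_combination -this

/-- A solution of `Δ_α f = g` is compared with the weighted circle means of its composition with a
disc automorphism. -/
theorem moebius_mean_bound {α G : ℝ} {f g : ℂ → ℂ} (hα : 0 ≤ α)
    (hf : ContDiffOn ℝ 2 f (Metric.ball 0 1)) (hg : ContinuousOn g (Metric.ball 0 1))
    (hG : ∀ z ∈ Metric.ball (0 : ℂ) 1, ‖g z‖ ≤ G)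
    (heq : ∀ z ∈ Metric.ball (0 : ℂ) 1, weightedLaplacian α f z = g z)
    (ha0 : 0 ≤ a) (ha : a < 1) {e : ℂ} (he : ‖e‖ = 1) {R : ℝ} (hR0 : 0 ≤ R) (hR : R < 1) :
    ‖(∫ θ in (0 : ℝ)..(2 * Real.pi), (1 + a * (R * exp (θ * I))) ^ (α : ℂ) *
        f (discMoebius a e (R * exp (θ * I)))) - 2 * Real.pi * f (e * a)‖ ≤
      2 * Real.pi * (2 ^ α * (G * (1 - a ^ 2) ^ (α + 1))) := by
  set B : Set ℂ := Metric.ball 0 1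
  have hBo : IsOpen B := Metric.isOpen_ball
  have hB : ∀ z ∈ B, ‖z‖ < 1 := fun z hz => mem_ball_zero_iff.1 hz
  set Φ := discMoebius a e with hΦdef
  set dΦ : ℂ → ℂ := fun s => e * ((1 - a ^ 2) / (1 + a * s) ^ 2) with hdΦ
  have hΦ : ∀ z ∈ B, HasDerivAt Φ (dΦ z) z :=
    fun z hz => hasDerivAt_discMoebius ha0 ha e (hB z hz).le
  have hΦB : Set.MapsTo Φ B B := fun z hz =>
    mem_ball_zero_iff.2 (norm_discMoebius_lt_one ha0 ha he (hB z hz))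
  have hΦc : ContinuousOn Φ B := fun z hz => (hΦ z hz).continuousAt.continuousWithinAt
  have hne : ∀ z ∈ B, 1 + a * z ≠ 0 := fun z hz =>
    slitPlane_ne_zero (one_add_mul_mem_slitPlane ha0 ha (hB z hz).le)
  have hdΦd : DifferentiableOn ℂ dΦ B := fun z hz => by
    refine DifferentiableAt.differentiableWithinAt ?_
    refine DifferentiableAt.const_mul (DifferentiableAt.div (by fun_prop) (by fun_prop) ?_) _
    exact pow_ne_zero _ (hne z hz)
  have ha2 : 0 < 1 - a ^ 2 := by nlinarith
  have hG0 : 0 ≤ G := (norm_nonneg _).trans (hG 0 (Metric.mem_ball_self one_pos))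
  set A : ℂ → ℂ := fun s => (1 + a * s) ^ (α : ℂ) with hA
  have hAd : DifferentiableOn ℂ A B := fun z hz =>
    (differentiableAt_one_add_mul_cpow ha0 ha _ (hB z hz).le).differentiableWithinAt
  set b : ℂ → ℂ := fun s => ((1 - a ^ 2) ^ α : ℝ) * (1 + a * s) ^ (-α : ℂ) * dΦ s with hb
  have hbd : DifferentiableOn ℂ b B := by
    refine DifferentiableOn.mul (DifferentiableOn.const_mul (fun z hz => ?_) _) hdΦd
    exact (differentiableAt_one_add_mul_cpow ha0 ha _ (hB z hz).le).differentiableWithinAt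
  set ψ : ℂ → ℂ := fun w => (((1 - ‖w‖ ^ 2) ^ (-α) : ℝ) : ℂ) * wirtingerDbar f w with hψ
  have hψC : ContDiffOn ℝ 1 ψ B := contDiffOn_weighted_wirtingerDbar hf α
  have hder : ∀ {h : ℂ → ℂ}, DifferentiableOn ℂ h B → ∀ z ∈ B, HasDerivAt h (deriv h z) z :=
    fun hd z hz => (hd.differentiableAt (hBo.mem_nhds hz)).hasDerivAt
  have hderc : ∀ {h : ℂ → ℂ}, DifferentiableOn ℂ h B → ContinuousOn (deriv h) B :=
    fun hd => (hd.deriv hBo).continuousOn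
  have hfd : ∀ z ∈ B,
      HasFDerivAt f (wirtingerForm (wirtingerD f z) (wirtingerDbar f z)) z := fun z hz =>
    ((hf.differentiableOn (by norm_num)).differentiableAt (hBo.mem_nhds hz)).hasFDerivAt_wirtinger
  have hψd : ∀ z ∈ B, HasFDerivAt ψ (wirtingerForm (g z) (wirtingerDbar ψ z)) z := fun z hz => by
    rw [← heq z hz]
    exact ((hψC.differentiableOn (by norm_num)).differentiableAt
      (hBo.mem_nhds hz)).hasFDerivAt_wirtinger
  have hconj : ∀ {h : ℂ → ℂ}, ContinuousOn h B →
      ContinuousOn (fun z => (starRingEnd ℂ) (h z)) B :=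
    fun hh => continuous_conj.comp_continuousOn hh
  have hAc := hAd.continuousOn
  have hdΦc := hdΦd.continuousOn
  have hbc := hbd.continuousOn
  have hfz : ContinuousOn (fun z => wirtingerD f (Φ z)) B :=
    (hf.wirtingerD hBo (m := 1) (by norm_num)).continuousOn.comp hΦc hΦB
  have hffc : ContinuousOn (fun z => f (Φ z)) B := hf.continuousOn.comp hΦc hΦB
  have hψΦ : ContinuousOn (fun z => ψ (Φ z)) B := hψC.continuousOn.comp hΦc hΦB
  have hψzb : ContinuousOn (fun z => wirtingerDbar ψ (Φ z)) B :=
    (hψC.wirtingerDbar hBo (m := 0) (by norm_num)).continuousOn.comp hΦc hΦB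
  have hgΦ : ContinuousOn (fun z => g (Φ z)) B := hg.comp hΦc hΦB
  -- The antiholomorphic factor of `Ψ` is invisible to `∂_z`, so `∂_z Ψ = conj b · g(Φ) Φ'`. The
  -- comparison function `1 - |Φ|²` has `-∂_z ∂_z̄` equal to `|Φ'|²`, and its value `1 - a²` at the
  -- origin supplies the last factor of the estimate.
  have key := circle_mean_comparison (α := α) (C := 2 ^ α * (1 - a ^ 2) ^ α * G)
    (F := fun z => A z * f (Φ z))
    (pF := fun z => deriv A z * f (Φ z) + A z * (wirtingerD f (Φ z) * dΦ z))
    (Ψ := fun z => (starRingEnd ℂ) (b z) * ψ (Φ z))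
    (pΨ := fun z => 0 * ψ (Φ z) + (starRingEnd ℂ) (b z) * (g (Φ z) * dΦ z))
    (qΨ := fun z => (starRingEnd ℂ) (deriv b z) * ψ (Φ z) +
      (starRingEnd ℂ) (b z) * (wirtingerDbar ψ (Φ z) * (starRingEnd ℂ) (dΦ z)))
    (F₀ := fun z => 1 - Φ z * (starRingEnd ℂ) (Φ z))
    (p₀ := fun z => -(dΦ z * (starRingEnd ℂ) (Φ z)))
    (q₀ := fun z => -(Φ z * (starRingEnd ℂ) (dΦ z)))
    (q₁ := fun z => -(Φ z * (starRingEnd ℂ) (deriv dΦ z)))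
    (κ := fun z => ‖dΦ z‖ ^ 2) hα (by positivity)
    (fun z hz => by
      refine ((hder hAd z hz).hasFDerivAt_wirtinger.wirtinger_mul
        ((hfd _ (hΦB hz)).wirtinger_comp (hΦ z hz))).congr_fderiv ?_
      congr 1
      rw [zero_mul, zero_add, hA]
      simp only [hb, hψ, map_mul, conj_ofReal]
      rw [moebius_weight_identity ha0 ha he (hB z hz)]
      ring)
    (((hderc hAd).mul hffc).add (hAc.mul (hfz.mul hdΦc)))
    (fun z hz => by
      refine ((hder hbd z hz).hasFDerivAt_conj_wirtinger.wirtinger_mul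
        ((hψd _ (hΦB hz)).wirtinger_comp (hΦ z hz))))
    ((continuousOn_const.mul hψΦ).add ((hconj hbc).mul (hgΦ.mul hdΦc)))
    (((hconj (hderc hbd)).mul hψΦ).add ((hconj hbc).mul (hψzb.mul (hconj hdΦc))))
    (fun z hz => by
      refine (((hΦ z hz).hasFDerivAt_wirtinger.wirtinger_mul
        (hΦ z hz).hasFDerivAt_conj_wirtinger).const_sub 1).congr_fderiv ?_
      refine ContinuousLinearMap.ext fun v => ?_
      simp [wirtingerForm_apply]
      ring)
    ((hdΦc.mul (hconj hΦc)).neg)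
    (fun z hz => by
      refine ((hΦ z hz).hasFDerivAt_wirtinger.wirtinger_mul
        (hder hdΦd z hz).hasFDerivAt_conj_wirtinger).neg.congr_fderiv ?_
      refine ContinuousLinearMap.ext fun v => ?_
      have : dΦ z * (starRingEnd ℂ) (dΦ z) = ((‖dΦ z‖ ^ 2 : ℝ) : ℂ) := by
        rw [mul_conj, normSq_eq_norm_sq]
      rw [← this]
      simp [wirtingerForm_apply]
      ring)
    ((hdΦc.norm).pow 2)
    ((hΦc.mul (hconj (hderc hdΦd))).neg)
    (fun z hz => by
      have hz1 := hB z hz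
      have hn : 0 < ‖1 + a * z‖ := norm_pos_iff.2 (hne z hz)
      have hz2 : 0 < 1 - ‖z‖ ^ 2 := by
        have := norm_nonneg z
        nlinarith
      have hle : ‖1 + a * z‖ ^ (-α) ≤ 2 ^ α * (1 - ‖z‖ ^ 2) ^ (-α) := by
        -- Source of the constant `2^α`: `|1 + a z| ≥ 1 - |z| ≥ (1 - |z|²)/2`.
        have h1 : (1 - ‖z‖ ^ 2) / 2 ≤ ‖1 + a * z‖ := by
          have := norm_one_add_mul_ge ha0 ha z
          have := norm_nonneg z
          nlinarith
        refine (Real.rpow_le_rpow_of_nonpos (by positivity) h1 (by linarith)).trans_eq ?_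
        rw [Real.div_rpow hz2.le zero_le_two, Real.rpow_neg zero_le_two, div_inv_eq_mul, mul_comm]
      have hp : ‖(1 + a * z) ^ (-α : ℂ)‖ = ‖1 + a * z‖ ^ (-α) := by
        rw [← ofReal_neg]; exact norm_cpow_real _ _
      have hbn : ‖b z‖ = (1 - a ^ 2) ^ α * ‖1 + a * z‖ ^ (-α) * ‖dΦ z‖ := by
        rw [show b z = ((1 - a ^ 2) ^ α : ℝ) * (1 + a * z) ^ (-α : ℂ) * dΦ z from rfl,
          norm_mul _ (dΦ z), norm_mul, norm_real, Real.norm_of_nonneg (by positivity), hp]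
      rw [zero_mul, zero_add, norm_mul, norm_conj, norm_mul (g (Φ z)), hbn]
      have hgz := hG _ (hΦB hz)
      calc (1 - a ^ 2) ^ α * ‖1 + a * z‖ ^ (-α) * ‖dΦ z‖ * (‖g (Φ z)‖ * ‖dΦ z‖)
          ≤ (1 - a ^ 2) ^ α * (2 ^ α * (1 - ‖z‖ ^ 2) ^ (-α)) * ‖dΦ z‖ * (G * ‖dΦ z‖) := by
            gcongr
        _ = _ := by ring)
    hR0 hR
  have hΦ0 : Φ 0 = e * a := by simp [hΦdef, discMoebius]
  have hA0 : A 0 = 1 := by simp [hA]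
  rw [hΦ0, hA0, one_mul] at key
  refine key.trans ?_
  have hea : e * a * (starRingEnd ℂ) (e * a) = ((a ^ 2 : ℝ) : ℂ) := by
    rw [mul_conj, normSq_eq_norm_sq, norm_mul, he, norm_real, Real.norm_of_nonneg ha0, one_mul]
  -- The mean of `1 - |Φ|²` over the circle is nonnegative and is simply dropped.
  have hint : 0 ≤ (∫ θ in (0 : ℝ)..(2 * Real.pi),
      (1 - Φ (R * exp (θ * I)) * (starRingEnd ℂ) (Φ (R * exp (θ * I))))).re := by
    have : ∀ θ : ℝ, 1 - Φ (R * exp (θ * I)) * (starRingEnd ℂ) (Φ (R * exp (θ * I))) =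
        ((1 - ‖Φ (R * exp (θ * I))‖ ^ 2 : ℝ) : ℂ) := fun θ => by
      rw [mul_conj, normSq_eq_norm_sq]; push_cast; rfl
    simp only [this]
    rw [intervalIntegral.integral_ofReal, ofReal_re]
    refine intervalIntegral.integral_nonneg (by positivity) fun θ _ => ?_
    have hlt := hB _ (hΦB (mul_exp_I_mem_ball (by rwa [abs_of_nonneg hR0]) θ))
    have := norm_nonneg (Φ (R * exp (θ * I)))
    nlinarith
  rw [hea, sub_re]
  have h2 : (2 * (Real.pi : ℂ) * (1 - ((a ^ 2 : ℝ) : ℂ))).re = 2 * Real.pi * (1 - a ^ 2) := by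
    norm_cast
  rw [h2]
  have hrp : (1 - a ^ 2) ^ (α + 1) = (1 - a ^ 2) ^ α * (1 - a ^ 2) := by
    rw [Real.rpow_add ha2, Real.rpow_one]
  rw [hrp]
  have hC : 0 ≤ 2 ^ α * (1 - a ^ 2) ^ α * G := by positivity
  nlinarith

end Moebius

/-! ### Parseval's identity. -/

section Parseval

theorem integral_exp_int_mul_I (n : ℤ) :
    ∫ θ in (0 : ℝ)..(2 * Real.pi), exp (n * θ * I) = if n = 0 then (2 * Real.pi : ℂ) else 0 := by
  split_ifs with h
  · simp [h]
  · have hne : (n : ℂ) * I ≠ 0 := mul_ne_zero (Int.cast_ne_zero.2 h) I_ne_zero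
    have h := integral_exp_mul_complex (a := 0) (b := 2 * Real.pi) hne
    have e : ∀ θ : ℂ, (n : ℂ) * I * θ = n * θ * I := fun θ => by ring
    simp only [e] at h
    rw [h]
    push_cast
    have : exp (n * (2 * Real.pi) * I) = 1 := by
      rw [mul_assoc]; exact exp_int_mul_two_pi_mul_I n
    rw [this]; simp

theorem norm_exp_int_mul_I (n : ℤ) (θ : ℝ) : ‖exp (n * θ * I)‖ = 1 := by
  have := norm_exp_ofReal_mul_I (n * θ)
  push_cast at this
  exact this

/-- Parseval's identity for an absolutely convergent trigonometric series. -/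
theorem integral_norm_sq_eq_tsum {d : ℤ → ℝ} (hd : Summable fun n => |d n|) {F : ℝ → ℂ}
    (hFc : Continuous F) (hF : ∀ θ : ℝ, HasSum (fun n : ℤ => (d n : ℂ) * exp (n * θ * I)) (F θ)) :
    HasSum (fun n => 2 * Real.pi * d n ^ 2) (∫ θ in (0 : ℝ)..(2 * Real.pi), ‖F θ‖ ^ 2) := by
  -- Used twice: against exponentials to read off the coefficients, and against `conj F` to obtain
  -- the sum of squares.
  have termwise : ∀ {G : ℝ → ℂ}, Continuous G →
      HasSum (fun n : ℤ => (d n : ℂ) * ∫ θ in (0 : ℝ)..(2 * Real.pi), exp (n * θ * I) * G θ)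
        (∫ θ in (0 : ℝ)..(2 * Real.pi), F θ * G θ) := by
    intro G hG
    obtain ⟨K, hK⟩ := (isCompact_uIcc (a := (0 : ℝ)) (b := 2 * Real.pi)).exists_bound_of_continuousOn
      hG.continuousOn
    have h := intervalIntegral.hasSum_integral_of_dominated_convergence (μ := volume)
      (a := 0) (b := 2 * Real.pi)
      (F := fun (n : ℤ) (θ : ℝ) => (d n : ℂ) * (exp (n * θ * I) * G θ))
      (f := fun θ => F θ * G θ) (fun n _ => |d n| * K)
      (fun n => Continuous.aestronglyMeasurable (by fun_prop))
      (fun n => Eventually.of_forall fun θ hθ => by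
        rw [norm_mul, norm_mul, norm_exp_int_mul_I, one_mul, norm_real, Real.norm_eq_abs]
        exact mul_le_mul_of_nonneg_left (hK θ (Set.uIoc_subset_uIcc hθ)) (abs_nonneg _))
      (Eventually.of_forall fun θ _ => hd.mul_right K)
      intervalIntegrable_const
      (Eventually.of_forall fun θ _ => by
        simpa only [mul_assoc] using (hF θ).mul_right (G θ))
    simpa only [intervalIntegral.integral_const_mul] using h
  have coeff : ∀ n : ℤ, ∫ θ in (0 : ℝ)..(2 * Real.pi), exp (n * θ * I) * (starRingEnd ℂ) (F θ) =
      2 * Real.pi * d n := by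
    intro n
    have h1 := termwise (G := fun θ : ℝ => exp (-(n * θ * I))) (by fun_prop)
    have h2 : ∀ m : ℤ, (d m : ℂ) * ∫ θ in (0 : ℝ)..(2 * Real.pi),
        exp (m * θ * I) * exp (-(n * θ * I)) = if m = n then (2 * Real.pi * d n : ℂ) else 0 := by
      intro m
      have e : ∀ θ : ℝ, exp (m * θ * I) * exp (-(n * θ * I)) = exp ((m - n : ℤ) * θ * I) := by
        intro θ
        rw [← exp_add]; push_cast; ring_nf
      simp only [e, integral_exp_int_mul_I, sub_eq_zero]
      split_ifs with h
      · rw [h]; ring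
      · simp
    simp only [h2] at h1
    have h3 := h1.unique (hasSum_ite_eq n (2 * Real.pi * d n : ℂ))
    have h4 := congrArg (starRingEnd ℂ) h3
    rw [← intervalIntegral.intervalIntegral_conj] at h4
    simp only [map_mul, ← exp_conj, map_neg, conj_ofReal, conj_I, map_intCast] at h4
    rw [map_ofNat] at h4
    rw [← h4]
    congr 1; ext θ
    rw [mul_comm]; ring_nf
  have h := termwise (G := fun θ => (starRingEnd ℂ) (F θ)) (continuous_conj.comp hFc)
  simp only [coeff] at h
  have e : ∀ θ, F θ * (starRingEnd ℂ) (F θ) = ((‖F θ‖ ^ 2 : ℝ) : ℂ) := fun θ => by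
    rw [mul_conj, normSq_eq_norm_sq]
  simp only [e] at h
  rw [intervalIntegral.integral_ofReal] at h
  refine hasSum_ofReal.1 ?_
  convert h using 2 with n
  push_cast; ring

end Parseval

/-! ### Binomial coefficients, uniformly in the exponent. -/

section Binomial

/-- The numbers `(1 - α)(2 - α)⋯(n - α) / (n + 1)!`, so that
`(1 + z) ^ α = 1 + α ∑ (-1) ^ n binomialTail α n z ^ (n + 1)`. -/
noncomputable def binomialTail (α : ℝ) : ℕ → ℝ
  | 0 => 1
  | n + 1 => binomialTail α n * (n + 1 - α) / (n + 2)

theorem binomialTail_nonneg {α : ℝ} (hα : α ≤ 1) : ∀ n, 0 ≤ binomialTail α n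
  | 0 => zero_le_one
  | n + 1 => by
    have := binomialTail_nonneg hα n
    have : 0 ≤ (n : ℝ) + 1 - α := by have : (0 : ℝ) ≤ n := n.cast_nonneg; linarith
    rw [binomialTail]; positivity

/-- The extreme case is `α = 0`, the logarithmic series, where equality holds. -/
theorem binomialTail_le {α : ℝ} (h0 : 0 ≤ α) (hα : α ≤ 1) :
    ∀ n : ℕ, binomialTail α n ≤ 1 / (n + 1)
  | 0 => by simp [binomialTail]
  | n + 1 => by
    have h1 := binomialTail_le h0 hα n
    have h2 := binomialTail_nonneg hα n
    have h3 : (0 : ℝ) ≤ n := n.cast_nonneg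
    rw [binomialTail]
    push_cast
    rw [show (n : ℝ) + 1 + 1 = n + 2 by ring]
    gcongr
    rw [le_div_iff₀ (by positivity)] at h1
    nlinarith

theorem succ_mul_choose_succ (a : ℂ) (n : ℕ) :
    ((n : ℂ) + 1) * Ring.choose a (n + 1) = (a - n) * Ring.choose a n := by
  have h1 := Ring.descPochhammer_eq_factorial_smul_choose a n
  have h2 := Ring.descPochhammer_eq_factorial_smul_choose a (n + 1)
  rw [descPochhammer_succ_right, Polynomial.smeval_mul, h1, Polynomial.smeval_sub,
    Polynomial.smeval_X, Polynomial.smeval_natCast, nsmul_eq_mul, nsmul_eq_mul,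
    Nat.factorial_succ] at h2
  have h3 : ((n.factorial : ℕ) : ℂ) ≠ 0 := Nat.cast_ne_zero.2 n.factorial_ne_zero
  apply mul_left_cancel₀ h3
  simp at h2
  linear_combination -h2

theorem choose_succ_eq_binomialTail (α : ℝ) (n : ℕ) :
    Ring.choose (α : ℂ) (n + 1) = α * ((-1) ^ n * binomialTail α n : ℝ) := by
  induction n with
  | zero => simp [binomialTail]
  | succ n ih =>
    have h := succ_mul_choose_succ (α : ℂ) (n + 1)
    have h2 : ((n : ℂ) + 2) ≠ 0 := by exact_mod_cast (by positivity : ((n : ℝ) + 2) ≠ 0)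
    rw [ih] at h
    apply mul_left_cancel₀ h2
    rw [binomialTail]
    push_cast at h ⊢
    field_simp
    linear_combination h

/-- The factor `α` is pulled out so that division by it leaves coefficients bounded uniformly for `0
≤ α ≤ 1`. -/
theorem hasSum_one_add_cpow {α : ℝ} {z : ℂ} (hz : ‖z‖ < 1) :
    HasSum (fun n : ℕ => (α : ℂ) * (((-1) ^ n * binomialTail α n : ℝ) * z ^ (n + 1)))
      ((1 + z) ^ (α : ℂ) - 1) := by
  have h := (one_add_cpow_hasFPowerSeriesOnBall_zero (a := (α : ℂ))).hasSum (y := z) (by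
    rw [Metric.mem_eball, edist_zero_right]
    rw [← ofReal_norm, ← ENNReal.ofReal_one]
    exact (ENNReal.ofReal_lt_ofReal_iff one_pos).2 hz)
  simp only [binomialSeries_apply, zero_add, List.ofFn_const, List.prod_replicate,
    smul_eq_mul] at h
  have h2 := (hasSum_nat_add_iff' 1).2 h
  simp only [choose_succ_eq_binomialTail, Finset.range_one, Finset.sum_singleton,
    Ring.choose_zero_right, pow_zero, mul_one, mul_assoc] at h2
  exact h2

end Binomial

/-! ### The Poisson kernel on the circle; the cases `α = 0` and `α ≥ 1`. -/

section Kernel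

/-- The Poisson kernel of the unit disc with pole at `-r`, on the unit circle. -/
noncomputable def circleKernel (r θ : ℝ) : ℝ := (1 - r ^ 2) / (1 + 2 * r * Real.cos θ + r ^ 2)

variable {r : ℝ}

theorem circleKernel_denom_pos (hr0 : 0 ≤ r) (hr : r < 1) (θ : ℝ) :
    0 < 1 + 2 * r * Real.cos θ + r ^ 2 := by
  have := Real.neg_one_le_cos θ
  nlinarith

theorem one_add_mul_cos_pos (hr0 : 0 ≤ r) (hr : r < 1) (θ : ℝ) : 0 < 1 + r * Real.cos θ := by
  have := Real.neg_one_le_cos θ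
  nlinarith

theorem circleKernel_continuous (hr0 : 0 ≤ r) (hr : r < 1) : Continuous (circleKernel r) := by
  unfold circleKernel
  exact Continuous.div (by fun_prop) (by fun_prop) fun θ => (circleKernel_denom_pos hr0 hr θ).ne'

/-- The primitive is `θ - 2 arg(1 + r e^{iθ})`, because `K = Re((1 - z)/(1 + z)) = 1 - 2 Re(z/(1 +
z))` at `z = r e^{iθ}`. -/
theorem hasDerivAt_circleKernel_primitive (hr0 : 0 ≤ r) (hr : r < 1) (θ : ℝ) :
    HasDerivAt (fun θ => θ - 2 * Real.arctan (r * Real.sin θ / (1 + r * Real.cos θ)))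
      (circleKernel r θ) θ := by
  have h1 := one_add_mul_cos_pos hr0 hr θ
  have h2 := circleKernel_denom_pos hr0 hr θ
  have hs := Real.sin_sq_add_cos_sq θ
  have hd := ((((Real.hasDerivAt_sin θ).const_mul r).div
    (((Real.hasDerivAt_cos θ).const_mul r).const_add 1) h1.ne').arctan.const_mul 2)
  refine ((hasDerivAt_id θ).sub hd).congr_deriv ?_
  have h3 : 1 + (r * Real.sin θ / (1 + r * Real.cos θ)) ^ 2 =
      (1 + 2 * r * Real.cos θ + r ^ 2) / (1 + r * Real.cos θ) ^ 2 := by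
    rw [div_pow, eq_div_iff (by positivity), add_mul, div_mul_cancel₀ _ (by positivity)]
    linear_combination r ^ 2 * hs
  simp only [Pi.div_apply]
  rw [h3, circleKernel]
  field_simp
  linear_combination (-2 * r ^ 2) * hs

theorem integral_circleKernel (hr0 : 0 ≤ r) (hr : r < 1) (a b : ℝ) :
    ∫ θ in a..b, circleKernel r θ =
      (b - 2 * Real.arctan (r * Real.sin b / (1 + r * Real.cos b))) -
        (a - 2 * Real.arctan (r * Real.sin a / (1 + r * Real.cos a))) :=
  intervalIntegral.integral_eq_sub_of_hasDerivAt
    (fun θ _ => hasDerivAt_circleKernel_primitive hr0 hr θ)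
    ((circleKernel_continuous hr0 hr).intervalIntegrable _ _)

theorem cos_two_arctan_add_pi_div_two (r : ℝ) :
    Real.cos (Real.pi / 2 + 2 * Real.arctan r) = -(2 * r / (1 + r ^ 2)) := by
  rw [add_comm, Real.cos_add_pi_div_two, Real.sin_two_mul]
  have h : Real.sin (Real.arctan r) = r * Real.cos (Real.arctan r) := by
    rw [Real.sin_arctan, Real.cos_arctan]; ring
  rw [h, show 2 * (r * Real.cos (Real.arctan r)) * Real.cos (Real.arctan r) =
    2 * r * Real.cos (Real.arctan r) ^ 2 by ring, Real.cos_sq_arctan]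
  ring

theorem sin_two_arctan_add_pi_div_two (r : ℝ) :
    Real.sin (Real.pi / 2 + 2 * Real.arctan r) = (1 - r ^ 2) / (1 + r ^ 2) := by
  rw [add_comm, Real.sin_add_pi_div_two, Real.cos_two_mul, Real.cos_sq_arctan]
  field_simp
  ring

/-- The extremal integral of the Schwarz lemma for harmonic functions. -/
theorem integral_abs_one_sub_circleKernel (hr0 : 0 ≤ r) (hr : r < 1) :
    ∫ θ in (0 : ℝ)..(2 * Real.pi), |1 - (1 - r ^ 2) / (1 + r ^ 2) * circleKernel r θ| =
      8 * Real.arctan r := by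
  set c := (1 - r ^ 2) / (1 + r ^ 2) with hc
  -- The point of `(0, π)` where `1 - c K` changes sign.
  set τ := Real.pi / 2 + 2 * Real.arctan r with hτ
  have hA0 : 0 ≤ Real.arctan r := Real.arctan_nonneg.2 hr0
  have hA1 : Real.arctan r < Real.pi / 4 := by
    rw [← Real.arctan_one]; exact Real.arctan_strictMono hr
  have hpi := Real.pi_pos
  have hcosτ : Real.cos τ = -(2 * r / (1 + r ^ 2)) := cos_two_arctan_add_pi_div_two r
  have hsinτ : Real.sin τ = (1 - r ^ 2) / (1 + r ^ 2) := sin_two_arctan_add_pi_div_two r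
  have hsgn : ∀ θ, 1 - c * circleKernel r θ =
      2 * r * (Real.cos θ - Real.cos τ) / (1 + 2 * r * Real.cos θ + r ^ 2) := fun θ => by
    have := circleKernel_denom_pos hr0 hr θ
    rw [hcosτ, hc, circleKernel, eq_div_iff this.ne', sub_mul, mul_assoc ((1 - r ^ 2) / _),
      div_mul_cancel₀ _ this.ne']
    field_simp
    ring
  have hpos : ∀ θ, Real.cos τ ≤ Real.cos θ → 0 ≤ 1 - c * circleKernel r θ := fun θ h => by
    rw [hsgn]
    exact div_nonneg (mul_nonneg (by positivity) (sub_nonneg.2 h))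
      (circleKernel_denom_pos hr0 hr θ).le
  have hneg : ∀ θ, Real.cos θ ≤ Real.cos τ → 1 - c * circleKernel r θ ≤ 0 := fun θ h => by
    rw [hsgn]
    exact div_nonpos_of_nonpos_of_nonneg
      (mul_nonpos_of_nonneg_of_nonpos (by positivity) (sub_nonpos.2 h))
      (circleKernel_denom_pos hr0 hr θ).le
  have hcont : Continuous fun θ => |1 - c * circleKernel r θ| := by
    have := circleKernel_continuous hr0 hr
    fun_prop
  have hint : ∀ a b, ∫ θ in a..b, (1 - c * circleKernel r θ) =
      (b - a) - c * ((b - 2 * Real.arctan (r * Real.sin b / (1 + r * Real.cos b))) -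
        (a - 2 * Real.arctan (r * Real.sin a / (1 + r * Real.cos a)))) := fun a b => by
    rw [intervalIntegral.integral_sub intervalIntegrable_const
      (((circleKernel_continuous hr0 hr).const_mul c).intervalIntegrable _ _),
      intervalIntegral.integral_const_mul, integral_circleKernel hr0 hr]
    simp
  have hcos2 : ∀ θ, Real.cos (2 * Real.pi - θ) = Real.cos θ := fun θ => Real.cos_two_pi_sub θ
  have hsin2 : ∀ θ, Real.sin (2 * Real.pi - θ) = -Real.sin θ := fun θ => Real.sin_two_pi_sub θ
  -- Hence `∫ K` over `[0, τ]` is `τ - 2 arctan r = π/2`: the arc where `1 - c K ≥ 0` carries half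
  -- the mass of `K`. This is what makes `c` optimal; the terms in `c` cancel and `4τ - 2π = 8
  -- arctan r` remains.
  have hratio : r * Real.sin τ / (1 + r * Real.cos τ) = r := by
    have h1 := one_add_mul_cos_pos hr0 hr τ
    rw [div_eq_iff h1.ne', hsinτ, hcosτ]
    field_simp
    ring
  rw [← intervalIntegral.integral_add_adjacent_intervals (b := τ)
      (hcont.intervalIntegrable _ _) (hcont.intervalIntegrable _ _),
    ← intervalIntegral.integral_add_adjacent_intervals (a := τ) (b := 2 * Real.pi - τ)
      (hcont.intervalIntegrable _ _) (hcont.intervalIntegrable _ _)]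
  have i1 : ∫ θ in (0 : ℝ)..τ, |1 - c * circleKernel r θ| =
      ∫ θ in (0 : ℝ)..τ, (1 - c * circleKernel r θ) := by
    refine intervalIntegral.integral_congr fun θ hθ => abs_of_nonneg (hpos θ ?_)
    rw [Set.uIcc_of_le (by linarith)] at hθ
    exact Real.cos_le_cos_of_nonneg_of_le_pi hθ.1 (by linarith) hθ.2
  have i2 : ∫ θ in τ..(2 * Real.pi - τ), |1 - c * circleKernel r θ| =
      ∫ θ in τ..(2 * Real.pi - τ), -(1 - c * circleKernel r θ) := by
    refine intervalIntegral.integral_congr fun θ hθ => abs_of_nonpos (hneg θ ?_)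
    rw [Set.uIcc_of_le (by linarith)] at hθ
    rcases le_total θ Real.pi with h | h
    · exact Real.cos_le_cos_of_nonneg_of_le_pi (by linarith) h hθ.1
    · rw [← hcos2 θ]
      exact Real.cos_le_cos_of_nonneg_of_le_pi (by linarith) (by linarith) (by linarith [hθ.2])
  have i3 : ∫ θ in (2 * Real.pi - τ)..(2 * Real.pi), |1 - c * circleKernel r θ| =
      ∫ θ in (2 * Real.pi - τ)..(2 * Real.pi), (1 - c * circleKernel r θ) := by
    refine intervalIntegral.integral_congr fun θ hθ => abs_of_nonneg (hpos θ ?_)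
    rw [Set.uIcc_of_le (by linarith)] at hθ
    rw [← hcos2 θ]
    exact Real.cos_le_cos_of_nonneg_of_le_pi (by linarith [hθ.2]) (by linarith)
      (by linarith [hθ.1])
  rw [i1, i2, i3, intervalIntegral.integral_neg, hint, hint, hint, hcos2, hsin2, mul_neg, neg_div,
    Real.arctan_neg, hratio]
  simp only [Real.sin_zero, Real.sin_two_pi, mul_zero, zero_div, Real.arctan_zero]
  rw [hτ]
  ring

variable {U : ℝ → ℂ} {M : ℝ}

/-- Testing against a function with vanishing `circleKernel` integral. -/
theorem norm_integral_mul_le (hr0 : 0 ≤ r) (hr : r < 1) (hU : Continuous U)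
    (hUM : ∀ θ, ‖U θ‖ ≤ M)
    (hk : ∫ θ in (0 : ℝ)..(2 * Real.pi), (circleKernel r θ : ℂ) * U θ = 0)
    {H : ℝ → ℂ} (hH : Continuous H) (c : ℝ) :
    ‖∫ θ in (0 : ℝ)..(2 * Real.pi), H θ * U θ‖ ≤
      M * ∫ θ in (0 : ℝ)..(2 * Real.pi), ‖H θ - c * circleKernel r θ‖ := by
  have hkc : Continuous fun θ => (circleKernel r θ : ℂ) :=
    Complex.continuous_ofReal.comp (circleKernel_continuous hr0 hr)
  have h1 : ∫ θ in (0 : ℝ)..(2 * Real.pi), H θ * U θ =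
      ∫ θ in (0 : ℝ)..(2 * Real.pi), (H θ - c * circleKernel r θ) * U θ := by
    have : ∀ θ, (H θ - c * circleKernel r θ) * U θ = H θ * U θ - c * (circleKernel r θ * U θ) :=
      fun θ => by ring
    simp only [this]
    have i1 : IntervalIntegrable (fun θ => H θ * U θ) volume 0 (2 * Real.pi) :=
      (hH.mul hU).intervalIntegrable _ _
    have i2 : IntervalIntegrable (fun θ => c * ((circleKernel r θ : ℂ) * U θ)) volume 0
      (2 * Real.pi) := ((hkc.mul hU).const_mul _).intervalIntegrable _ _
    rw [intervalIntegral.integral_sub i1 i2, intervalIntegral.integral_const_mul, hk,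
      mul_zero, sub_zero]
  rw [h1, ← intervalIntegral.integral_const_mul]
  have hc : Continuous fun θ => H θ - c * circleKernel r θ := by fun_prop
  refine intervalIntegral.norm_integral_le_of_norm_le (by positivity)
    (Eventually.of_forall fun θ _ => ?_) ((hc.norm.const_mul M).intervalIntegrable _ _)
  rw [norm_mul, mul_comm]
  exact mul_le_mul_of_nonneg_right (hUM θ) (norm_nonneg _)

theorem norm_integral_le_arctan (hr0 : 0 ≤ r) (hr : r < 1) (hU : Continuous U)
    (hUM : ∀ θ, ‖U θ‖ ≤ M)
    (hk : ∫ θ in (0 : ℝ)..(2 * Real.pi), (circleKernel r θ : ℂ) * U θ = 0) :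
    ‖∫ θ in (0 : ℝ)..(2 * Real.pi), U θ‖ ≤ M * (8 * Real.arctan r) := by
  have h := norm_integral_mul_le hr0 hr hU hUM hk (H := fun _ => 1) continuous_const
    ((1 - r ^ 2) / (1 + r ^ 2))
  simp only [one_mul] at h
  rw [← integral_abs_one_sub_circleKernel hr0 hr]
  convert h using 4 with θ
  rw [← Real.norm_eq_abs, ← norm_real]
  push_cast
  rfl

theorem pi_div_four_mul_le_arctan (hr0 : 0 ≤ r) (hr : r ≤ 1) : Real.pi / 4 * r ≤ Real.arctan r := by
  have hc : ConcaveOn ℝ (Set.Ici 0) Real.arctan := by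
    refine concaveOn_of_deriv2_nonpos (convex_Ici 0) Real.continuous_arctan.continuousOn
      Real.differentiable_arctan.differentiableOn ?_ ?_
    · rw [Real.deriv_arctan]
      exact (Differentiable.div (by fun_prop) (by fun_prop)
        fun x => by positivity).differentiableOn
    · intro x hx
      rw [interior_Ici] at hx
      have hx : 0 < x := hx
      rw [Function.iterate_succ, Function.iterate_one, Function.comp, Real.deriv_arctan]
      have h1 : HasDerivAt (fun x : ℝ => 1 + x ^ 2) (2 * x) x := by
        simpa using (hasDerivAt_pow 2 x).const_add 1
      have h2 := h1.inv (by positivity)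
      have : deriv (fun x : ℝ => 1 / (1 + x ^ 2)) x = -(2 * x) / (1 + x ^ 2) ^ 2 := by
        simp only [one_div]; exact h2.deriv
      rw [this]
      exact div_nonpos_of_nonpos_of_nonneg (by linarith) (by positivity)
  have h := hc.2 (show (0 : ℝ) ∈ Set.Ici 0 by simp) (show (1 : ℝ) ∈ Set.Ici 0 by simp)
    (sub_nonneg.2 hr) hr0 (by ring)
  simpa [mul_comm] using h

/-- Derivatives are compared along the segment `t ↦ t z`; `α ≥ 1` makes `x^{α-1}` nondecreasing, so
`|1 + t z|` may be replaced by `1 + t |z|`. -/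
theorem norm_one_add_cpow_sub_one_le {α : ℝ} (hα : 1 ≤ α) {z : ℂ} (hz : ‖z‖ < 1) :
    ‖(1 + z) ^ (α : ℂ) - 1‖ ≤ (1 + ‖z‖) ^ α - 1 := by
  have hmem : ∀ t ∈ Set.Icc (0 : ℝ) 1, ‖(t : ℂ) * z‖ < 1 := fun t ht => by
    rw [norm_mul, norm_real, Real.norm_of_nonneg ht.1]
    have := norm_nonneg z
    nlinarith [ht.2]
  have hd : ∀ t ∈ Set.Icc (0 : ℝ) 1, HasDerivAt (fun t : ℝ => (1 + t * z) ^ (α : ℂ) - 1)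
      (α * (1 + t * z) ^ ((α : ℂ) - 1) * z) t := fun t ht => by
    have h1 : HasDerivAt (fun t : ℝ => 1 + (t : ℂ) * z) z t := by
      simpa using ((ofRealCLM.hasDerivAt (x := t)).mul_const z).const_add 1
    have h2 : 1 + (t : ℂ) * z ∈ slitPlane := mem_slitPlane_of_norm_lt_one (hmem t ht)
    have h3 := ((hasDerivAt_id (1 + (t : ℂ) * z)).cpow_const (c := (α : ℂ)) h2).comp_of_eq t h1 rfl
    simpa [Function.comp_def] using h3.sub_const 1
  have hd2 : ∀ t ∈ Set.Icc (0 : ℝ) 1, HasDerivAt (fun t : ℝ => (1 + t * ‖z‖) ^ α - 1)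
      (α * (1 + t * ‖z‖) ^ (α - 1) * ‖z‖) t := fun t ht => by
    have h1 : HasDerivAt (fun t : ℝ => 1 + t * ‖z‖) ‖z‖ t := by
      simpa using ((hasDerivAt_id t).mul_const ‖z‖).const_add 1
    have h2 : (1 + t * ‖z‖) ≠ 0 := by
      have := ht.1
      positivity
    refine ((h1.rpow_const (Or.inl h2)).sub_const 1).congr_deriv ?_
    ring
  have h := image_norm_le_of_norm_deriv_right_le_deriv_boundary' (a := 0) (b := 1)
    (f := fun t : ℝ => (1 + t * z) ^ (α : ℂ) - 1) (B := fun t : ℝ => (1 + t * ‖z‖) ^ α - 1)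
    (fun t ht => (hd t ht).continuousAt.continuousWithinAt)
    (fun t ht => (hd t ⟨ht.1, ht.2.le⟩).hasDerivWithinAt) (by simp)
    (fun t ht => (hd2 t ht).continuousAt.continuousWithinAt)
    (fun t ht => (hd2 t ⟨ht.1, ht.2.le⟩).hasDerivWithinAt)
    (fun t ht => by
      have hnorm : ‖(1 + (t : ℂ) * z) ^ ((α : ℂ) - 1)‖ = ‖1 + (t : ℂ) * z‖ ^ (α - 1) := by
        rw [← ofReal_one, ← ofReal_sub, norm_cpow_real]
      rw [norm_mul, norm_mul, norm_real, Real.norm_of_nonneg (by linarith), hnorm]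
      have h1 : ‖1 + (t : ℂ) * z‖ ≤ 1 + t * ‖z‖ := by
        refine (norm_add_le _ _).trans ?_
        rw [norm_one, norm_mul, norm_real, Real.norm_of_nonneg ht.1]
      have h2 : ‖1 + (t : ℂ) * z‖ ^ (α - 1) ≤ (1 + t * ‖z‖) ^ (α - 1) :=
        Real.rpow_le_rpow (norm_nonneg _) h1 (by linarith)
      gcongr) (Set.right_mem_Icc.2 zero_le_one)
  simpa using h

/-- Convexity of `x^α` between `1` and `2`. -/
theorem one_add_rpow_sub_one_le {α : ℝ} (hα : 1 ≤ α) (hr0 : 0 ≤ r) (hr : r ≤ 1) :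
    (1 + r) ^ α - 1 ≤ (2 ^ α - 1) * r := by
  have h := (convexOn_rpow hα).2 (show (1 : ℝ) ∈ Set.Ici 0 by simp)
    (show (2 : ℝ) ∈ Set.Ici 0 by simp) (sub_nonneg.2 hr) hr0 (by ring)
  simp only [smul_eq_mul, Real.one_rpow] at h
  have e : (1 - r) * 1 + r * 2 = 1 + r := by ring
  rw [e] at h
  linarith

theorem continuous_one_add_cpow (hr0 : 0 ≤ r) (hr : r < 1) (β : ℂ) :
    Continuous fun θ : ℝ => (1 + (r : ℂ) * exp (θ * I)) ^ β := by
  refine Continuous.cpow (by fun_prop) continuous_const fun θ => ?_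
  exact one_add_mul_mem_slitPlane hr0 hr (norm_exp_ofReal_mul_I θ).le

/-- The weight is `1` plus an excess of size at most `(2^α - 1) r`. The first part is the case `α =
0`; for the second, `r ≤ (4/π) arctan r` by concavity. -/
theorem norm_integral_weighted_le_of_one_le {α : ℝ} (hα : 1 ≤ α) (hr0 : 0 ≤ r) (hr : r < 1)
    (hU : Continuous U) (hUM : ∀ θ, ‖U θ‖ ≤ M)
    (hk : ∫ θ in (0 : ℝ)..(2 * Real.pi), (circleKernel r θ : ℂ) * U θ = 0) :
    ‖∫ θ in (0 : ℝ)..(2 * Real.pi), (1 + (r : ℂ) * exp (θ * I)) ^ (α : ℂ) * U θ‖ ≤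
      M * (2 ^ α * (8 * Real.arctan r)) := by
  have hM : 0 ≤ M := (norm_nonneg _).trans (hUM 0)
  have h1 := norm_integral_le_arctan hr0 hr hU hUM hk
  have hc := continuous_one_add_cpow hr0 hr α
  have h2 : ‖∫ θ in (0 : ℝ)..(2 * Real.pi), ((1 + (r : ℂ) * exp (θ * I)) ^ (α : ℂ) - 1) * U θ‖ ≤
      (2 ^ α - 1) * r * M * |2 * Real.pi - 0| := by
    refine intervalIntegral.norm_integral_le_of_norm_le_const fun θ _ => ?_
    rw [norm_mul]
    have hz : ‖(r : ℂ) * exp (θ * I)‖ = r := by rw [norm_mul_exp_I, abs_of_nonneg hr0]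
    have h3 := norm_one_add_cpow_sub_one_le hα (z := r * exp (θ * I)) (by rw [hz]; exact hr)
    rw [hz] at h3
    have h4 := h3.trans (one_add_rpow_sub_one_le hα hr0 hr.le)
    exact mul_le_mul h4 (hUM θ) (norm_nonneg _) ((norm_nonneg _).trans h4)
  have h3 : ∫ θ in (0 : ℝ)..(2 * Real.pi), (1 + (r : ℂ) * exp (θ * I)) ^ (α : ℂ) * U θ =
      (∫ θ in (0 : ℝ)..(2 * Real.pi), ((1 + (r : ℂ) * exp (θ * I)) ^ (α : ℂ) - 1) * U θ) +
        ∫ θ in (0 : ℝ)..(2 * Real.pi), U θ := by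
    have i1 : IntervalIntegrable (fun θ : ℝ => ((1 + (r : ℂ) * exp (θ * I)) ^ (α : ℂ) - 1) * U θ)
      volume 0 (2 * Real.pi) := ((hc.sub continuous_const).mul hU).intervalIntegrable _ _
    rw [← intervalIntegral.integral_add i1 (hU.intervalIntegrable _ _)]
    congr 1; ext θ; ring
  rw [h3]
  refine (norm_add_le _ _).trans ((add_le_add h2 h1).trans ?_)
  have h4 := pi_div_four_mul_le_arctan hr0 hr.le
  have h5 : (1 : ℝ) ≤ 2 ^ α := Real.one_le_rpow one_le_two (by linarith)
  rw [sub_zero, abs_of_nonneg (by positivity)]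
  have h6 := mul_le_mul_of_nonneg_left h4 (mul_nonneg hM (sub_nonneg.2 h5))
  nlinarith

end Kernel

/-! ### Numerical inequalities in `x = r²`. -/

section PolynomialBounds

variable {x : ℝ}

/-- A rounded-down truncation of the degree-seven polynomial `hP` in `small_radius_extreme_zero`.
For `x ≤ 2/5` the `x^5` term is absorbed by `x^4`, and the two highest terms together are
nonnegative. `third_quartic_nonneg` does the same for `small_radius_extreme_third`. -/
theorem half_quartic_nonneg (h0 : 0 ≤ x) (h1 : x ≤ 2 / 5) :
    0 ≤ 0.01821 - 0.39354 * x + 3.25182 * x ^ 2 - 6.50771 * x ^ 3 + 1.9 * x ^ 4 := by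
  rcases le_total x 0.17 with h | h
  · have hB : 2.15 ≤ 3.25182 - 6.50771 * x + 1.9 * x ^ 2 := by nlinarith
    nlinarith [mul_le_mul_of_nonneg_left hB (sq_nonneg x), sq_nonneg (x - 0.0915)]
  · have hB : 0 ≤ (x - 0.17) * (0.4 - x) := mul_nonneg (by linarith) (by linarith)
    have : 0.347 ≤ x * (3.25182 - 6.50771 * x + 1.9 * x ^ 2) := by
      nlinarith [mul_nonneg h0 hB, sq_nonneg x]
    nlinarith

theorem third_quartic_nonneg (h0 : 0 ≤ x) (h1 : x ≤ 2 / 5) :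
    0 ≤ 0.01821 - 0.20687 * x + 2.08204 * x ^ 2 - 4.05794 * x ^ 3 + 0.45 * x ^ 4 := by
  nlinarith [mul_nonneg h0 (sub_nonneg.2 h1), sq_nonneg (x - 0.06),
    mul_nonneg h0 (sq_nonneg (x - 0.06)), sq_nonneg (x * (x - 0.2))]

theorem small_radius_extreme_zero (h0 : 0 ≤ x) (h1 : x ≤ 2 / 5) {c b : ℝ}
    (hc : c = 1 - 11 / 5 * x) (hb : b = 7 / 50) :
    ((1 - c + b * c * x) ^ 2 + x * (1 + c - b * c) ^ 2 + (x * (1 / 2 + c) + b * (1 - c)) ^ 2 +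
        x * (x * c - b * (1 + c)) ^ 2) * (1 - x) +
      (x ^ 4 * (c + 1 / 4) ^ 2 + b ^ 2 * x ^ 2 * (c + 1 / 2) ^ 2) +
      (1 - b * x) ^ 2 * c ^ 2 * x ≤
      (1 - b ^ 2) * (4.6473 * (x * (1 - x / 3 + x ^ 2 / 5 - x ^ 3 / 7) ^ 2)) * (1 - x) := by
  have hp := half_quartic_nonneg h0 h1
  have hx3 : 0 ≤ x ^ 3 := by positivity
  have hx2 : 0 ≤ x ^ 2 := by positivity
  have hx4 : 0 ≤ x ^ 4 := by positivity
  have hx5 : 0 ≤ x ^ 4 * (2 / 5 - x) := mul_nonneg hx4 (by linarith)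
  have hx6 : 0 ≤ x ^ 6 * (2 / 5 - x) := mul_nonneg (by positivity) (by linarith)
  have hx6' : 0 ≤ x ^ 6 := by positivity
  have hP : 0 ≤ (455323 / 25000000 : ℝ) * x ^ 0 + (-1967661 / 5000000 : ℝ) * x ^ 1 + (406477791 / 125000000 : ℝ) * x ^ 2 + (-813462653 / 125000000 : ℝ) * x ^ 3 + (1418902333 / 625000000 : ℝ) * x ^ 4 + (-547830363 / 625000000 : ℝ) * x ^ 5 + (309171591 / 875000000 : ℝ) * x ^ 6 + (-16272189 / 175000000 : ℝ) * x ^ 7 := by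
    linarith
  refine sub_nonneg.1 ((mul_nonneg h0 hP).trans_eq ?_)
  rw [hc, hb]
  ring

theorem small_radius_extreme_third (h0 : 0 ≤ x) (h1 : x ≤ 2 / 5) {c b : ℝ}
    (hc : c = 1 - 11 / 5 * x) (hb : b = 7 / 50) :
    ((1 - c + b * c * x) ^ 2 + x * (1 + c - b * c) ^ 2 + (x * (1 / 2 + c) + b * (1 - c)) ^ 2 +
        x * (x * (1 / 3 + c) - b * (1 + c)) ^ 2) * (1 - x) +
      (x ^ 4 * (c + 1 / 4) ^ 2 + b ^ 2 * x ^ 2 * (c + 1 / 2) ^ 2) +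
      (1 - b * x) ^ 2 * c ^ 2 * x ≤
      (1 - b ^ 2) * (4.6473 * (x * (1 - x / 3 + x ^ 2 / 5 - x ^ 3 / 7) ^ 2)) * (1 - x) := by
  have hp := third_quartic_nonneg h0 h1
  have hx3 : 0 ≤ x ^ 3 := by positivity
  have hx2 : 0 ≤ x ^ 2 := by positivity
  have hx4 : 0 ≤ x ^ 4 := by positivity
  have hx5 : 0 ≤ x ^ 4 * (2 / 5 - x) := mul_nonneg hx4 (by linarith)
  have hx6 : 0 ≤ x ^ 6 * (2 / 5 - x) := mul_nonneg (by positivity) (by linarith)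
  have hx6' : 0 ≤ x ^ 6 := by positivity
  have hP : 0 ≤ (455323 / 25000000 : ℝ) * x ^ 0 + (-3102983 / 15000000 : ℝ) * x ^ 1 + (2342300119 / 1125000000 : ℝ) * x ^ 2 + (-4565163877 / 1125000000 : ℝ) * x ^ 3 + (1506706999 / 1875000000 : ℝ) * x ^ 4 + (-547830363 / 625000000 : ℝ) * x ^ 5 + (309171591 / 875000000 : ℝ) * x ^ 6 + (-16272189 / 175000000 : ℝ) * x ^ 7 := by
    linarith
  refine sub_nonneg.1 ((mul_nonneg h0 hP).trans_eq ?_)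
  rw [hc, hb]
  ring

/-- The left side is the Parseval sum behind `integral_norm_sub_kernel_sq_le`: the squares of
`smallCoeff` at indices `0` to `3`, a geometric bound for the rest, and the antianalytic part. Here
`q₁`, `q₂` stand for `binomialTail α 1`, `binomialTail α 2`. The sum increases in `q₁` and is convex
in `q₂`, so only `q₁ = 1/2` and `q₂ = 0` or `1/3` matter. -/
theorem small_radius_polynomial_bound (h0 : 0 ≤ x) (h1 : x ≤ 2 / 5) {q₁ q₂ c b : ℝ}
    (hq₁ : 0 ≤ q₁) (hq₁' : q₁ ≤ 1 / 2) (hq₂ : 0 ≤ q₂) (hq₂' : q₂ ≤ 1 / 3)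
    (hc : c = 1 - 11 / 5 * x) (hb : b = 7 / 50) :
    (1 - c + b * c * x) ^ 2 + x * (1 + c - b * c) ^ 2 + (x * (q₁ + c) + b * (1 - c)) ^ 2 +
      x * (x * (q₂ + c) - b * (1 + c)) ^ 2 +
      (x ^ 4 * (c + 1 / 4) ^ 2 + b ^ 2 * x ^ 2 * (c + 1 / 2) ^ 2) / (1 - x) +
      (1 - b * x) ^ 2 * c ^ 2 * x / (1 - x) ≤
    (1 - b ^ 2) * (4.6473 * (x * (1 - x / 3 + x ^ 2 / 5 - x ^ 3 / 7) ^ 2)) := by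
  have hc0 : 0 ≤ c := by rw [hc]; linarith
  have hc1 : 0 ≤ 1 - c := by rw [hc]; linarith
  have hx : 0 < 1 - x := by linarith
  have e1 : (x * (q₁ + c) + b * (1 - c)) ^ 2 ≤ (x * (1 / 2 + c) + b * (1 - c)) ^ 2 := by
    have : 0 ≤ b := by rw [hb]; norm_num
    gcongr
  have e2 : (x * (q₂ + c) - b * (1 + c)) ^ 2 ≤ (x * c - b * (1 + c)) ^ 2 ∨
      (x * (q₂ + c) - b * (1 + c)) ^ 2 ≤ (x * (1 / 3 + c) - b * (1 + c)) ^ 2 := by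
    rcases le_total (x * (q₂ + c) - b * (1 + c)) 0 with h | h
    · left
      nlinarith [mul_nonneg h0 hq₂]
    · right
      have : x * (q₂ + c) ≤ x * (1 / 3 + c) := by gcongr
      nlinarith
  have h : ((1 - c + b * c * x) ^ 2 + x * (1 + c - b * c) ^ 2 + (x * (q₁ + c) + b * (1 - c)) ^ 2 +
        x * (x * (q₂ + c) - b * (1 + c)) ^ 2) * (1 - x) +
      (x ^ 4 * (c + 1 / 4) ^ 2 + b ^ 2 * x ^ 2 * (c + 1 / 2) ^ 2) +
      (1 - b * x) ^ 2 * c ^ 2 * x ≤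
      (1 - b ^ 2) * (4.6473 * (x * (1 - x / 3 + x ^ 2 / 5 - x ^ 3 / 7) ^ 2)) * (1 - x) := by
    rcases e2 with e2 | e2
    · refine le_trans ?_ (small_radius_extreme_zero h0 h1 hc hb)
      gcongr
    · refine le_trans ?_ (small_radius_extreme_third h0 h1 hc hb)
      gcongr
  rw [add_assoc, ← add_div, ← le_sub_iff_add_le', div_le_iff₀ hx, sub_mul]
  linarith

/-- The left side is the bound of `integral_norm_cpowSlope_sq_le`; the two factors of `1 - x/3 +
x²/5 - x³/7` on the right are first replaced by a linear minorant. -/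
theorem middle_radius_polynomial_bound (h0 : 2 / 5 ≤ x) (h1 : x ≤ 13 / 20) :
    1 + x + x ^ 2 / 4 + x ^ 3 / 9 + 0.2839 * x ^ 4 ≤
      4.6473 * (x * (1 - x / 3 + x ^ 2 / 5 - x ^ 3 / 7) ^ 2) := by
  have h01 := mul_nonneg (sub_nonneg.2 h0) (sub_nonneg.2 h1)
  have h2 : 1.0236 - 0.3396 * x ≤ 1 - x / 3 + x ^ 2 / 5 - x ^ 3 / 7 := by
    nlinarith [mul_nonneg h01 (sub_nonneg.2 h0)]
  have h3 : (1.0236 - 0.3396 * x) ^ 2 ≤ (1 - x / 3 + x ^ 2 / 5 - x ^ 3 / 7) ^ 2 := by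
    have : 0 ≤ 1.0236 - 0.3396 * x := by linarith
    gcongr
  have h4 := mul_le_mul_of_nonneg_left h3 (by linarith : 0 ≤ x)
  have h5 : 1 + x + x ^ 2 / 4 + x ^ 3 / 9 + 0.2839 * x ^ 4 ≤
      4.6473 * (x * (1.0236 - 0.3396 * x) ^ 2) := by
    nlinarith [mul_nonneg h01 (sub_nonneg.2 h0), mul_nonneg h01 (sq_nonneg x), h01]
  linarith

theorem large_radius_polynomial_bound (h0 : 13 / 20 ≤ x) (h1 : x ≤ 1) :
    1 + x + x ^ 2 / 4 + x ^ 3 / 9 + 0.2839 * x ^ 4 ≤ 2.8667 * x := by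
  have h01 := mul_nonneg (sub_nonneg.2 h0) (sub_nonneg.2 h1)
  nlinarith [mul_nonneg h01 (sub_nonneg.2 h0), mul_nonneg h01 (sq_nonneg x), h01]

end PolynomialBounds

/-! ### Lower bounds for the target `(1 + log 2)(4/π) arctan r`. -/

section ArctanBounds

variable {r : ℝ}

/-- Partial sum of the Gregory series: the difference has derivative `t^8 / (1 + t²)`. -/
theorem cubic_le_arctan (hr0 : 0 ≤ r) :
    r * (1 - r ^ 2 / 3 + (r ^ 2) ^ 2 / 5 - (r ^ 2) ^ 3 / 7) ≤ Real.arctan r := by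
  have hd : ∀ t : ℝ, HasDerivAt
      (fun t => Real.arctan t - (t - t ^ 3 / 3 + t ^ 5 / 5 - t ^ 7 / 7))
      (1 / (1 + t ^ 2) - (1 - t ^ 2 + t ^ 4 - t ^ 6)) t := fun t => by
    refine ((Real.hasDerivAt_arctan t).sub ((((hasDerivAt_id t).sub
      ((hasDerivAt_pow 3 t).div_const 3)).add ((hasDerivAt_pow 5 t).div_const 5)).sub
      ((hasDerivAt_pow 7 t).div_const 7))).congr_deriv ?_
    push_cast
    ring
  have hm : Monotone fun t => Real.arctan t - (t - t ^ 3 / 3 + t ^ 5 / 5 - t ^ 7 / 7) := by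
    refine monotone_of_hasDerivAt_nonneg hd fun t => ?_
    have : 1 / (1 + t ^ 2) - (1 - t ^ 2 + t ^ 4 - t ^ 6) = t ^ 8 / (1 + t ^ 2) := by
      field_simp
      ring
    simp only [Pi.zero_apply]
    rw [this]
    positivity
  have h := hm hr0
  simp only [Real.arctan_zero] at h
  norm_num at h
  linarith

theorem pi_mul_le_one_add_log_two : 2.15577 * Real.pi ≤ (1 + Real.log 2) * 4 := by
  have h1 := Real.log_two_gt_d9
  have h2 := Real.pi_lt_d6
  linarith

/-- `4.6473` lies just below `2.15577²`, and `2.15577` just below `(1 + log 2) · 4/π`. -/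
theorem cubic_sq_le_target (hr0 : 0 ≤ r) (hr : r < 1) :
    4.6473 * (r ^ 2 * (1 - r ^ 2 / 3 + (r ^ 2) ^ 2 / 5 - (r ^ 2) ^ 3 / 7) ^ 2) ≤
      ((1 + Real.log 2) * (4 / Real.pi * Real.arctan r)) ^ 2 := by
  have h1 := cubic_le_arctan hr0
  have hpi := Real.pi_pos
  have h2 : 2.15577 ≤ (1 + Real.log 2) * (4 / Real.pi) := by
    rw [← mul_div_assoc, le_div_iff₀ hpi]; exact pi_mul_le_one_add_log_two
  have hx : r ^ 2 ≤ 1 := by nlinarith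
  have h3 : 0 ≤ r * (1 - r ^ 2 / 3 + (r ^ 2) ^ 2 / 5 - (r ^ 2) ^ 3 / 7) := by
    refine mul_nonneg hr0 ?_
    have : (r ^ 2) ^ 3 ≤ 1 := pow_le_one₀ (sq_nonneg r) hx
    nlinarith [sq_nonneg (r ^ 2)]
  calc 4.6473 * (r ^ 2 * (1 - r ^ 2 / 3 + (r ^ 2) ^ 2 / 5 - (r ^ 2) ^ 3 / 7) ^ 2)
      ≤ (2.15577 * (r * (1 - r ^ 2 / 3 + (r ^ 2) ^ 2 / 5 - (r ^ 2) ^ 3 / 7))) ^ 2 := by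
        rw [mul_pow, mul_pow]
        exact mul_le_mul_of_nonneg_right (by norm_num) (by positivity)
    _ ≤ ((1 + Real.log 2) * (4 / Real.pi) * Real.arctan r) ^ 2 := by
        gcongr
    _ = _ := by ring

/-- The chord bound `r ≤ (4/π) arctan r`, better near `r = 1`; `2.8667` lies just below `(1 + log
2)²`. -/
theorem linear_sq_le_target (hr0 : 0 ≤ r) (hr : r < 1) :
    2.8667 * r ^ 2 ≤ ((1 + Real.log 2) * (4 / Real.pi * Real.arctan r)) ^ 2 := by
  have h1 := pi_div_four_mul_le_arctan hr0 hr.le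
  have hpi := Real.pi_pos
  have h2 : r ≤ 4 / Real.pi * Real.arctan r := by
    rw [div_mul_eq_mul_div, le_div_iff₀ hpi]; linarith
  have h3 : 1.69314 ≤ 1 + Real.log 2 := by linarith [Real.log_two_gt_d9]
  calc 2.8667 * r ^ 2 ≤ (1.69314 * r) ^ 2 := by nlinarith [sq_nonneg r]
    _ ≤ _ := by gcongr

end ArctanBounds

/-! ### Parseval with analytic and antianalytic parts. -/

section TwoSidedParseval

/-- Parseval's identity for a trigonometric series given by its analytic and antianalytic parts. -/
theorem integral_norm_sq_eq_tsum_add_tsum {g h : ℕ → ℝ} (hg : Summable fun n => |g n|)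
    (hh : Summable fun n => |h n|) {F G H : ℝ → ℂ} (hFc : Continuous F)
    (hG : ∀ θ : ℝ, HasSum (fun n : ℕ => (g n : ℂ) * exp (θ * I) ^ n) (G θ))
    (hH : ∀ θ : ℝ, HasSum (fun n : ℕ => (h n : ℂ) * exp (-(θ * I)) ^ (n + 1)) (H θ))
    (hF : ∀ θ, F θ = G θ + H θ) :
    Summable (fun n => g n ^ 2) ∧ Summable (fun n => h n ^ 2) ∧
    ∫ θ in (0 : ℝ)..(2 * Real.pi), ‖F θ‖ ^ 2 = 2 * Real.pi * (∑' n, g n ^ 2 + ∑' n, h n ^ 2) := by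
  -- `Int.negSucc n` is `-(n + 1)`, so `h n` is the coefficient of `e^{-i(n+1)θ}`.
  obtain ⟨d, hdg, hdh⟩ : ∃ d : ℤ → ℝ, (∀ n : ℕ, d n = g n) ∧ ∀ n : ℕ, d (Int.negSucc n) = h n :=
    ⟨fun n => Int.rec (motive := fun _ => ℝ) g h n, fun _ => rfl, fun _ => rfl⟩
  have hd : Summable fun n => |d n| := by
    have := (hg.hasSum.int_rec hh.hasSum).summable
    refine this.congr fun n => ?_
    cases n with
    | ofNat n => simpa using congrArg abs (hdg n).symm
    | negSucc n => simp [hdh]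
  have hFd : ∀ θ : ℝ, HasSum (fun n : ℤ => (d n : ℂ) * exp (n * θ * I)) (F θ) := fun θ => by
    rw [hF]
    refine HasSum.congr_fun ((hG θ).int_rec (hH θ)) fun n => ?_
    cases n with
    | ofNat n =>
      simp only [← Complex.exp_nat_mul, Int.ofNat_eq_natCast, hdg, Int.cast_natCast, mul_assoc]
    | negSucc n =>
      simp only [← Complex.exp_nat_mul, hdh]
      congr 2
      push_cast [Int.cast_negSucc]
      ring
  have hsq : ∀ u : ℕ → ℝ, Summable (fun n => |u n|) → Summable fun n => u n ^ 2 := fun u hu => by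
    refine Summable.of_norm_bounded_eventually_nat (g := fun n => |u n|) hu ?_
    filter_upwards [hu.tendsto_atTop_zero.eventually (gt_mem_nhds one_pos)] with n hn
    rw [Real.norm_eq_abs, abs_pow, pow_two]
    exact mul_le_of_le_one_left (abs_nonneg _) hn.le
  refine ⟨hsq g hg, hsq h hh, ?_⟩
  have h1 := integral_norm_sq_eq_tsum hd hFc hFd
  have h2 := ((hsq g hg).hasSum.int_rec (hsq h hh).hasSum).mul_left (2 * Real.pi)
  rw [← h1.tsum_eq, ← h2.tsum_eq]
  refine tsum_congr fun n => ?_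
  cases n with
  | ofNat n => simp [hdg]
  | negSucc n => simp [hdh]

end TwoSidedParseval

/-! ### Passing from weighted `L²` to `L¹`. -/

section CauchySchwarz

/-- The weighted Cauchy–Schwarz bound for a circle mean. -/
theorem integral_norm_le_of_integral_norm_sq_le {W f : ℝ → ℂ} (hW : Continuous W)
    (hf : Continuous f) (hf0 : ∀ θ, f θ ≠ 0) {B T : ℝ} (hB : 0 < B) (hT : 0 < T)
    (h1 : ∫ θ in (0 : ℝ)..(2 * Real.pi), ‖W θ * f θ‖ ^ 2 ≤ 2 * Real.pi * (B * T ^ 2))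
    (h2 : ∫ θ in (0 : ℝ)..(2 * Real.pi), (‖f θ‖ ^ 2)⁻¹ ≤ 2 * Real.pi / B) :
    ∫ θ in (0 : ℝ)..(2 * Real.pi), ‖W θ‖ ≤ 2 * Real.pi * T := by
  have hfi : Continuous fun θ => (‖f θ‖ ^ 2)⁻¹ :=
    (hf.norm.pow 2).inv₀ fun θ => pow_ne_zero _ (norm_ne_zero_iff.2 (hf0 θ))
  have hWf : Continuous fun θ => ‖W θ * f θ‖ ^ 2 := (hW.mul hf).norm.pow 2
  -- Pointwise AM–GM, with equality where `‖W‖ ‖f‖² = T B`, replaces Cauchy–Schwarz.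
  have hpt : ∀ θ, ‖W θ‖ ≤ (2 * (T * B))⁻¹ * ‖W θ * f θ‖ ^ 2 + T * B / 2 * (‖f θ‖ ^ 2)⁻¹ := fun θ => by
    have hn : 0 < ‖f θ‖ := norm_pos_iff.2 (hf0 θ)
    have hTB : 0 < T * B := mul_pos hT hB
    have : (2 * (T * B))⁻¹ * ‖W θ * f θ‖ ^ 2 + T * B / 2 * (‖f θ‖ ^ 2)⁻¹ - ‖W θ‖ =
        (‖W θ‖ * ‖f θ‖ ^ 2 - T * B) ^ 2 / (2 * (T * B) * ‖f θ‖ ^ 2) := by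
      rw [norm_mul]
      field_simp
      ring
    have h3 : 0 ≤ (‖W θ‖ * ‖f θ‖ ^ 2 - T * B) ^ 2 / (2 * (T * B) * ‖f θ‖ ^ 2) := by positivity
    linarith
  have hpi := Real.pi_pos
  calc ∫ θ in (0 : ℝ)..(2 * Real.pi), ‖W θ‖
      ≤ ∫ θ in (0 : ℝ)..(2 * Real.pi),
          ((2 * (T * B))⁻¹ * ‖W θ * f θ‖ ^ 2 + T * B / 2 * (‖f θ‖ ^ 2)⁻¹) :=
        intervalIntegral.integral_mono (by positivity) (hW.norm.intervalIntegrable _ _)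
          (((continuous_const.mul hWf).add (continuous_const.mul hfi)).intervalIntegrable _ _) hpt
    _ = (2 * (T * B))⁻¹ * (∫ θ in (0 : ℝ)..(2 * Real.pi), ‖W θ * f θ‖ ^ 2) +
          T * B / 2 * ∫ θ in (0 : ℝ)..(2 * Real.pi), (‖f θ‖ ^ 2)⁻¹ := by
        rw [intervalIntegral.integral_add ((hWf.intervalIntegrable _ _).const_mul _)
          ((hfi.intervalIntegrable _ _).const_mul _),
          intervalIntegral.integral_const_mul, intervalIntegral.integral_const_mul]
    _ ≤ (2 * (T * B))⁻¹ * (2 * Real.pi * (B * T ^ 2)) + T * B / 2 * (2 * Real.pi / B) := by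
        gcongr
    _ = _ := by field_simp; ring

/-- `|1 - b w²|^{-2}` is a multiple of the kernel with parameter `b` at `2θ + π`; the shift by `π`
is there because the kernel has its pole at `-b`. -/
theorem integral_inv_norm_one_sub_sq {b : ℝ} (hb0 : 0 ≤ b) (hb : b < 1) :
    ∫ θ in (0 : ℝ)..(2 * Real.pi), (‖1 - (b : ℂ) * exp (θ * I) ^ 2‖ ^ 2)⁻¹ =
      2 * Real.pi / (1 - b ^ 2) := by
  have hb2 : 0 < 1 - b ^ 2 := by nlinarith
  have e : ∀ θ : ℝ, (‖1 - (b : ℂ) * exp (θ * I) ^ 2‖ ^ 2)⁻¹ =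
      (1 - b ^ 2)⁻¹ * circleKernel b (2 * θ + Real.pi) := fun θ => by
    have h1 : ‖1 - (b : ℂ) * exp (θ * I) ^ 2‖ ^ 2 =
        1 + 2 * b * Real.cos (2 * θ + Real.pi) + b ^ 2 := by
      rw [← Complex.exp_nat_mul, show ((2 : ℕ) : ℂ) * (θ * I) = ((2 * θ : ℝ) : ℂ) * I by
        push_cast; ring, Complex.exp_mul_I, ← ofReal_cos, ← ofReal_sin, Real.cos_add_pi,
        ← Complex.normSq_eq_norm_sq, Complex.normSq_apply]
      simp only [sub_re, one_re, mul_re, ofReal_re, ofReal_im, add_re, I_re, I_im, sub_im, one_im,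
        mul_im, add_im]
      linear_combination b ^ 2 * Real.sin_sq_add_cos_sq (2 * θ)
    rw [h1, circleKernel]
    field_simp
  simp only [e]
  rw [intervalIntegral.integral_const_mul,
    intervalIntegral.integral_comp_mul_add (circleKernel b) two_ne_zero,
    integral_circleKernel hb0 hb]
  have s1 : Real.sin (2 * (2 * Real.pi) + Real.pi) = 0 := by
    rw [show 2 * (2 * Real.pi) + Real.pi = (5 : ℕ) * Real.pi by push_cast; ring, Real.sin_nat_mul_pi]
  have s2 : Real.sin (2 * 0 + Real.pi) = 0 := by simp
  rw [s1, s2]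
  simp only [mul_zero, zero_div, Real.arctan_zero, smul_eq_mul]
  field_simp
  ring

end CauchySchwarz

/-! ### The slope for `0 < α ≤ 1`: plain `L²` bound. -/

section FractionalExponent

variable {α r : ℝ}

/-- `1 + ((1 + z)^α - 1) / α`, at `z = r e^{iθ}`. -/
noncomputable def cpowSlope (α r θ : ℝ) : ℂ :=
  1 + ((1 + (r : ℂ) * exp (θ * I)) ^ (α : ℂ) - 1) / α

/-- The Taylor coefficients of `1 + ((1 + z)^α - 1) / α`. -/
noncomputable def slopeCoeff (α : ℝ) : ℕ → ℝ
  | 0 => 1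
  | n + 1 => (-1) ^ n * binomialTail α n

theorem cpowSlope_continuous (hr0 : 0 ≤ r) (hr : r < 1) : Continuous (cpowSlope α r) :=
  continuous_const.add (((continuous_one_add_cpow hr0 hr α).sub continuous_const).div_const _)

theorem norm_radius_mul_exp (hr0 : 0 ≤ r) (θ : ℝ) : ‖(r : ℂ) * exp (θ * I)‖ = r := by
  rw [norm_mul_exp_I, abs_of_nonneg hr0]

theorem hasSum_cpowSlope (hα : α ≠ 0) (hr0 : 0 ≤ r) (hr : r < 1) (θ : ℝ) :
    HasSum (fun n : ℕ => ((slopeCoeff α n * r ^ n : ℝ) : ℂ) * exp (θ * I) ^ n)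
      (cpowSlope α r θ) := by
  have h := (hasSum_one_add_cpow (α := α) (z := (r : ℂ) * exp (θ * I))
    (by rwa [norm_radius_mul_exp hr0])).div_const (α : ℂ)
  have hα' : (α : ℂ) ≠ 0 := ofReal_ne_zero.2 hα
  rw [← hasSum_nat_add_iff' 1]
  simp only [Finset.range_one, Finset.sum_singleton, slopeCoeff, cpowSlope, pow_zero, mul_one,
    ofReal_one, add_sub_cancel_left]
  refine h.congr_fun fun n => ?_
  rw [mul_div_cancel_left₀ _ hα']
  push_cast
  ring

theorem abs_slopeCoeff_le (h0 : 0 ≤ α) (h1 : α ≤ 1) (n : ℕ) : |slopeCoeff α n| ≤ 1 := by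
  cases n with
  | zero => simp [slopeCoeff]
  | succ n =>
    rw [slopeCoeff, abs_mul, abs_pow, abs_neg, abs_one, one_pow, one_mul,
      abs_of_nonneg (binomialTail_nonneg h1 n)]
    refine (binomialTail_le h0 h1 n).trans ?_
    have : (0 : ℝ) ≤ n := n.cast_nonneg
    rw [div_le_one (by linarith)]
    linarith

theorem summable_abs_mul_pow {u : ℕ → ℝ} {K : ℝ} (hr0 : 0 ≤ r) (hr : r < 1)
    (hu : ∀ n, |u n| ≤ K) : Summable fun n => |u n * r ^ n| := by
  refine Summable.of_nonneg_of_le (fun n => abs_nonneg _) (fun n => ?_)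
    ((summable_geometric_of_lt_one hr0 hr).mul_left K)
  rw [abs_mul, abs_of_nonneg (pow_nonneg hr0 n)]
  exact mul_le_mul_of_nonneg_right (hu n) (pow_nonneg hr0 n)

theorem tsum_inv_sq_tail_le : ∑' n : ℕ, 1 / ((n : ℝ) + 4) ^ 2 ≤ 0.2839 := by
  -- The dropped terms have indices `0` to `3`; the one of index `0` is `1 / 0 = 0`. What remains is
  -- `π²/6 - 1 - 1/4 - 1/9`.
  have h := (hasSum_nat_add_iff' 4).2 hasSum_zeta_two
  have e : ∀ n : ℕ, 1 / ((n + 4 : ℕ) : ℝ) ^ 2 = 1 / ((n : ℝ) + 4) ^ 2 := fun n => by push_cast; rfl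
  simp only [e] at h
  rw [h.tsum_eq]
  norm_num [Finset.sum_range_succ]
  have h2 := Real.pi_lt_d6
  have h3 := Real.pi_pos
  nlinarith

theorem integral_norm_cpowSlope_sq_le (h0 : 0 < α) (h1 : α ≤ 1) (hr0 : 0 ≤ r) (hr : r < 1) :
    ∫ θ in (0 : ℝ)..(2 * Real.pi), ‖cpowSlope α r θ‖ ^ 2 ≤ 2 * Real.pi *
      (1 + r ^ 2 + (r ^ 2) ^ 2 / 4 + (r ^ 2) ^ 3 / 9 + 0.2839 * (r ^ 2) ^ 4) := by
  obtain ⟨hs, -, he⟩ := integral_norm_sq_eq_tsum_add_tsum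
    (summable_abs_mul_pow hr0 hr (abs_slopeCoeff_le h0.le h1)) (h := fun _ => 0) (by simp)
    (cpowSlope_continuous (α := α) hr0 hr) (hasSum_cpowSlope h0.ne' hr0 hr) (H := fun _ => 0)
    (fun θ => by simp) (by simp)
  rw [he]
  refine mul_le_mul_of_nonneg_left ?_ (by positivity)
  have hx0 : 0 ≤ r ^ 2 := sq_nonneg r
  have hx1 : r ^ 2 ≤ 1 := by nlinarith
  have hb : ∀ n, 0 ≤ binomialTail α n := binomialTail_nonneg h1
  have hb' : ∀ n : ℕ, binomialTail α n ≤ 1 / (n + 1) := binomialTail_le h0.le h1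
  have hsq : ∀ n : ℕ, (slopeCoeff α (n + 1) * r ^ (n + 1)) ^ 2 =
      binomialTail α n ^ 2 * (r ^ 2) ^ (n + 1) := fun n => by
    have h2 : ((-1 : ℝ) ^ n) ^ 2 = 1 := by rw [← pow_mul, mul_comm, pow_mul]; simp
    rw [slopeCoeff]
    linear_combination binomialTail α n ^ 2 * (r ^ 2) ^ (n + 1) * h2
  rw [← hs.sum_add_tsum_nat_add 4]
  simp only [Finset.sum_range_succ, Finset.range_zero, Finset.sum_empty, hsq, zero_add]
  have t1 : binomialTail α 1 ≤ 1 / 2 := by have := hb' 1; norm_num at this ⊢; exact this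
  have t2 : binomialTail α 2 ≤ 1 / 3 := by have := hb' 2; norm_num at this ⊢; exact this
  have s1 : binomialTail α 1 ^ 2 * (r ^ 2) ^ 2 ≤ (1 / 2) ^ 2 * (r ^ 2) ^ 2 := by
    have := hb 1; gcongr
  have s2 : binomialTail α 2 ^ 2 * (r ^ 2) ^ 3 ≤ (1 / 3) ^ 2 * (r ^ 2) ^ 3 := by
    have := hb 2; gcongr
  have hz : Summable fun n : ℕ => 1 / ((n : ℝ) + 4) ^ 2 := by
    have h := (hasSum_nat_add_iff' 4).2 hasSum_zeta_two
    have e : ∀ n : ℕ, 1 / ((n + 4 : ℕ) : ℝ) ^ 2 = 1 / ((n : ℝ) + 4) ^ 2 := fun n => by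
      push_cast; rfl
    simp only [e] at h
    exact h.summable
  have s3 : ∑' n : ℕ, binomialTail α (n + 3) ^ 2 * (r ^ 2) ^ (n + 3 + 1) ≤
      0.2839 * (r ^ 2) ^ 4 := by
    calc ∑' n : ℕ, binomialTail α (n + 3) ^ 2 * (r ^ 2) ^ (n + 3 + 1)
        ≤ ∑' n : ℕ, (r ^ 2) ^ 4 * (1 / ((n : ℝ) + 4) ^ 2) := by
          refine Summable.tsum_le_tsum (fun n => ?_) ?_ (hz.mul_left _)
          · have h4 : binomialTail α (n + 3) ≤ 1 / ((n : ℝ) + 4) := by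
              have := hb' (n + 3)
              push_cast at this
              rwa [show (n : ℝ) + 3 + 1 = n + 4 by ring] at this
            have h5 : (r ^ 2) ^ (n + 3 + 1) ≤ (r ^ 2) ^ 4 :=
              pow_le_pow_of_le_one hx0 hx1 (by omega)
            have h6 := hb (n + 3)
            calc _ ≤ (1 / ((n : ℝ) + 4)) ^ 2 * (r ^ 2) ^ 4 := by gcongr
              _ = _ := by rw [div_pow, one_pow, mul_comm]
          · have := (summable_nat_add_iff 4).2 hs
            refine this.congr fun n => ?_
            rw [show n + 4 = n + 3 + 1 from rfl, hsq]
      _ = (r ^ 2) ^ 4 * ∑' n : ℕ, 1 / ((n : ℝ) + 4) ^ 2 := tsum_mul_left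
      _ ≤ _ := by
          rw [mul_comm]
          exact mul_le_mul_of_nonneg_right tsum_inv_sq_tail_le (by positivity)
  have s0 : slopeCoeff α 0 = 1 := rfl
  have s4 : binomialTail α 0 = 1 := rfl
  rw [s0, s4]
  simp only [zero_pow two_ne_zero, tsum_zero]
  norm_num at s1 s2 s3 ⊢
  linarith

end FractionalExponent

/-! ### The slope at small radius: subtraction of the kernel and a weight. -/

section SmallRadius

variable {α r b c : ℝ}

theorem ofReal_circleKernel (hr0 : 0 ≤ r) (hr : r < 1) (θ : ℝ) :
    (circleKernel r θ : ℂ) = 1 / (1 + r * exp (θ * I)) -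
      r * exp (-(θ * I)) / (1 + r * exp (-(θ * I))) := by
  have n1 : 1 + (r : ℂ) * exp (θ * I) ≠ 0 := fun h => by
    have := norm_radius_mul_exp hr0 θ
    rw [eq_neg_of_add_eq_zero_right h, norm_neg, norm_one] at this
    exact hr.ne' this
  have n2 : 1 + (r : ℂ) * exp (-(θ * I)) ≠ 0 := fun h => by
    have := norm_radius_mul_exp hr0 (-θ)
    rw [ofReal_neg, neg_mul, eq_neg_of_add_eq_zero_right h, norm_neg, norm_one] at this
    exact hr.ne' this
  have hc : 2 * Complex.cos θ = exp (θ * I) + exp (-(θ * I)) := by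
    rw [Complex.cos, neg_mul]; ring
  have he : exp (θ * I) * exp (-(θ * I)) = 1 := by rw [← Complex.exp_add]; simp
  have hd : ((1 + 2 * r * Real.cos θ + r ^ 2 : ℝ) : ℂ) =
      (1 + r * exp (θ * I)) * (1 + r * exp (-(θ * I))) := by
    push_cast
    linear_combination (r : ℂ) * hc - (r : ℂ) ^ 2 * he
  rw [circleKernel, ofReal_div, hd, div_sub_div _ _ n1 n2]
  congr 1
  push_cast
  linear_combination (r : ℂ) ^ 2 * he

/-- The Taylor coefficients of `(1 + ((1 + z)^α - 1) / α - c / (1 + z)) (1 - b z² / r²)`, corrected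
by the analytic part of the kernel, at `z = r w` in powers of `w`. -/
noncomputable def smallCoeff (α r b c : ℝ) : ℕ → ℝ
  | 0 => 1 - c + b * c * r ^ 2
  | 1 => r * (1 + c) - b * c * r
  | n + 2 => (slopeCoeff α (n + 2) - c * (-1) ^ (n + 2)) * r ^ (n + 2) -
      b * ((slopeCoeff α n - c * (-1) ^ n) * r ^ n)

/-- The two extra terms come from the antianalytic part of the kernel. With `η = w⁻¹`, `w² · rη/(1 +
rη) = r w - r² + r² · rη/(1 + rη)`, so multiplication by `b w²` moves two terms to nonnegative
frequencies and leaves the factor `1 - b r²` on the rest. -/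
theorem hasSum_smallCoeff (hα : α ≠ 0) (hr0 : 0 ≤ r) (hr : r < 1) (θ : ℝ) :
    HasSum (fun n : ℕ => (smallCoeff α r b c n : ℂ) * exp (θ * I) ^ n)
      ((cpowSlope α r θ - c / (1 + r * exp (θ * I))) * (1 - b * exp (θ * I) ^ 2) +
        b * c * r ^ 2 - b * c * r * exp (θ * I)) := by
  set w := exp (θ * I)
  have hgeo : HasSum (fun n : ℕ => ((c * (-1) ^ n * r ^ n : ℝ) : ℂ) * w ^ n)
      (c / (1 + r * w)) := by
    have h := (hasSum_geometric_of_norm_lt_one (ξ := -((r : ℂ) * w))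
      (by rwa [norm_neg, norm_radius_mul_exp hr0])).mul_left (c : ℂ)
    rw [sub_neg_eq_add, ← div_eq_mul_inv] at h
    refine h.congr_fun fun n => ?_
    push_cast
    rw [neg_eq_neg_one_mul ((r : ℂ) * w), mul_pow, mul_pow]
    ring
  have hS := (hasSum_cpowSlope hα hr0 hr θ).sub hgeo
  have h0 := ((hasSum_nat_add_iff' 2).2 hS).sub (hS.mul_left ((b : ℂ) * w ^ 2))
  rw [← hasSum_nat_add_iff' 2]
  convert h0.congr_fun (fun n => ?_) using 1
  · simp only [Finset.sum_range_succ, Finset.range_zero, Finset.sum_empty, smallCoeff, slopeCoeff,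
      binomialTail]
    push_cast
    ring
  · rw [smallCoeff]
    push_cast
    ring

theorem hasSum_reflected (hr0 : 0 ≤ r) (hr : r < 1) (κ θ : ℝ) :
    HasSum (fun n : ℕ => ((κ * (-1) ^ n * r ^ (n + 1) : ℝ) : ℂ) * exp (-(θ * I)) ^ (n + 1))
      (κ * (r * exp (-(θ * I)) / (1 + r * exp (-(θ * I))))) := by
  have hn := norm_radius_mul_exp hr0 (-θ)
  rw [ofReal_neg, neg_mul] at hn
  have h := (hasSum_geometric_of_norm_lt_one (ξ := -((r : ℂ) * exp (-(θ * I))))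
    (by rwa [norm_neg, hn])).mul_left ((κ : ℂ) * (r * exp (-(θ * I))))
  rw [sub_neg_eq_add, ← div_eq_mul_inv, mul_div_assoc] at h
  refine h.congr_fun fun n => ?_
  push_cast
  rw [neg_eq_neg_one_mul ((r : ℂ) * _), mul_pow, mul_pow]
  ring

/-- The signs alternate in step, so up to sign each coefficient is a difference `A - B` of
nonnegative quantities and `(A - B)² ≤ A² + B²`. -/
theorem smallCoeff_add_four_sq_le (h0 : 0 ≤ α) (h1 : α ≤ 1) (hb : 0 ≤ b) (hc : 0 ≤ c)
    (n : ℕ) : smallCoeff α r b c (n + 4) ^ 2 ≤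
      ((r ^ 2) ^ 4 * (c + 1 / 4) ^ 2 + b ^ 2 * (r ^ 2) ^ 2 * (c + 1 / 2) ^ 2) * (r ^ 2) ^ n := by
  have hn : (0 : ℝ) ≤ n := n.cast_nonneg
  have q1 := binomialTail_nonneg h1 (n + 1)
  have q3 := binomialTail_nonneg h1 (n + 3)
  have q1' : binomialTail α (n + 1) ≤ 1 / 2 := (binomialTail_le h0 h1 _).trans (by
    push_cast
    exact one_div_le_one_div_of_le (by norm_num) (by linarith))
  have q3' : binomialTail α (n + 3) ≤ 1 / 4 := (binomialTail_le h0 h1 _).trans (by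
    push_cast
    exact one_div_le_one_div_of_le (by norm_num) (by linarith))
  have hs : ((-1 : ℝ) ^ n) ^ 2 = 1 := by rw [← pow_mul, mul_comm, pow_mul]; simp
  have e : smallCoeff α r b c (n + 4) ^ 2 =
      (r ^ 2 * (c + binomialTail α (n + 3)) - b * (c + binomialTail α (n + 1))) ^ 2 *
        (r ^ 2) ^ (n + 2) := by
    rw [show n + 4 = n + 2 + 2 from rfl, smallCoeff, show n + 2 + 2 = n + 3 + 1 from rfl,
      slopeCoeff, show n + 2 = n + 1 + 1 from rfl, slopeCoeff]
    linear_combination (r ^ 2 * (c + binomialTail α (n + 3)) - b * (c + binomialTail α (n + 1))) ^ 2 *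
        (r ^ 2) ^ (n + 2) * hs
  rw [e]
  have hA : 0 ≤ r ^ 2 * (c + binomialTail α (n + 3)) := by positivity
  have hB : 0 ≤ b * (c + binomialTail α (n + 1)) := by positivity
  have hA' : r ^ 2 * (c + binomialTail α (n + 3)) ≤ r ^ 2 * (c + 1 / 4) := by gcongr
  have hB' : b * (c + binomialTail α (n + 1)) ≤ b * (c + 1 / 2) := by gcongr
  calc _ ≤ ((r ^ 2 * (c + 1 / 4)) ^ 2 + (b * (c + 1 / 2)) ^ 2) * (r ^ 2) ^ (n + 2) := by
        refine mul_le_mul_of_nonneg_right ?_ (by positivity)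
        nlinarith [mul_nonneg hA hB, pow_le_pow_left₀ hA hA' 2, pow_le_pow_left₀ hB hB' 2]
    _ = _ := by ring

theorem summable_abs_smallCoeff (h0 : 0 ≤ α) (h1 : α ≤ 1) (hr0 : 0 ≤ r) (hr : r < 1)
    (b c : ℝ) : Summable fun n => |smallCoeff α r b c n| := by
  have hp : ∀ n : ℕ, |slopeCoeff α n - c * (-1) ^ n| ≤ 1 + |c| := fun n => by
    refine (abs_sub _ _).trans (add_le_add (abs_slopeCoeff_le h0 h1 n) ?_)
    rw [abs_mul, abs_pow, abs_neg, abs_one, one_pow, mul_one]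
  have hs := summable_abs_mul_pow hr0 hr hp
  refine (summable_nat_add_iff 2).1 ?_
  refine Summable.of_nonneg_of_le (fun n => abs_nonneg _) (fun n => ?_)
    (((summable_nat_add_iff 2).2 hs).add (hs.mul_left |b|))
  rw [smallCoeff]
  refine (abs_sub _ _).trans ?_
  rw [abs_mul b]

/-- The right side vanishes like `r²`, which forces `c → 1` as `r → 0`. With `b = 0` the coefficient
of `r²` on the left would be `2² + 1 = 5`, above `4.6473`. The weight lowers it to `(2 - b)² + 4b² +
1`, which for `b = 7/50` is below `4.6473 (1 - b²)`. -/
theorem integral_norm_sub_kernel_sq_le (h0 : 0 < α) (h1 : α ≤ 1) (hr0 : 0 ≤ r) (hr : r < 1)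
    (hr2 : r ^ 2 ≤ 2 / 5) (hc : c = 1 - 11 / 5 * r ^ 2) (hb : b = 7 / 50) :
    ∫ θ in (0 : ℝ)..(2 * Real.pi),
      ‖(cpowSlope α r θ - c * circleKernel r θ) * (1 - b * exp (θ * I) ^ 2)‖ ^ 2 ≤
    2 * Real.pi * ((1 - b ^ 2) *
      (4.6473 * (r ^ 2 * (1 - r ^ 2 / 3 + (r ^ 2) ^ 2 / 5 - (r ^ 2) ^ 3 / 7) ^ 2))) := by
  have hx0 : 0 ≤ r ^ 2 := sq_nonneg r
  have hx : 0 < 1 - r ^ 2 := by linarith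
  have hb0 : 0 ≤ b := by rw [hb]; norm_num
  have hc0 : 0 ≤ c := by rw [hc]; linarith
  have hcont : Continuous fun θ : ℝ =>
      (cpowSlope α r θ - c * circleKernel r θ) * (1 - b * exp (θ * I) ^ 2) :=
    ((cpowSlope_continuous hr0 hr).sub (continuous_const.mul
      (Complex.continuous_ofReal.comp (circleKernel_continuous hr0 hr)))).mul (by fun_prop)
  have hsh : Summable fun n : ℕ => |((1 - b * r ^ 2) * c * r * (-1) ^ n) * r ^ n| :=
    summable_abs_mul_pow hr0 hr (K := |(1 - b * r ^ 2) * c * r|) fun n => by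
      rw [abs_mul, abs_pow, abs_neg, abs_one, one_pow, mul_one]
  have hsh' : Summable fun n : ℕ => |(1 - b * r ^ 2) * c * (-1) ^ n * r ^ (n + 1)| :=
    hsh.congr fun n => by congr 1; ring
  obtain ⟨hs, hs', he⟩ := integral_norm_sq_eq_tsum_add_tsum
    (summable_abs_smallCoeff h0.le h1 hr0 hr b c) hsh' hcont
    (hasSum_smallCoeff h0.ne' hr0 hr) (hasSum_reflected hr0 hr _) (fun θ => by
      have he : exp (θ * I) * exp (-(θ * I)) = 1 := by rw [← Complex.exp_add]; simp
      have n2 : 1 + (r : ℂ) * exp (-(θ * I)) ≠ 0 := fun h => by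
        have := norm_radius_mul_exp hr0 (-θ)
        rw [ofReal_neg, neg_mul, eq_neg_of_add_eq_zero_right h, norm_neg, norm_one] at this
        exact hr.ne' this
      rw [ofReal_circleKernel hr0 hr]
      set w := exp (θ * I)
      set η := exp (-(θ * I))
      set k := 1 / (1 + (r : ℂ) * w)
      rw [div_eq_mul_one_div (c : ℂ) (1 + r * w)]
      push_cast
      field_simp
      linear_combination (b * c * r ^ 2 - b * c * r * w) * he)
  have hq1 := binomialTail_le h0.le h1 1
  have hq2 := binomialTail_le h0.le h1 2
  norm_num at hq1 hq2
  have hgeo : HasSum (fun n : ℕ => ((1 - b * r ^ 2) * c * (-1) ^ n * r ^ (n + 1)) ^ 2)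
      ((1 - b * r ^ 2) ^ 2 * c ^ 2 * r ^ 2 / (1 - r ^ 2)) := by
    rw [div_eq_mul_inv]
    refine ((hasSum_geometric_of_lt_one hx0 (by linarith)).mul_left _).congr_fun fun n => ?_
    have hs : ((-1 : ℝ) ^ n) ^ 2 = 1 := by rw [← pow_mul, mul_comm, pow_mul]; simp
    linear_combination (1 - b * r ^ 2) ^ 2 * c ^ 2 * r ^ 2 * (r ^ 2) ^ n * hs
  have hgeo' := (hasSum_geometric_of_lt_one hx0 (by linarith : r ^ 2 < 1)).mul_left
    ((r ^ 2) ^ 4 * (c + 1 / 4) ^ 2 + b ^ 2 * (r ^ 2) ^ 2 * (c + 1 / 2) ^ 2)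
  have htail : ∑' n, smallCoeff α r b c (n + 4) ^ 2 ≤
      ((r ^ 2) ^ 4 * (c + 1 / 4) ^ 2 + b ^ 2 * (r ^ 2) ^ 2 * (c + 1 / 2) ^ 2) / (1 - r ^ 2) := by
    rw [div_eq_mul_inv, ← hgeo'.tsum_eq]
    exact Summable.tsum_le_tsum (smallCoeff_add_four_sq_le h0.le h1 hb0 hc0)
      ((summable_nat_add_iff 4).2 hs) hgeo'.summable
  rw [he, hgeo.tsum_eq]
  refine mul_le_mul_of_nonneg_left ?_ (by positivity)
  refine le_trans (add_le_add_left ?_ _) (small_radius_polynomial_bound hx0 hr2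
    (binomialTail_nonneg h1 1) (by linarith) (binomialTail_nonneg h1 2) (by linarith) hc hb)
  rw [← hs.sum_add_tsum_nat_add 4]
  refine add_le_add (le_of_eq ?_) htail
  simp only [Finset.sum_range_succ, Finset.range_zero, Finset.sum_empty, smallCoeff, slopeCoeff,
    show binomialTail α 0 = 1 from rfl]
  ring

end SmallRadius

/-! ### The weighted Schwarz lemma on the circle. -/

section Weighted

variable {α r M : ℝ} {U : ℝ → ℂ}

/-- The key estimate for exponents below one, in terms of the difference quotient in `α`. -/
theorem norm_integral_cpowSlope_le (h0 : 0 < α) (h1 : α ≤ 1) (hr0 : 0 < r) (hr : r < 1)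
    (hU : Continuous U) (hUM : ∀ θ, ‖U θ‖ ≤ M)
    (hk : ∫ θ in (0 : ℝ)..(2 * Real.pi), (circleKernel r θ : ℂ) * U θ = 0) :
    ‖∫ θ in (0 : ℝ)..(2 * Real.pi), cpowSlope α r θ * U θ‖ ≤
      M * ((1 + Real.log 2) * (8 * Real.arctan r)) := by
  have hM : 0 ≤ M := (norm_nonneg _).trans (hUM 0)
  have hc := cpowSlope_continuous (α := α) hr0.le hr
  have hpi := Real.pi_pos
  have hT : 0 < (1 + Real.log 2) * (4 / Real.pi * Real.arctan r) := by
    have := Real.arctan_pos.2 hr0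
    have := Real.log_pos one_lt_two
    positivity
  obtain ⟨c, hcb⟩ : ∃ c : ℝ, ∫ θ in (0 : ℝ)..(2 * Real.pi), ‖cpowSlope α r θ - c * circleKernel r θ‖ ≤
      2 * Real.pi * ((1 + Real.log 2) * (4 / Real.pi * Real.arctan r)) := by
    have hkc : ∀ c : ℝ, Continuous fun θ => cpowSlope α r θ - c * circleKernel r θ := fun c =>
      hc.sub (continuous_const.mul
        (Complex.continuous_ofReal.comp (circleKernel_continuous hr0.le hr)))
    have hx1 : r ^ 2 < 1 := by nlinarith
    rcases le_total (r ^ 2) (2 / 5) with hx | hx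
    · refine ⟨1 - 11 / 5 * r ^ 2, integral_norm_le_of_integral_norm_sq_le (hkc _)
        (f := fun θ : ℝ => 1 - ((7 / 50 : ℝ) : ℂ) * exp (θ * I) ^ 2) (by fun_prop) (fun θ h => ?_)
        (B := 1 - (7 / 50) ^ 2) (by norm_num) hT ?_ ?_⟩
      · have := congrArg norm (sub_eq_zero.1 h)
        rw [norm_one, norm_mul, norm_pow, norm_exp_ofReal_mul_I, norm_real] at this
        norm_num at this
      · refine (integral_norm_sub_kernel_sq_le h0 h1 hr0.le hr hx rfl rfl).trans ?_
        have := cubic_sq_le_target hr0.le hr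
        gcongr
      · exact (integral_inv_norm_one_sub_sq (by norm_num) (by norm_num)).le
    -- Away from the origin the target is large enough: no kernel is subtracted and the weight is
    -- trivial.
    · refine ⟨0, integral_norm_le_of_integral_norm_sq_le (hkc _) (f := fun _ => 1) continuous_const
        (fun _ => one_ne_zero) (B := 1) one_pos hT ?_ (by simp)⟩
      simp only [ofReal_zero, zero_mul, sub_zero, mul_one, one_mul]
      refine (integral_norm_cpowSlope_sq_le h0 h1 hr0.le hr).trans ?_
      refine mul_le_mul_of_nonneg_left ?_ (by positivity)
      rcases le_total (r ^ 2) (13 / 20) with hx' | hx'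
      · exact (middle_radius_polynomial_bound hx hx').trans (cubic_sq_le_target hr0.le hr)
      · exact (large_radius_polynomial_bound hx' hx1.le).trans (linear_sq_le_target hr0.le hr)
  refine (norm_integral_mul_le hr0.le hr hU hUM hk hc c).trans
    (mul_le_mul_of_nonneg_left (hcb.trans_eq ?_) hM)
  field_simp
  norm_num

theorem one_add_mul_log_two_le (α : ℝ) : 1 + α * Real.log 2 ≤ 2 ^ α := by
  have := Real.add_one_le_exp (Real.log 2 * α)
  rw [Real.rpow_def_of_pos two_pos]
  linarith

/-- The weighted Schwarz lemma on the circle: a continuous function bounded by `M` with vanishing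
Poisson integral at `-r`. -/
theorem norm_integral_weighted_le (h0 : 0 ≤ α) (hr0 : 0 ≤ r) (hr : r < 1)
    (hU : Continuous U) (hUM : ∀ θ, ‖U θ‖ ≤ M)
    (hk : ∫ θ in (0 : ℝ)..(2 * Real.pi), (circleKernel r θ : ℂ) * U θ = 0) :
    ‖∫ θ in (0 : ℝ)..(2 * Real.pi), (1 + (r : ℂ) * exp (θ * I)) ^ (α : ℂ) * U θ‖ ≤
      M * (2 ^ α * (8 * Real.arctan r)) := by
  have hM : 0 ≤ M := (norm_nonneg _).trans (hUM 0)
  have hbase := norm_integral_le_arctan hr0 hr hU hUM hk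
  rcases le_or_gt 1 α with h1 | h1
  · exact norm_integral_weighted_le_of_one_le h1 hr0 hr hU hUM hk
  rcases h0.eq_or_lt with rfl | h0
  · simpa using hbase
  rcases hr0.eq_or_lt with rfl | hr0
  · simpa using hbase
  have hα : (α : ℂ) ≠ 0 := ofReal_ne_zero.2 h0.ne'
  have hslope := norm_integral_cpowSlope_le h0 h1.le hr0 hr hU hUM hk
  have hSU : Continuous fun θ => cpowSlope α r θ * U θ := (cpowSlope_continuous hr0.le hr).mul hU
  -- `(1 + z)^α = (1 - α) · 1 + α · slope`. The two bounds combine to `(1 - α) + α (1 + log 2) = 1 +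
  -- α log 2`, a minorant of `2^α`.
  have e : ∫ θ in (0 : ℝ)..(2 * Real.pi), (1 + (r : ℂ) * exp (θ * I)) ^ (α : ℂ) * U θ =
      ((1 - α : ℝ) : ℂ) * (∫ θ in (0 : ℝ)..(2 * Real.pi), U θ) +
        (α : ℂ) * ∫ θ in (0 : ℝ)..(2 * Real.pi), cpowSlope α r θ * U θ := by
    rw [← intervalIntegral.integral_const_mul, ← intervalIntegral.integral_const_mul,
      ← intervalIntegral.integral_add ((hU.intervalIntegrable _ _).const_mul _)
        ((hSU.intervalIntegrable _ _).const_mul _)]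
    congr 1
    ext θ
    rw [cpowSlope]
    push_cast
    field_simp
    ring
  rw [e]
  refine (norm_add_le _ _).trans ?_
  rw [norm_mul, norm_mul, norm_real, norm_real, Real.norm_of_nonneg (by linarith),
    Real.norm_of_nonneg h0.le]
  have hA : 0 ≤ M * (8 * Real.arctan r) :=
    mul_nonneg hM (mul_nonneg (by norm_num) (Real.arctan_nonneg.2 hr0.le))
  calc _ ≤ (1 - α) * (M * (8 * Real.arctan r)) +
        α * (M * ((1 + Real.log 2) * (8 * Real.arctan r))) := by
        have : 0 ≤ 1 - α := by linarith
        gcongr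
    _ = (1 + α * Real.log 2) * (M * (8 * Real.arctan r)) := by ring
    _ ≤ 2 ^ α * (M * (8 * Real.arctan r)) :=
        mul_le_mul_of_nonneg_right (one_add_mul_log_two_le α) hA
    _ = _ := by ring

end Weighted

/-! ### Fubini, and characters as test functions on the circle. -/

section Preliminaries

theorem intervalIntegral_swap_of_continuous {a b c d : ℝ} (hab : a ≤ b) (hcd : c ≤ d)
    {F : ℝ → ℝ → ℂ} (hF : Continuous fun p : ℝ × ℝ => F p.1 p.2) :
    ∫ x in a..b, ∫ y in c..d, F x y = ∫ y in c..d, ∫ x in a..b, F x y := by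
  simp only [intervalIntegral.integral_of_le hab, intervalIntegral.integral_of_le hcd]
  refine integral_integral_swap ?_
  rw [Measure.prod_restrict]
  refine IntegrableOn.mono_set (t := Set.Icc a b ×ˢ Set.Icc c d) ?_
    (Set.prod_mono Set.Ioc_subset_Icc_self Set.Ioc_subset_Icc_self)
  exact hF.continuousOn.integrableOn_compact (isCompact_Icc.prod isCompact_Icc)

attribute [local instance] finrank_real_complex_fact' in
theorem contMDiff_circle_coe {m : WithTop ℕ∞} :
    ContMDiff (𝓡 1) 𝓘(ℝ, ℂ) m fun ζ : Circle => (ζ : ℂ) :=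
  contMDiff_coe_sphere

theorem contMDiff_circle_coe_pow (n : ℕ) :
    ContMDiff (𝓡 1) 𝓘(ℝ, ℂ) ∞ fun ζ : Circle => ((ζ ^ n : Circle) : ℂ) :=
  contMDiff_circle_coe.comp (contMDiff_pow n)

theorem contMDiff_circle_coe_zpow (n : ℤ) :
    ContMDiff (𝓡 1) 𝓘(ℝ, ℂ) ∞ fun ζ : Circle => ((ζ ^ n : Circle) : ℂ) := by
  obtain ⟨m, rfl | rfl⟩ := n.eq_nat_or_neg
  · simpa using contMDiff_circle_coe_pow m
  · have h : ContMDiff (𝓡 1) (𝓡 1) ∞ fun ζ : Circle => (ζ ^ m)⁻¹ :=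
      (contMDiff_inv (𝓡 1) ∞).comp (contMDiff_pow m)
    refine (contMDiff_circle_coe.comp h).congr fun ζ => ?_
    simp

theorem HasDistribBoundaryValue.tendsto_fourier {f : ℂ → ℂ} {u : Circle → ℂ}
    (h : HasDistribBoundaryValue f u) (n : ℤ) :
    Tendsto (fun r : ℝ => ∫ θ in (0 : ℝ)..(2 * Real.pi),
        f (r * exp (θ * I)) * exp (θ * I) ^ (-n)) (𝓝[<] 1)
      (𝓝 (∫ θ in (0 : ℝ)..(2 * Real.pi), u (Circle.exp θ) * exp (θ * I) ^ (-n))) := by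
  have := h _ (contMDiff_circle_coe_zpow (-n))
  simpa only [Circle.coe_zpow, Circle.coe_exp] using this

end Preliminaries

/-! ### Convolution with trigonometric polynomials. -/

section TrigPolynomial

variable {η : ℝ → ℝ} {S : Finset ℤ} {w : ℤ → ℂ}

/-- Convolution with a trigonometric polynomial on the circle. -/
theorem integral_trigPolynomial_mul (hη : ∀ t : ℝ, (η t : ℂ) = ∑ n ∈ S, w n * exp (t * I) ^ n)
    {v : ℂ → ℂ} (hv : Continuous fun θ : ℝ => v (exp (θ * I))) (ψ : ℝ) :
    ∫ t in (-Real.pi)..Real.pi, (η t : ℂ) * v (exp (-(t * I)) * exp (ψ * I)) =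
      ∑ n ∈ S, w n * exp (ψ * I) ^ n *
        ∫ θ in (0 : ℝ)..(2 * Real.pi), v (exp (θ * I)) * exp (θ * I) ^ (-n) := by
  have hz : ∀ n : ℤ, Continuous fun θ : ℝ => exp (θ * I) ^ n := fun n =>
    Continuous.zpow₀ (by fun_prop) n fun θ => Or.inl (exp_ne_zero _)
  have hper : Function.Periodic (fun s : ℝ => (η (ψ - s) : ℂ) * v (exp (s * I)))
      (2 * Real.pi) := fun s => by
    have e1 : exp (((s + 2 * Real.pi : ℝ) : ℂ) * I) = exp (s * I) := by
      rw [show ((s + 2 * Real.pi : ℝ) : ℂ) * I = s * I + 2 * Real.pi * I by push_cast; ring]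
      exact exp_periodic _
    have e2 : exp (((ψ - (s + 2 * Real.pi) : ℝ) : ℂ) * I) = exp (((ψ - s : ℝ) : ℂ) * I) := by
      rw [show ((ψ - s : ℝ) : ℂ) * I = ((ψ - (s + 2 * Real.pi) : ℝ) : ℂ) * I + 2 * Real.pi * I by
        push_cast; ring]
      exact (exp_periodic _).symm
    simp only [hη, e1, e2]
  have h1 : ∫ t in (-Real.pi)..Real.pi, (η t : ℂ) * v (exp (-(t * I)) * exp (ψ * I)) =
      ∫ s in (ψ - Real.pi)..(ψ - -Real.pi), (η (ψ - s) : ℂ) * v (exp (s * I)) := by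
    rw [← intervalIntegral.integral_comp_sub_left (fun s => (η (ψ - s) : ℂ) * v (exp (s * I)))]
    congr 1
    ext t
    rw [sub_sub_cancel, ← Complex.exp_add]
    congr 3
    push_cast
    ring
  have h2 := hper.intervalIntegral_add_eq (ψ - Real.pi) 0
  rw [zero_add, show ψ - Real.pi + 2 * Real.pi = ψ - -Real.pi by ring] at h2
  rw [h1, h2]
  have h3 : ∀ s : ℝ, (η (ψ - s) : ℂ) * v (exp (s * I)) =
      ∑ n ∈ S, w n * exp (ψ * I) ^ n * (v (exp (s * I)) * exp (s * I) ^ (-n)) := fun s => by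
    rw [hη, Finset.sum_mul]
    refine Finset.sum_congr rfl fun n _ => ?_
    rw [ofReal_sub, sub_mul, Complex.exp_sub, div_zpow, zpow_neg]
    ring
  simp only [h3]
  rw [intervalIntegral.integral_finsetSum]
  · simp only [intervalIntegral.integral_const_mul]
  · exact fun n _ => ((hv.mul (hz _)).intervalIntegrable _ _).const_mul _

end TrigPolynomial

/-! ### Boundary behaviour of disc automorphisms. -/

section MoebiusOnCircle

variable {a : ℝ} {e : ℂ}

theorem norm_discMoebius_eq_one (ha0 : 0 ≤ a) (ha : a < 1) (he : ‖e‖ = 1) {s : ℂ}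
    (hs : ‖s‖ = 1) : ‖discMoebius a e s‖ = 1 := by
  have h := one_sub_norm_sq_discMoebius ha0 ha he hs.le
  rw [hs] at h
  have h0 := norm_nonneg (discMoebius a e s)
  have : ‖discMoebius a e s‖ ^ 2 = 1 := by
    have : (1 - a ^ 2) * (1 - (1 : ℝ) ^ 2) / ‖1 + a * s‖ ^ 2 = 0 := by simp
    linarith
  nlinarith

theorem one_add_mul_ne_zero (ha0 : 0 ≤ a) (ha : a < 1) {s : ℂ} (hs : ‖s‖ ≤ 1) :
    1 + a * s ≠ 0 :=
  slitPlane_ne_zero (one_add_mul_mem_slitPlane ha0 ha hs)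

theorem hasDerivAt_discMoebius_circle (ha0 : 0 ≤ a) (ha : a < 1) (e : ℂ) (θ : ℝ) :
    HasDerivAt (fun θ : ℝ => discMoebius a e (exp (θ * I)))
      (I * circleKernel a θ * discMoebius a e (exp (θ * I))) θ := by
  have hn := norm_exp_ofReal_mul_I θ
  have hx : HasDerivAt (fun θ : ℝ => exp (θ * I)) (exp (θ * I) * I) θ := by
    have := ((hasDerivAt_id (θ : ℂ)).mul_const I).cexp.comp_ofReal
    simpa using this
  have h := (hasDerivAt_discMoebius ha0 ha e hn.le).comp θ hx
  refine h.congr_deriv ?_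
  have hexp : exp (θ * I) * exp (-(θ * I)) = 1 := by rw [← Complex.exp_add]; simp
  have n1 := one_add_mul_ne_zero ha0 ha hn.le
  have n2 : 1 + (a : ℂ) * exp (-(θ * I)) ≠ 0 := by
    have := one_add_mul_ne_zero ha0 ha (norm_exp_ofReal_mul_I (-θ)).le
    rwa [ofReal_neg, neg_mul] at this
  rw [ofReal_circleKernel ha0 ha, discMoebius]
  field_simp
  linear_combination e * a * (1 + a * exp (θ * I)) * hexp

/-- `Φ` carries `K dθ` to arc length: since `dΦ/dθ = i K Φ` on the circle, `Φ^n / (i n)` is a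
periodic primitive of the integrand. -/
theorem integral_circleKernel_mul_zpow (ha0 : 0 ≤ a) (ha : a < 1) (he : ‖e‖ = 1) {n : ℤ}
    (hn : n ≠ 0) :
    ∫ θ in (0 : ℝ)..(2 * Real.pi),
      (circleKernel a θ : ℂ) * discMoebius a e (exp (θ * I)) ^ n = 0 := by
  have hne : ∀ θ : ℝ, discMoebius a e (exp (θ * I)) ≠ 0 := fun θ h => by
    have := norm_discMoebius_eq_one ha0 ha he (norm_exp_ofReal_mul_I θ)
    rw [h, norm_zero] at this
    exact zero_ne_one this
  have hd : ∀ θ : ℝ, HasDerivAt (fun θ : ℝ => (n * I : ℂ)⁻¹ * discMoebius a e (exp (θ * I)) ^ n)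
      ((circleKernel a θ : ℂ) * discMoebius a e (exp (θ * I)) ^ n) θ := fun θ => by
    have h := ((hasDerivAt_zpow n _ (Or.inl (hne θ))).comp θ
      (hasDerivAt_discMoebius_circle ha0 ha e θ)).const_mul (n * I : ℂ)⁻¹
    refine h.congr_deriv ?_
    have hn' : (n : ℂ) ≠ 0 := Int.cast_ne_zero.2 hn
    have hp := hne θ
    rw [zpow_sub_one₀ hp]
    generalize discMoebius a e (exp (θ * I)) = p at hp ⊢
    field_simp
  rw [intervalIntegral.integral_eq_sub_of_hasDerivAt (fun θ _ => hd θ)]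
  · simp
  · have hc : Continuous fun θ : ℝ => discMoebius a e (exp (θ * I)) :=
      continuous_iff_continuousAt.2 fun θ =>
        (hasDerivAt_discMoebius_circle ha0 ha e θ).continuousAt
    exact (Continuous.mul (Complex.continuous_ofReal.comp (circleKernel_continuous ha0 ha))
      (hc.zpow₀ n fun θ => Or.inl (hne θ))).intervalIntegrable _ _

end MoebiusOnCircle

/-! ### Angular regularisation. -/

section AngularMean

variable {η : ℝ → ℝ} {S : Finset ℤ} {w : ℤ → ℂ} {f : ℂ → ℂ}

/-- The angular Fourier coefficient of `f` on the circle of radius `ρ`. -/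
noncomputable def angularCoeff (f : ℂ → ℂ) (ρ : ℝ) (n : ℤ) : ℂ :=
  ∫ θ in (0 : ℝ)..(2 * Real.pi), f (ρ * exp (θ * I)) * exp (θ * I) ^ (-n)

/-- The angular convolution of `f` with `η`. -/
noncomputable def angularMean (η : ℝ → ℝ) (f : ℂ → ℂ) (z : ℂ) : ℂ :=
  ∫ t in (-Real.pi)..Real.pi, (η t : ℂ) * f (exp (-(t * I)) * z)

theorem norm_exp_neg_mul_I (t : ℝ) : ‖exp (-(t * I))‖ = 1 := by
  rw [show -((t : ℂ) * I) = ((-t : ℝ) : ℂ) * I by push_cast; ring, norm_exp_ofReal_mul_I]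

/-- Only the frequencies of `η` survive, so the regularised function is controlled by finitely many
radial functions, exactly those whose limits the distributional boundary condition supplies. -/
theorem angularMean_eq_sum (hη : ∀ t : ℝ, (η t : ℂ) = ∑ n ∈ S, w n * exp (t * I) ^ n) {z : ℂ}
    (hz : z ≠ 0) (hf : Continuous fun θ : ℝ => f (‖z‖ * exp (θ * I))) :
    angularMean η f z = ∑ n ∈ S, w n * (z / ‖z‖) ^ n * angularCoeff f ‖z‖ n := by
  have h := integral_trigPolynomial_mul hη (v := fun s => f (‖z‖ * s)) hf (arg z)
  have hz' : (‖z‖ : ℂ) ≠ 0 := ofReal_ne_zero.2 (norm_ne_zero_iff.2 hz)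
  have he : exp (arg z * I) = z / ‖z‖ := by
    rw [eq_div_iff hz', mul_comm, norm_mul_exp_arg_mul_I]
  rw [he] at h
  simp only [angularMean, angularCoeff]
  convert h using 4 with t
  field_simp

theorem tendsto_angularMean (hη : ∀ t : ℝ, (η t : ℂ) = ∑ n ∈ S, w n * exp (t * I) ^ n)
    (hf : ContinuousOn f (Metric.ball 0 1)) (hf1 : Continuous fun θ : ℝ => f (exp (θ * I)))
    (hb : ∀ n, Tendsto (fun r => angularCoeff f r n) (𝓝[<] 1) (𝓝 (angularCoeff f 1 n)))
    {ζ : ℂ} (hζ : ‖ζ‖ = 1) :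
    Tendsto (angularMean η f) (𝓝[Metric.ball 0 1] ζ) (𝓝 (angularMean η f ζ)) := by
  have hζ0 : ζ ≠ 0 := norm_ne_zero_iff.1 (by rw [hζ]; exact one_ne_zero)
  have hn : Tendsto (fun z : ℂ => ‖z‖) (𝓝[Metric.ball 0 1] ζ) (𝓝[<] 1) := by
    refine tendsto_nhdsWithin_iff.2 ⟨?_, ?_⟩
    · have := (continuous_norm.tendsto ζ).mono_left
        (nhdsWithin_le_nhds (s := Metric.ball (0 : ℂ) 1))
      rwa [hζ] at this
    · filter_upwards [self_mem_nhdsWithin] with z hz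
      simpa using hz
  have hdiv : Tendsto (fun z : ℂ => z / (‖z‖ : ℂ)) (𝓝[Metric.ball 0 1] ζ) (𝓝 (ζ / (‖ζ‖ : ℂ))) := by
    have hc : ContinuousAt (fun z : ℂ => z / (‖z‖ : ℂ)) ζ :=
      ContinuousAt.div continuousAt_id
        (Complex.continuous_ofReal.comp continuous_norm).continuousAt (by simp [hζ])
    exact hc.tendsto.mono_left nhdsWithin_le_nhds
  rw [angularMean_eq_sum hη hζ0 (by simpa [hζ] using hf1)]
  have hsum : Tendsto (fun z : ℂ => ∑ n ∈ S, w n * (z / ‖z‖) ^ n * angularCoeff f ‖z‖ n)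
      (𝓝[Metric.ball 0 1] ζ) (𝓝 (∑ n ∈ S, w n * (ζ / ‖ζ‖) ^ n * angularCoeff f ‖ζ‖ n)) := by
    refine tendsto_finsetSum _ fun n _ => ?_
    have h2 : Tendsto (fun z : ℂ => angularCoeff f ‖z‖ n) (𝓝[Metric.ball 0 1] ζ)
        (𝓝 (angularCoeff f ‖ζ‖ n)) := by rw [hζ]; exact (hb n).comp hn
    have h3 := hdiv.zpow₀ n (Or.inl (by simp [hζ, hζ0]))
    exact (h3.const_mul (w n)).mul h2
  refine hsum.congr' ?_
  filter_upwards [self_mem_nhdsWithin, nhdsWithin_le_nhds (eventually_ne_nhds hζ0)] with z hz hz0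
  have hzn : ‖z‖ < 1 := by simpa using hz
  refine (angularMean_eq_sum hη hz0 ?_).symm
  exact continuous_circle_comp hf (by rwa [abs_norm])

/-- Supplies the dominating constant for the limit `R → 1`. -/
theorem exists_norm_angularMean_le (hη : ∀ t : ℝ, (η t : ℂ) = ∑ n ∈ S, w n * exp (t * I) ^ n)
    (hf : ContinuousOn f (Metric.ball 0 1))
    (hb : ∀ n, Tendsto (fun r => angularCoeff f r n) (𝓝[<] 1) (𝓝 (angularCoeff f 1 n))) :
    ∃ K : ℝ, ∃ ρ₀ < 1, 0 ≤ ρ₀ ∧ ∀ z : ℂ, ρ₀ < ‖z‖ → ‖z‖ < 1 → ‖angularMean η f z‖ ≤ K := by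
  have ht : Tendsto (fun r => ∑ n ∈ S, ‖w n‖ * ‖angularCoeff f r n‖) (𝓝[<] 1)
      (𝓝 (∑ n ∈ S, ‖w n‖ * ‖angularCoeff f 1 n‖)) :=
    tendsto_finsetSum _ fun n _ => (hb n).norm.const_mul _
  have hev := ht.eventually (ge_mem_nhds (lt_add_one _))
  obtain ⟨ρ₁, hρ₁, h1⟩ := (mem_nhdsLT_iff_exists_Ioo_subset).1 hev
  refine ⟨∑ n ∈ S, ‖w n‖ * ‖angularCoeff f 1 n‖ + 1, max ρ₁ 0, max_lt hρ₁ one_pos, le_max_right _ _, fun z hz hz1 => ?_⟩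
  have hz0 : 0 < ‖z‖ := (le_max_right _ _).trans_lt hz
  rw [angularMean_eq_sum hη (norm_pos_iff.1 hz0) (continuous_circle_comp hf (by rwa [abs_norm]))]
  refine le_trans ?_ (h1 ⟨(le_max_left _ _).trans_lt hz, hz1⟩)
  refine (norm_sum_le _ _).trans_eq (Finset.sum_congr rfl fun n _ => ?_)
  rw [norm_mul, norm_mul, norm_zpow, norm_div, norm_real, norm_norm, div_self hz0.ne', one_zpow,
    mul_one]

theorem norm_angularMean_le {M : ℝ} (hη0 : ∀ t, 0 ≤ η t) (hηc : Continuous η)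
    (hM : ∀ z, ‖z‖ = 1 → ‖f z‖ ≤ M) {z : ℂ} (hz : ‖z‖ = 1) :
    ‖angularMean η f z‖ ≤ M * ∫ t in (-Real.pi)..Real.pi, η t := by
  rw [← intervalIntegral.integral_const_mul]
  refine intervalIntegral.norm_integral_le_of_norm_le (by linarith [Real.pi_pos]) ?_
    ((continuous_const.mul hηc).intervalIntegrable _ _)
  refine Eventually.of_forall fun t _ => ?_
  rw [norm_mul, norm_real, Real.norm_of_nonneg (hη0 t), mul_comm]
  exact mul_le_mul_of_nonneg_right (hM _ (by rw [norm_mul, norm_exp_neg_mul_I, hz, one_mul]))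
    (hη0 t)

end AngularMean

/-! ### The growth estimate for angular means. -/

section Boundary

variable {η : ℝ → ℝ} {S : Finset ℤ} {w : ℤ → ℂ} {f g : ℂ → ℂ} {α a G M : ℝ} {e : ℂ}

theorem continuous_discMoebius_circle (ha0 : 0 ≤ a) (ha : a < 1) (e : ℂ) {R : ℝ}
    (hR0 : 0 ≤ R) (hR : R ≤ 1) : Continuous fun θ : ℝ => discMoebius a e (R * exp (θ * I)) := by
  unfold discMoebius
  refine continuous_const.mul (Continuous.div (by fun_prop) (by fun_prop) fun θ => ?_)
  exact one_add_mul_ne_zero ha0 ha (by rwa [norm_radius_mul_exp hR0])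

theorem continuous_one_add_mul_cpow (ha0 : 0 ≤ a) (ha : a < 1) {R : ℝ} (hR0 : 0 ≤ R) (hR : R ≤ 1)
    (β : ℂ) : Continuous fun θ : ℝ => (1 + (a : ℂ) * (R * exp (θ * I))) ^ β :=
  Continuous.cpow (by fun_prop) continuous_const fun θ =>
    one_add_mul_mem_slitPlane ha0 ha (by rwa [norm_radius_mul_exp hR0])

/-- The Möbius mean bound, averaged over rotations. -/
theorem moebius_angularMean_bound (hη0 : ∀ t, 0 ≤ η t) (hηc : Continuous η) (hα : 0 ≤ α)
    (hf : ContDiffOn ℝ 2 f (Metric.ball 0 1)) (hg : ContinuousOn g (Metric.ball 0 1))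
    (hG : ∀ z ∈ Metric.ball (0 : ℂ) 1, ‖g z‖ ≤ G)
    (heq : ∀ z ∈ Metric.ball (0 : ℂ) 1, weightedLaplacian α f z = g z)
    (ha0 : 0 ≤ a) (ha : a < 1) (he : ‖e‖ = 1) {R : ℝ} (hR0 : 0 ≤ R) (hR : R < 1) :
    ‖(∫ θ in (0 : ℝ)..(2 * Real.pi), (1 + a * (R * exp (θ * I))) ^ (α : ℂ) *
        angularMean η f (discMoebius a e (R * exp (θ * I)))) -
      2 * Real.pi * angularMean η f (e * a)‖ ≤
      2 * Real.pi * (2 ^ α * (G * (1 - a ^ 2) ^ (α + 1))) * ∫ t in (-Real.pi)..Real.pi, η t := by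
  have hpi := Real.pi_pos
  have hΦ := continuous_discMoebius_circle ha0 ha e hR0 hR.le
  have hh := continuous_one_add_mul_cpow ha0 ha hR0 hR.le (α : ℂ)
  have hmem : ∀ θ t : ℝ, exp (-(t * I)) * discMoebius a e (R * exp (θ * I)) ∈
      Metric.ball (0 : ℂ) 1 := fun θ t => by
    rw [mem_ball_zero_iff, norm_mul, norm_exp_neg_mul_I, one_mul]
    exact norm_discMoebius_lt_one ha0 ha he (by rwa [norm_radius_mul_exp hR0])
  have hmem' : ∀ t : ℝ, exp (-(t * I)) * (e * a) ∈ Metric.ball (0 : ℂ) 1 := fun t => by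
    rw [mem_ball_zero_iff, norm_mul, norm_mul, norm_exp_neg_mul_I, he, norm_real,
      Real.norm_of_nonneg ha0]
    linarith
  have hη' : Continuous fun t => (η t : ℂ) := Complex.continuous_ofReal.comp hηc
  have hjoint : Continuous fun p : ℝ × ℝ => (1 + (a : ℂ) * (R * exp (p.1 * I))) ^ (α : ℂ) *
      ((η p.2 : ℂ) * f (exp (-(p.2 * I)) * discMoebius a e (R * exp (p.1 * I)))) := by
    refine (hh.comp continuous_fst).mul ((hη'.comp continuous_snd).mul ?_)
    refine hf.continuousOn.comp_continuous (Continuous.mul (by fun_prop) (hΦ.comp continuous_fst))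
      fun p => hmem p.1 p.2
  -- A rotation of `Φ` only changes the unimodular factor `e`, on which the bound does not depend.
  have hswap : ∫ θ in (0 : ℝ)..(2 * Real.pi), (1 + a * (R * exp (θ * I))) ^ (α : ℂ) *
        angularMean η f (discMoebius a e (R * exp (θ * I))) =
      ∫ t in (-Real.pi)..Real.pi, (η t : ℂ) *
        ∫ θ in (0 : ℝ)..(2 * Real.pi), (1 + a * (R * exp (θ * I))) ^ (α : ℂ) *
          f (discMoebius a (exp (-(t * I)) * e) (R * exp (θ * I))) := by
    simp only [angularMean, ← intervalIntegral.integral_const_mul]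
    rw [intervalIntegral_swap_of_continuous (by positivity) (by linarith) hjoint]
    refine intervalIntegral.integral_congr fun t _ => ?_
    refine intervalIntegral.integral_congr fun θ _ => ?_
    simp only [discMoebius, mul_assoc]
    ring
  have hIc : Continuous fun t : ℝ => (η t : ℂ) *
        ∫ θ in (0 : ℝ)..(2 * Real.pi), (1 + a * (R * exp (θ * I))) ^ (α : ℂ) *
          f (discMoebius a (exp (-(t * I)) * e) (R * exp (θ * I))) := by
    refine hη'.mul (intervalIntegral.continuous_parametric_intervalIntegral_of_continuous' ?_ _ _)
    refine (hh.comp continuous_snd).mul (hf.continuousOn.comp_continuous (f := fun p : ℝ × ℝ =>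
      discMoebius a (exp (-(p.1 * I)) * e) (R * exp (p.2 * I))) ?_ fun p => ?_)
    · have : Continuous fun p : ℝ × ℝ => exp (-(p.1 * I)) * discMoebius a e (R * exp (p.2 * I)) :=
        Continuous.mul (by fun_prop) (hΦ.comp continuous_snd)
      refine this.congr fun p => ?_
      simp only [discMoebius, mul_assoc]
    · have := hmem p.2 p.1
      simpa only [discMoebius, mul_assoc] using this
  have hfc : Continuous fun t : ℝ => (η t : ℂ) * f (exp (-(t * I)) * (e * a)) :=
    hη'.mul (hf.continuousOn.comp_continuous (by fun_prop) hmem')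
  rw [hswap, angularMean, ← intervalIntegral.integral_const_mul,
    ← intervalIntegral.integral_sub (hIc.intervalIntegrable _ _)
      ((hfc.intervalIntegrable _ _).const_mul _), ← intervalIntegral.integral_const_mul]
  refine intervalIntegral.norm_integral_le_of_norm_le (by linarith) ?_
    ((continuous_const.mul hηc).intervalIntegrable _ _)
  refine Eventually.of_forall fun t _ => ?_
  have h := moebius_mean_bound hα hf hg hG heq ha0 ha (e := exp (-(t * I)) * e)
    (by rw [norm_mul, norm_exp_neg_mul_I, he, one_mul]) hR0 hR
  rw [mul_left_comm, ← mul_sub, norm_mul, norm_real, Real.norm_of_nonneg (hη0 t), mul_comm,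
    ← mul_assoc (exp _) e]
  exact mul_le_mul_of_nonneg_right h (hη0 t)

end Boundary

section Boundary

variable {η : ℝ → ℝ} {S : Finset ℤ} {w : ℤ → ℂ} {f g : ℂ → ℂ} {α a G M : ℝ} {e : ℂ}

theorem tendsto_discMoebius_radial (ha0 : 0 ≤ a) (ha : a < 1) (he : ‖e‖ = 1) (θ : ℝ) :
    Tendsto (fun R : ℝ => discMoebius a e (R * exp (θ * I))) (𝓝[<] 1)
      (𝓝[Metric.ball 0 1] discMoebius a e (exp (θ * I))) := by
  have hn := norm_exp_ofReal_mul_I θ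
  refine tendsto_nhdsWithin_iff.2 ⟨?_, ?_⟩
  · have h1 : Tendsto (fun R : ℝ => (R : ℂ) * exp (θ * I)) (𝓝[<] 1) (𝓝 (exp (θ * I))) := by
      have h : Continuous fun R : ℝ => (R : ℂ) * exp (θ * I) := by fun_prop
      have h2 := (h.tendsto 1).mono_left (nhdsWithin_le_nhds (s := Set.Iio 1))
      simpa using h2
    exact (hasDerivAt_discMoebius ha0 ha e hn.le).continuousAt.tendsto.comp h1
  · filter_upwards [Ioo_mem_nhdsLT (zero_lt_one' ℝ)] with R hR
    rw [mem_ball_zero_iff]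
    exact norm_discMoebius_lt_one ha0 ha he (by rw [norm_radius_mul_exp hR.1.le]; exact hR.2)

/-- Uniform in `θ`, because `1 - |Φ|² ≤ (1 - R²) / (1 - a)²` on `|s| = R`. -/
theorem eventually_lt_norm_discMoebius (ha0 : 0 ≤ a) (ha : a < 1) (he : ‖e‖ = 1) {ρ : ℝ}
    (hρ0 : 0 ≤ ρ) (hρ : ρ < 1) :
    ∀ᶠ R : ℝ in 𝓝[<] 1, ∀ θ : ℝ, ρ < ‖discMoebius a e (R * exp (θ * I))‖ := by
  have ht : Tendsto (fun R : ℝ => (1 - R ^ 2) / (1 - a) ^ 2) (𝓝[<] 1) (𝓝 0) := by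
    have h : Continuous fun R : ℝ => (1 - R ^ 2) / (1 - a) ^ 2 := by fun_prop
    have h2 := (h.tendsto 1).mono_left (nhdsWithin_le_nhds (s := Set.Iio 1))
    simpa using h2
  have hρ2 : 0 < 1 - ρ ^ 2 := by nlinarith
  filter_upwards [ht.eventually (gt_mem_nhds hρ2), Ioo_mem_nhdsLT (zero_lt_one' ℝ)]
    with R hR hR01 θ
  have hs : ‖(R : ℂ) * exp (θ * I)‖ = R := norm_radius_mul_exp hR01.1.le θ
  have h := one_sub_norm_sq_discMoebius ha0 ha he (hs.trans_le hR01.2.le)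
  have hd : 1 - a ≤ ‖1 + (a : ℂ) * (R * exp (θ * I))‖ := by
    have := norm_sub_norm_le (1 : ℂ) (-((a : ℂ) * (R * exp (θ * I))))
    rw [norm_one, norm_neg, norm_mul, hs, norm_real, Real.norm_of_nonneg ha0, sub_neg_eq_add]
      at this
    nlinarith [hR01.2]
  have h1a : 0 < 1 - a := sub_pos.2 ha
  have hle : (1 - a ^ 2) * (1 - R ^ 2) / ‖1 + (a : ℂ) * (R * exp (θ * I))‖ ^ 2 ≤
      (1 - R ^ 2) / (1 - a) ^ 2 := by
    have : 0 ≤ 1 - R ^ 2 := by nlinarith [hR01.1, hR01.2]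
    have : (1 - a ^ 2) * (1 - R ^ 2) ≤ 1 - R ^ 2 := by nlinarith [sq_nonneg a]
    gcongr
  rw [hs] at h
  have hn := norm_nonneg (discMoebius a e (R * exp (θ * I)))
  by_contra hc
  have := pow_le_pow_left₀ hn (not_lt.1 hc) 2
  linarith

/-- The growth estimate for angular means against a nonnegative trigonometric polynomial. -/
theorem norm_angularMean_le_of_solution
    (hη : ∀ t : ℝ, (η t : ℂ) = ∑ n ∈ S, w n * exp (t * I) ^ n)
    (hη0 : ∀ t, 0 ≤ η t) (hηc : Continuous η) (hα : 0 ≤ α)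
    (hf : ContDiffOn ℝ 2 f (Metric.ball 0 1)) (hg : ContinuousOn g (Metric.ball 0 1))
    (hG : ∀ z ∈ Metric.ball (0 : ℂ) 1, ‖g z‖ ≤ G)
    (heq : ∀ z ∈ Metric.ball (0 : ℂ) 1, weightedLaplacian α f z = g z)
    (hf1 : Continuous fun θ : ℝ => f (exp (θ * I))) (hM : ∀ z, ‖z‖ = 1 → ‖f z‖ ≤ M)
    (hb : ∀ n, Tendsto (fun r => angularCoeff f r n) (𝓝[<] 1) (𝓝 (angularCoeff f 1 n)))
    (h0 : angularCoeff f 1 0 = 0) (ha0 : 0 ≤ a) (ha : a < 1) (he : ‖e‖ = 1) :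
    ‖angularMean η f (e * a)‖ ≤ 2 ^ α * (4 / Real.pi * M * Real.arctan a +
      G * (1 - a ^ 2) ^ (α + 1)) * ∫ t in (-Real.pi)..Real.pi, η t := by
  have hpi := Real.pi_pos
  set J := ∫ t in (-Real.pi)..Real.pi, η t
  have hΦ1 : ∀ θ : ℝ, ‖discMoebius a e (exp (θ * I))‖ = 1 := fun θ =>
    norm_discMoebius_eq_one ha0 ha he (norm_exp_ofReal_mul_I θ)
  have hΦ0 : ∀ θ : ℝ, discMoebius a e (exp (θ * I)) ≠ 0 := fun θ h => by
    have := hΦ1 θ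
    rw [h, norm_zero] at this
    exact zero_ne_one this
  have hΦc : Continuous fun θ : ℝ => discMoebius a e (exp (θ * I)) := by
    simpa using continuous_discMoebius_circle ha0 ha e zero_le_one le_rfl
  set U : ℝ → ℂ := fun θ => angularMean η f (discMoebius a e (exp (θ * I))) with hUdef
  have hUeq : ∀ θ, U θ = ∑ n ∈ S, w n * angularCoeff f 1 n * discMoebius a e (exp (θ * I)) ^ n :=
    fun θ => by
    rw [hUdef]
    simp only
    rw [angularMean_eq_sum hη (hΦ0 θ) (by simpa [hΦ1] using hf1), hΦ1]
    refine Finset.sum_congr rfl fun n _ => ?_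
    rw [ofReal_one, div_one]
    ring
  have hUc : Continuous U := by
    rw [show U = fun θ : ℝ => ∑ n ∈ S, w n * angularCoeff f 1 n * discMoebius a e (exp (θ * I)) ^ n
      from funext hUeq]
    exact continuous_finsetSum _ fun n _ =>
      continuous_const.mul (hΦc.zpow₀ n fun θ => Or.inl (hΦ0 θ))
  have hUM : ∀ θ, ‖U θ‖ ≤ M * J := fun θ => norm_angularMean_le hη0 hηc hM (hΦ1 θ)
  have hkc : Continuous fun θ => (circleKernel a θ : ℂ) :=
    Complex.continuous_ofReal.comp (circleKernel_continuous ha0 ha)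
  -- Term by term: the zeroth coefficient vanishes by the mean-zero hypothesis, and the other powers
  -- of `Φ` are orthogonal to the kernel.
  have hk : ∫ θ in (0 : ℝ)..(2 * Real.pi), (circleKernel a θ : ℂ) * U θ = 0 := by
    simp only [hUeq, Finset.mul_sum]
    have hint : ∀ n : ℤ, Continuous fun θ : ℝ => (circleKernel a θ : ℂ) *
        (w n * angularCoeff f 1 n * discMoebius a e (exp (θ * I)) ^ n) := fun n =>
      hkc.mul (continuous_const.mul (hΦc.zpow₀ n fun θ => Or.inl (hΦ0 θ)))
    rw [intervalIntegral.integral_finsetSum fun n _ => (hint n).intervalIntegrable _ _]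
    refine Finset.sum_eq_zero fun n _ => ?_
    rcases eq_or_ne n 0 with rfl | hn
    · simp [h0]
    · simp only [mul_left_comm _ (w n * angularCoeff f 1 n)]
      rw [intervalIntegral.integral_const_mul, integral_circleKernel_mul_zpow ha0 ha he hn,
        mul_zero]
  have hweighted := norm_integral_weighted_le hα ha0 ha hUc hUM hk
  have hlim : Tendsto (fun R : ℝ => ∫ θ in (0 : ℝ)..(2 * Real.pi),
      (1 + (a : ℂ) * (R * exp (θ * I))) ^ (α : ℂ) *
        angularMean η f (discMoebius a e (R * exp (θ * I)))) (𝓝[<] 1)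
      (𝓝 (∫ θ in (0 : ℝ)..(2 * Real.pi), (1 + (a : ℂ) * exp (θ * I)) ^ (α : ℂ) * U θ)) := by
    obtain ⟨K, ρ₀, hρ₀, hρ₀', hK⟩ := exists_norm_angularMean_le hη hf.continuousOn hb
    refine intervalIntegral.tendsto_integral_filter_of_dominated_convergence
      (fun _ => 2 ^ α * K) ?_ ?_ (by simp) ?_
    · filter_upwards [Ioo_mem_nhdsLT (zero_lt_one' ℝ)] with R hR
      have hΦ := continuous_discMoebius_circle ha0 ha e hR.1.le hR.2.le
      refine Continuous.aestronglyMeasurable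
        ((continuous_one_add_mul_cpow ha0 ha hR.1.le hR.2.le _).mul
          (intervalIntegral.continuous_parametric_intervalIntegral_of_continuous' ?_ _ _))
      refine Continuous.mul (Complex.continuous_ofReal.comp (hηc.comp continuous_snd))
        (hf.continuousOn.comp_continuous
          (Continuous.mul (by fun_prop) (hΦ.comp continuous_fst)) fun p => ?_)
      rw [mem_ball_zero_iff, norm_mul, norm_exp_neg_mul_I, one_mul]
      exact norm_discMoebius_lt_one ha0 ha he (by rw [norm_radius_mul_exp hR.1.le]; exact hR.2)
    · filter_upwards [eventually_lt_norm_discMoebius ha0 ha he hρ₀' hρ₀,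
        Ioo_mem_nhdsLT (zero_lt_one' ℝ)] with R hR hR01
      refine Eventually.of_forall fun θ _ => ?_
      have hn : ‖(R : ℂ) * exp (θ * I)‖ = R := norm_radius_mul_exp hR01.1.le θ
      have h1 := hK _ (hR θ) (norm_discMoebius_lt_one ha0 ha he (by rw [hn]; exact hR01.2))
      rw [norm_mul]
      refine mul_le_mul ?_ h1 (norm_nonneg _) (by positivity)
      rw [norm_cpow_real]
      refine Real.rpow_le_rpow (norm_nonneg _) ((norm_add_le _ _).trans ?_) hα
      rw [norm_one, norm_mul, hn, norm_real, Real.norm_of_nonneg ha0]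
      nlinarith [hR01.1, hR01.2]
    · refine Eventually.of_forall fun θ _ => ?_
      refine Tendsto.mul ?_ ((tendsto_angularMean hη hf.continuousOn hf1 hb (hΦ1 θ)).comp
        (tendsto_discMoebius_radial ha0 ha he θ))
      have hc : ContinuousAt (fun R : ℝ => (1 + (a : ℂ) * (R * exp (θ * I))) ^ (α : ℂ)) 1 := by
        refine ContinuousAt.cpow (by fun_prop) continuousAt_const ?_
        rw [ofReal_one, one_mul]
        exact one_add_mul_mem_slitPlane ha0 ha (norm_exp_ofReal_mul_I θ).le
      have := hc.tendsto.mono_left (nhdsWithin_le_nhds (s := Set.Iio 1))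
      simpa using this
  -- The Möbius mean bound is uniform in `R`, hence survives `R → 1`.
  have hbound := le_of_tendsto ((hlim.sub_const (2 * Real.pi * angularMean η f (e * a))).norm)
    (by
      filter_upwards [Ioo_mem_nhdsLT (zero_lt_one' ℝ)] with R hR
      exact moebius_angularMean_bound hη0 hηc hα hf hg hG heq ha0 ha he hR.1.le hR.2)
  have h2 : ‖2 * Real.pi * angularMean η f (e * a)‖ ≤ M * J * (2 ^ α * (8 * Real.arctan a)) +
      2 * Real.pi * (2 ^ α * (G * (1 - a ^ 2) ^ (α + 1))) * J := by
    have := norm_le_norm_add_norm_sub' (2 * Real.pi * angularMean η f (e * a))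
      (∫ θ in (0 : ℝ)..(2 * Real.pi), (1 + (a : ℂ) * exp (θ * I)) ^ (α : ℂ) * U θ)
    rw [norm_sub_rev] at this
    linarith
  rw [norm_mul, norm_mul, norm_real, Real.norm_of_nonneg hpi.le,
    show ‖(2 : ℂ)‖ = 2 by simp] at h2
  have h3 : 2 * Real.pi * (2 ^ α * (4 / Real.pi * M * Real.arctan a +
      G * (1 - a ^ 2) ^ (α + 1)) * J) = M * J * (2 ^ α * (8 * Real.arctan a)) +
      2 * Real.pi * (2 ^ α * (G * (1 - a ^ 2) ^ (α + 1))) * J := by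
    field_simp
    ring
  rw [← h3] at h2
  exact le_of_mul_le_mul_left h2 (by positivity)

end Boundary

/-! ### Removing the regularisation. -/

section Peak

/-- The Fejér-type kernel concentrating at the origin. -/
noncomputable def cosPeak (t : ℝ) : ℝ := (1 + Real.cos t) / 2

theorem cosPeak_nonneg (t : ℝ) : 0 ≤ cosPeak t := by
  have := Real.neg_one_le_cos t
  unfold cosPeak
  linarith

theorem continuous_cosPeak : Continuous cosPeak := by
  unfold cosPeak
  fun_prop

/-- `cosPeak t = (1 + e^{it})² / (4 e^{it})`; the binomial theorem gives the coefficients. -/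
theorem cosPeak_pow_eq_sum (N : ℕ) : ∃ (S : Finset ℤ) (w : ℤ → ℂ), ∀ t : ℝ,
    ((cosPeak t ^ N : ℝ) : ℂ) = ∑ n ∈ S, w n * exp (t * I) ^ n := by
  refine ⟨(Finset.range (2 * N + 1)).image fun j : ℕ => (j : ℤ) - N,
    fun n => (4⁻¹) ^ N * (2 * N).choose (n + N).toNat, fun t => ?_⟩
  have h0 : exp (t * I) ≠ 0 := exp_ne_zero _
  have h1 : (cosPeak t : ℂ) = 4⁻¹ * ((1 + exp (t * I)) ^ 2 * (exp (t * I))⁻¹) := by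
    have hc : 2 * Complex.cos t = exp (t * I) + (exp (t * I))⁻¹ := by
      rw [Complex.cos, neg_mul, Complex.exp_neg]; ring
    rw [cosPeak]
    push_cast
    field_simp
    field_simp at hc
    linear_combination 2 * hc
  rw [Finset.sum_image fun i _ j _ h => by simpa using h, ofReal_pow, h1, mul_pow, mul_pow,
    ← pow_mul, add_comm 1, add_pow, Finset.sum_mul, Finset.mul_sum]
  refine Finset.sum_congr rfl fun j _ => ?_
  beta_reduce
  rw [sub_add_cancel, Int.toNat_natCast, zpow_sub₀ h0, zpow_natCast, zpow_natCast, one_pow,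
    inv_pow]
  ring

theorem cosPeak_lt_cosPeak_zero {t : ℝ} (ht : t ∈ Set.Icc (-Real.pi) Real.pi) (h0 : t ≠ 0) :
    cosPeak t < cosPeak 0 := by
  have h1 : Real.cos t ≠ 1 := fun h =>
    h0 ((Real.cos_eq_one_iff_of_lt_of_lt (by linarith [ht.1, Real.pi_pos])
      (by linarith [ht.2, Real.pi_pos])).1 h)
  have h2 := lt_of_le_of_ne (Real.cos_le_one t) h1
  unfold cosPeak
  rw [Real.cos_zero]
  linarith

variable {f g : ℂ → ℂ} {α G M : ℝ}

/-- `cosPeak` has a unique maximum at `0` on `[-π, π]`, so its normalised powers concentrate there.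
-/
theorem tendsto_angularMean_cosPeak {z : ℂ} (hf : ContinuousOn f (Metric.ball 0 1))
    (hz : ‖z‖ < 1) :
    Tendsto (fun N : ℕ => (∫ t in (-Real.pi)..Real.pi, cosPeak t ^ N)⁻¹ •
      angularMean (fun t => cosPeak t ^ N) f z) atTop (𝓝 (f z)) := by
  have hpi := Real.pi_pos
  have hc : Continuous fun t : ℝ => f (exp (-(t * I)) * z) :=
    hf.comp_continuous (by fun_prop) fun t => by
      rwa [mem_ball_zero_iff, norm_mul, norm_exp_neg_mul_I, one_mul]
  have h := tendsto_setIntegral_pow_smul_of_unique_maximum_of_isCompact_of_continuousOn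
    (μ := volume) (s := Set.Icc (-Real.pi) Real.pi) (x₀ := 0) (c := cosPeak)
    (g := fun t : ℝ => f (exp (-(t * I)) * z)) isCompact_Icc continuous_cosPeak.continuousOn
    (fun t ht h0 => cosPeak_lt_cosPeak_zero ht h0) (fun t _ => cosPeak_nonneg t)
    (by simp [cosPeak]) (by
      rw [interior_Icc, closure_Ioo (by linarith)]
      exact ⟨by linarith, by linarith⟩) hc.continuousOn
  simp only [ofReal_zero, zero_mul, neg_zero, Complex.exp_zero, one_mul] at h
  refine h.congr fun N => ?_
  rw [angularMean, intervalIntegral.integral_of_le (by linarith),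
    intervalIntegral.integral_of_le (by linarith), integral_Icc_eq_integral_Ioc,
    integral_Icc_eq_integral_Ioc]
  simp only [real_smul]

theorem norm_le_of_solution (hα : 0 ≤ α)
    (hf : ContDiffOn ℝ 2 f (Metric.ball 0 1)) (hg : ContinuousOn g (Metric.ball 0 1))
    (hG0 : 0 ≤ G) (hG : ∀ z ∈ Metric.ball (0 : ℂ) 1, ‖g z‖ ≤ G)
    (heq : ∀ z ∈ Metric.ball (0 : ℂ) 1, weightedLaplacian α f z = g z)
    (hf1 : Continuous fun θ : ℝ => f (exp (θ * I))) (hM : ∀ z, ‖z‖ = 1 → ‖f z‖ ≤ M)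
    (hb : ∀ n, Tendsto (fun r => angularCoeff f r n) (𝓝[<] 1) (𝓝 (angularCoeff f 1 n)))
    (h0 : angularCoeff f 1 0 = 0) {z : ℂ} (hz : ‖z‖ < 1) :
    ‖f z‖ ≤ 2 ^ α * (4 / Real.pi * M * Real.arctan ‖z‖ + G * (1 - ‖z‖ ^ 2) ^ (α + 1)) := by
  have hM0 : 0 ≤ M := (norm_nonneg _).trans (hM 1 norm_one)
  have hx : 0 ≤ 1 - ‖z‖ ^ 2 := by nlinarith [norm_nonneg z]
  have hB : 0 ≤ 2 ^ α * (4 / Real.pi * M * Real.arctan ‖z‖ + G * (1 - ‖z‖ ^ 2) ^ (α + 1)) := by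
    have := Real.arctan_nonneg.2 (norm_nonneg z)
    have := Real.pi_pos
    positivity
  obtain ⟨e, he, hez⟩ : ∃ e : ℂ, ‖e‖ = 1 ∧ z = e * (‖z‖ : ℝ) :=
    ⟨exp (arg z * I), norm_exp_ofReal_mul_I _, by rw [mul_comm, norm_mul_exp_arg_mul_I]⟩
  refine le_of_tendsto (tendsto_angularMean_cosPeak hf.continuousOn hz).norm
    (Eventually.of_forall fun N => ?_)
  obtain ⟨S, w, hSw⟩ := cosPeak_pow_eq_sum N
  have h := norm_angularMean_le_of_solution (η := fun t => cosPeak t ^ N) hSw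
    (fun t => pow_nonneg (cosPeak_nonneg t) N) (continuous_cosPeak.pow N) hα hf hg hG heq hf1 hM hb
    h0 (norm_nonneg z) hz he
  rw [← hez] at h
  have hJ : 0 ≤ ∫ t in (-Real.pi)..Real.pi, cosPeak t ^ N :=
    intervalIntegral.integral_nonneg (by linarith [Real.pi_pos])
      fun t _ => pow_nonneg (cosPeak_nonneg t) N
  rw [norm_smul, norm_inv, Real.norm_of_nonneg hJ]
  refine (mul_le_mul_of_nonneg_left h (inv_nonneg.2 hJ)).trans ?_
  rw [mul_left_comm]
  exact mul_le_of_le_one_right hB (inv_mul_le_one)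

end Peak

/-! ### The inequality on the closed disc. -/

section Main

theorem norm_le_supNormCircle {u : Circle → ℂ} (hu : Continuous u) (ζ : Circle) :
    ‖u ζ‖ ≤ supNormCircle u :=
  le_ciSup (isCompact_range hu.norm).bddAbove ζ

theorem norm_le_supNormDisc {g : ℂ → ℂ} (hg : ContinuousOn g (Metric.closedBall 0 1)) {z : ℂ}
    (hz : z ∈ Metric.ball (0 : ℂ) 1) : ‖g z‖ ≤ supNormDisc g := by
  refine le_ciSup (f := fun z : Metric.ball (0 : ℂ) 1 => ‖g z‖) ?_ ⟨z, hz⟩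
  refine ((isCompact_closedBall (0 : ℂ) 1).bddAbove_image hg.norm).mono ?_
  rintro _ ⟨y, rfl⟩
  exact ⟨y, Metric.ball_subset_closedBall y.2, rfl⟩

/-- `P_α(0) = 1` for every `α`, so the value of the Poisson integral at the origin is the mean of
`u`. -/
theorem integral_eq_zero_of_alphaPoissonIntegral_zero {α : ℝ} {u : Circle → ℂ}
    (h : alphaPoissonIntegral α u 0 = 0) :
    ∫ θ in (0 : ℝ)..(2 * Real.pi), u (Circle.exp θ) = 0 := by
  simpa [alphaPoissonIntegral, alphaPoissonKernel, Real.pi_ne_zero] using h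

theorem norm_le_of_solvesDirichlet {α : ℝ} {g : ℂ → ℂ} {u : Circle → ℂ} {f : ℂ → ℂ} (hα : 0 ≤ α)
    (hg : ContinuousOn g (Metric.closedBall (0 : ℂ) 1)) (hu : Continuous u)
    (hf : ContDiffOn ℝ 2 f (Metric.ball (0 : ℂ) 1)) (h : SolvesDirichlet α g u f)
    (h0 : alphaPoissonIntegral α u 0 = 0) {z : ℂ} (hz : z ∈ Metric.closedBall (0 : ℂ) 1) :
    ‖f z‖ ≤ 2 ^ α * (4 / Real.pi * supNormCircle u * Real.arctan ‖z‖ +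
      supNormDisc g * (1 - ‖z‖ ^ 2) ^ (α + 1)) := by
  have hval : ∀ θ : ℝ, f (exp (θ * I)) = u (Circle.exp θ) := fun θ => by
    rw [← h.values_on_circle, Circle.coe_exp]
  have hM : ∀ z, ‖z‖ = 1 → ‖f z‖ ≤ supNormCircle u := fun z hz => by
    have := h.values_on_circle ⟨z, mem_sphere_zero_iff_norm.2 hz⟩
    rw [this]
    exact norm_le_supNormCircle hu _
  have hz1 : ‖z‖ ≤ 1 := mem_closedBall_zero_iff.1 hz
  rcases hz1.eq_or_lt with hz1 | hz1
  · have h2 : 1 ≤ (2 : ℝ) ^ α := Real.one_le_rpow one_le_two hα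
    have hM0 : 0 ≤ supNormCircle u := (norm_nonneg _).trans (hM z hz1)
    -- On the circle the bound reduces to `2^α ‖u‖`, as `(4/π) arctan 1 = 1`.
    rw [hz1, Real.arctan_one, one_pow, sub_self, Real.zero_rpow (by linarith), mul_zero, add_zero]
    have e : 4 / Real.pi * supNormCircle u * (Real.pi / 4) = supNormCircle u := by
      have := Real.pi_ne_zero
      field_simp
    rw [e]
    exact (hM z hz1).trans (le_mul_of_one_le_left hM0 h2)
  · refine norm_le_of_solution hα hf (hg.mono Metric.ball_subset_closedBall)
      ((norm_nonneg _).trans (norm_le_supNormDisc hg (Metric.mem_ball_self one_pos)))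
      (fun z hz => norm_le_supNormDisc hg hz) h.equation ?_ hM (fun n => ?_) ?_ hz1
    · simp only [hval]
      exact hu.comp Circle.exp.continuous
    · have := h.boundary.tendsto_fourier n
      simpa only [angularCoeff, ofReal_one, one_mul, hval] using this
    · have := integral_eq_zero_of_alphaPoissonIntegral_zero h0
      simpa [angularCoeff, hval] using this

end Main

/-! ### The extremal function `C (1 - |z|²)`. -/

section Extremal

theorem ofReal_mul_one_sub_norm_sq (C : ℝ) (z : ℂ) :
    ((C * (1 - ‖z‖ ^ 2) : ℝ) : ℂ) = C * (1 - z * (starRingEnd ℂ) z) := by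
  rw [mul_conj, normSq_eq_norm_sq]
  push_cast
  ring

theorem wirtingerDbar_paraboloid (C : ℝ) (z : ℂ) :
    wirtingerDbar (fun z => ((C * (1 - ‖z‖ ^ 2) : ℝ) : ℂ)) z = -C * z := by
  simp only [ofReal_mul_one_sub_norm_sq]
  refine HasFDerivAt.wirtingerDbar_eq (p := -C * (starRingEnd ℂ) z) ?_
  have h := ((hasDerivAt_id z).hasFDerivAt_wirtinger.wirtinger_mul
    (hasFDerivAt_conj_wirtinger z)).const_sub 1 |>.const_mul (C : ℂ)
  refine h.congr_fderiv (ContinuousLinearMap.ext fun v => ?_)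
  simp [wirtingerForm_apply]
  ring

theorem weightedLaplacian_zero_paraboloid (C : ℝ) (z : ℂ) :
    weightedLaplacian 0 (fun z => ((C * (1 - ‖z‖ ^ 2) : ℝ) : ℂ)) z = -C := by
  rw [weightedLaplacian]
  simp only [wirtingerDbar_paraboloid, neg_zero, Real.rpow_zero, ofReal_one, one_mul]
  refine HasFDerivAt.wirtingerD_eq (q := 0) ?_
  simpa using ((hasDerivAt_id z).const_mul (-C : ℂ)).hasFDerivAt_wirtinger

theorem contDiff_paraboloid (C : ℝ) {n : WithTop ℕ∞} :
    ContDiff ℝ n fun z : ℂ => ((C * (1 - ‖z‖ ^ 2) : ℝ) : ℂ) :=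
  ofRealCLM.contDiff.comp (contDiff_const.mul (contDiff_const.sub (contDiff_norm_sq ℝ)))

theorem solvesDirichlet_paraboloid (C : ℝ) :
    SolvesDirichlet 0 (fun _ => -(C : ℂ)) (fun _ => 0)
      (fun z => ((C * (1 - ‖z‖ ^ 2) : ℝ) : ℂ)) where
  equation z _ := weightedLaplacian_zero_paraboloid C z
  values_on_circle ζ := by rw [Circle.norm_coe]; simp
  boundary φ _ := by
    have e : ∀ r : ℝ, ∫ θ in (0 : ℝ)..(2 * Real.pi),
        ((C * (1 - ‖(r : ℂ) * (Circle.exp θ : ℂ)‖ ^ 2) : ℝ) : ℂ) * φ (Circle.exp θ) =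
        ((C * (1 - r ^ 2) : ℝ) : ℂ) * ∫ θ in (0 : ℝ)..(2 * Real.pi), φ (Circle.exp θ) := fun r => by
      rw [← intervalIntegral.integral_const_mul]
      simp
    simp only [e, zero_mul, intervalIntegral.integral_zero]
    have h : Continuous fun r : ℝ =>
        ((C * (1 - r ^ 2) : ℝ) : ℂ) * ∫ θ in (0 : ℝ)..(2 * Real.pi), φ (Circle.exp θ) := by
      fun_prop
    simpa using (h.tendsto 1).mono_left (nhdsWithin_le_nhds (s := Set.Iio 1))

theorem supNormCircle_zero : supNormCircle (fun _ => 0) = 0 := by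
  simp [supNormCircle]

theorem supNormDisc_neg_const {C : ℝ} (hC : 0 ≤ C) : supNormDisc (fun _ => -(C : ℂ)) = C := by
  have : Nonempty (Metric.ball (0 : ℂ) 1) := ⟨⟨0, Metric.mem_ball_self one_pos⟩⟩
  rw [supNormDisc, ciSup_const, norm_neg, norm_real, Real.norm_of_nonneg hC]

end Extremal

theorem theorem2p1 :
    (∀ (α : ℝ) (g : ℂ → ℂ) (fstar : Circle → ℂ) (f : ℂ → ℂ),
      0 ≤ α →
      ContinuousOn g (Metric.closedBall (0 : ℂ) 1) →
      ContMDiff (𝓡 1) 𝓘(ℝ, ℂ) 1 fstar →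
      ContDiffOn ℝ 2 f (Metric.ball (0 : ℂ) 1) →
      SolvesDirichlet α g fstar f →
      alphaPoissonIntegral α fstar 0 = 0 →
      ∀ z ∈ Metric.closedBall (0 : ℂ) 1,
        ‖f z‖ ≤ (2 : ℝ) ^ α *
          (4 / Real.pi * supNormCircle fstar * Real.arctan ‖z‖
            + supNormDisc g * (1 - ‖z‖ ^ 2) ^ (α + 1))) ∧
    (∀ (C : ℝ) (g : ℂ → ℂ) (fstar : Circle → ℂ) (f : ℂ → ℂ),
      0 < C →
      g = (fun _ => -(C : ℂ)) →
      fstar = (fun _ => 0) →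
      f = (fun z => ((C * (1 - ‖z‖ ^ 2) : ℝ) : ℂ)) →
      ContinuousOn g (Metric.closedBall (0 : ℂ) 1) ∧
      ContMDiff (𝓡 1) 𝓘(ℝ, ℂ) 1 fstar ∧
      ContDiffOn ℝ 2 f (Metric.ball (0 : ℂ) 1) ∧
      SolvesDirichlet 0 g fstar f ∧
      alphaPoissonIntegral 0 fstar 0 = 0 ∧
      ∀ z ∈ Metric.closedBall (0 : ℂ) 1,
        ‖f z‖ = (2 : ℝ) ^ (0 : ℝ) *
          (4 / Real.pi * supNormCircle fstar * Real.arctan ‖z‖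
            + supNormDisc g * (1 - ‖z‖ ^ 2) ^ ((0 : ℝ) + 1))) := by
  refine ⟨fun α g fstar f hα hg hfs hf h h0 z hz =>
    norm_le_of_solvesDirichlet hα hg hfs.continuous hf h h0 hz, ?_⟩
  rintro C g fstar f hC rfl rfl rfl
  refine ⟨continuousOn_const, contMDiff_const, (contDiff_paraboloid C).contDiffOn,
    solvesDirichlet_paraboloid C, by simp [alphaPoissonIntegral], fun z hz => ?_⟩
  have hz1 : ‖z‖ ≤ 1 := mem_closedBall_zero_iff.1 hz
  have hx : 0 ≤ 1 - ‖z‖ ^ 2 := by nlinarith [norm_nonneg z]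
  rw [supNormCircle_zero, supNormDisc_neg_const hC.le, norm_real,
    Real.norm_of_nonneg (mul_nonneg hC.le hx)]
  simp
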